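/- **Conventions.** A modulated quiver $(Q,\mathcal M)$ over $\mathbb R$ is a finite quiver $Q$ with a division algebra $\mathcal M(i)\in\{\mathbb R,\mathbb C,\mathbb H\}$ for each vertex $i$ and a simple $\mathcal M(t(\alpha))$-$\mathcal M(s(\alpha))$-bimodule $\mathcal M(\alpha)$ for each arrow $\alpha$; paths are composed from right to left, and $\mathcal M(\alpha\beta)=\mathcal M(\alpha)\otimes\mathcal M(\beta)$. Let $T(Q,\mathcal M)$ be the tensor algebra of the bimodule $\bigoplus_\alpha\mathcal M(\alpha)$ over $\prod_i\mathcal M(i)$. Write $\mathbf i$ for the unit $i$ of $\mathbb C$, and $\mathbf j,\mathbf k,\mathbf l$ for the quaternion units, with $\mathbf j\mathbf k=\mathbf l$. Let $\mathbf e\in T(Q,\mathcal M)\otimes_{\mathbb R}\mathbb C$ be the idempotent with component $1\otimes1$ at the vertices with $\mathcal M(i)\in\{\mathbb R,\mathbb C\}$ and $(1\otimes 1-\mathbf j\otimes\mathbf i)/2$ at the vertices with $\mathcal M(i)=\mathbb H$. Let $\Gamma$ be the complexified quiver: a vertex $i$ with $\mathcal M(i)=\mathbb C$ gives two vertices $i,\bar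 i$, any other vertex gives one; an arrow with bimodule ${}_{\mathbb R}\mathbb R_{\mathbb R}$ or ${}_{\mathbb H}\mathbb H_{\mathbb H}$ gives one arrow $\alpha$, any other arrow gives two arrows $\alpha,\bar\alpha$ between the vertices over its end points. Let $\Psi:\mathbf e(T(Q,\mathcal M)\otimes_{\mathbb R}\mathbb C)\mathbf e\to\mathbb C\Gamma$ be the standard isomorphism of $\mathbb C$-algebras. For an ideal $I$ of $T(Q,\mathcal M)$ put $J=\Psi(\mathbf e(I\otimes_{\mathbb R}\mathbb C)\mathbf e)$; then $\mathbb C\Gamma/J$ is Morita equivalent to $(T(Q,\mathcal M)/I)\otimes_{\mathbb R}\mathbb C$. A $\mathbb C$-algebra is *gentle* if it is finite-dimensional and Morita equivalent to some $\mathbb CQ'/I'$ with $Q'$ a finite quiver and $I'$ an ideal generated by paths of length two, such that at each vertex $v$ at most two arrows start and at most two arrows end; for an arrow $\alpha$ starting at $v$ and two different arrows $\beta,\gamma$ ending at $v$, exactly one of $\alpha\beta,\alpha\gamma$ lies in $I'$; and for an arrow $\alpha$ ending at $v$ and two different arrows $\beta,\gamma$ starting at $v$, exactly one of $\beta\alpha,\gamma\alpha$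 lies in $I'$. A vertex $v$ is *ordinarily gentle* in $T(Q,\mathcal M)/I$ if at most two arrows start and at most two arrows end at $v$; $I$ includes exactly one of $\mathcal M(\alpha\beta),\mathcal M(\alpha\gamma)$ (respectively of $\mathcal M(\beta\alpha),\mathcal M(\gamma\alpha)$) for $\alpha,\beta,\gamma$ as above; and either $v$ and all its neighbours carry $\mathbb R$, or they all carry $\mathbb H$, or $\mathcal M(v)=\mathbb C$ and $I\cap\mathcal M(\alpha\beta)\in\{0,\mathcal M(\alpha\beta)\}$ for all $\cdot\xrightarrow{\beta}v\xrightarrow{\alpha}\cdot$ whose outer end points do not carry $\mathbb C$. A vertex $v$, neither a source nor a sink, is *specially gentle* in $T(Q,\mathcal M)/I$ if $\mathcal M(v)\in\{\mathbb R,\mathbb H\}$, all arrows ending at $v$ start at one vertex $x$ and all arrows starting at $v$ end at one vertex $y$, there are two arrows $\beta,\beta^{\mathbf i}:x\to v$ if $\mathcal M(x)=\mathcal M(v)$ and a single arrow $\beta$ otherwise, there are two arrows $\alpha,\alpha^{\mathbf i}:v\to y$ if $\mathcal M(y)=\mathcal M(v)$ and a single arrow $\alpha$ otherwise, and $I$ includes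 exactly one of the two complementary $\mathcal M(y)$-$\mathcal M(x)$-subbimodules $I_v^0,I_v^1$ of $\bigoplus\mathcal M(\text{arrow }v\to y)\otimes\mathcal M(\text{arrow }x\to v)$ generated by the following elements (those for $I_v^0$ first, then those for $I_v^1$). Here $x_\alpha$ denotes $x$ as an element of $\mathcal M(\alpha)$, and in the row and column bimodules $\mathbb C^2$ the symbol $1$ stands for $[1\ 0]$ and $\begin{bmatrix}1\\0\end{bmatrix}$; $\mathbb H$ acts on them as the algebra of matrices $\begin{bmatrix}a&b\\-\bar b&\bar a\end{bmatrix}$, with $\mathbf j=\begin{bmatrix}\mathbf i&0\\0&-\mathbf i\end{bmatrix}$ and $\mathbf k=\begin{bmatrix}0&1\\-1&0\end{bmatrix}$. For $(\mathcal M(x),\mathcal M(v),\mathcal M(y))$ equal to - $(\mathbb R,\mathbb R,\mathbb R)$: $I_v^0$ by $1_\alpha\otimes1_\beta-1_{\alpha^{\mathbf i}}\otimes1_{\beta^{\mathbf i}}$ and $-1_\alpha\otimes1_{\beta^{\mathbf i}}-1_{\alpha^{\mathbf i}}\otimes1_\beta$; $I_v^1$ by $1_\alpha\otimes1_\beta+1_{\alpha^{\mathbf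 i}}\otimes1_{\beta^{\mathbf i}}$ and $1_\alpha\otimes1_{\beta^{\mathbf i}}-1_{\alpha^{\mathbf i}}\otimes1_\beta$; - $(\mathbb R,\mathbb R,\mathbb H)$ or $(\mathbb R,\mathbb R,\mathbb C)$: $1_\alpha\otimes1_\beta+c_\alpha\otimes1_{\beta^{\mathbf i}}$; respectively $1_\alpha\otimes1_\beta-c_\alpha\otimes1_{\beta^{\mathbf i}}$, with $c=\mathbf j$ or $\mathbf i$; - $(\mathbb H,\mathbb H,\mathbb R)$ or $(\mathbb H,\mathbb H,\mathbb C)$: $1_\alpha\otimes1_\beta+1_\alpha\otimes\mathbf j_{\beta^{\mathbf i}}$; respectively $1_\alpha\otimes\mathbf k_\beta-1_\alpha\otimes\mathbf l_{\beta^{\mathbf i}}$; - $(\mathbb H,\mathbb H,\mathbb H)$: $1_\alpha\otimes1_\beta-1_{\alpha^{\mathbf i}}\otimes1_{\beta^{\mathbf i}}+1_\alpha\otimes\mathbf j_{\beta^{\mathbf i}}+1_{\alpha^{\mathbf i}}\otimes\mathbf j_\beta$; respectively $1_\alpha\otimes\mathbf k_\beta+1_{\alpha^{\mathbf i}}\otimes\mathbf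 k_{\beta^{\mathbf i}}-1_\alpha\otimes\mathbf l_{\beta^{\mathbf i}}+1_{\alpha^{\mathbf i}}\otimes\mathbf l_\beta$; - $(\mathbb H,\mathbb R,\mathbb R)$ or $(\mathbb C,\mathbb R,\mathbb R)$: $1_\alpha\otimes1_\beta+1_{\alpha^{\mathbf i}}\otimes c_\beta$; respectively $1_\alpha\otimes1_\beta-1_{\alpha^{\mathbf i}}\otimes c_\beta$, with $c=\mathbf j$ or $\mathbf i$; - $(\mathbb R,\mathbb H,\mathbb H)$: $1_\alpha\otimes1_\beta+1_{\alpha^{\mathbf i}}\otimes\mathbf j_\beta$; respectively $1_\alpha\otimes\mathbf k_\beta+1_{\alpha^{\mathbf i}}\otimes\mathbf l_\beta$; - $(\mathbb C,\mathbb H,\mathbb H)$: $1_\alpha\otimes1_\beta+\mathbf j_{\alpha^{\mathbf i}}\otimes1_\beta$; respectively $\mathbf k_\alpha\otimes1_\beta+\mathbf l_{\alpha^{\mathbf i}}\otimes1_\beta$. (Other triples, and sources and sinks, do not occur at the vertex $v$ below.) **Proposition.** Let $I$ be an ideal of $T(Q,\mathcal M)$, and assume one of the following. 1. $(Q,\mathcal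 M)$ is one of $$\mathbb R\xrightarrow{\mathbb R}\mathbb R\xrightarrow{\mathbb H}\mathbb H,\quad \mathbb R\xrightarrow{\mathbb R}\mathbb R\xrightarrow{\mathbb C}\mathbb C,\quad \mathbb H\xrightarrow{\mathbb H}\mathbb H\xrightarrow{\mathbb H}\mathbb R,\quad \mathbb H\xrightarrow{\mathbb H}\mathbb H\xrightarrow{\mathbb C^2}\mathbb C,$$ or the opposite of one of these, and $I$ is admissible, i.e. contained in the square of the ideal generated by $\bigoplus_\alpha\mathcal M(\alpha)$. 2. $(Q,\mathcal M)$ is one of $$\mathbb R\xrightarrow{\mathbb R}\mathbb R_u\overset{\mathbb R}{\underset{\mathbb R}{\rightrightarrows}}\mathbb R_v\overset{\mathbb R}{\underset{\mathbb R}{\rightrightarrows}}\mathbb R,\quad \mathbb R\xrightarrow{\mathbb R}\mathbb R_u\overset{\mathbb R}{\underset{\mathbb R}{\rightrightarrows}}\mathbb R_v\xrightarrow{\mathbb H}\mathbb H,\quad \mathbb R\xrightarrow{\mathbb R}\mathbb R_u\overset{\mathbb R}{\underset{\mathbb R}{\rightrightarrows}}\mathbb R_v\xrightarrow{\mathbb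 C}\mathbb C,$$ $$\mathbb H\xrightarrow{\mathbb H}\mathbb H_u\overset{\mathbb H}{\underset{\mathbb H}{\rightrightarrows}}\mathbb H_v\xrightarrow{\mathbb H}\mathbb R,\quad \mathbb H\xrightarrow{\mathbb H}\mathbb H_u\overset{\mathbb H}{\underset{\mathbb H}{\rightrightarrows}}\mathbb H_v\overset{\mathbb H}{\underset{\mathbb H}{\rightrightarrows}}\mathbb H,\quad \mathbb H\xrightarrow{\mathbb H}\mathbb H_u\overset{\mathbb H}{\underset{\mathbb H}{\rightrightarrows}}\mathbb H_v\xrightarrow{\mathbb C^2}\mathbb C,$$ or the opposite of one of these, $u$ is ordinarily gentle in $T(Q,\mathcal M)/I$ and $v$ is specially gentle in $T(Q,\mathcal M)/I$. Then the complexification $\mathbb C\Gamma/J$ is not a gentle algebra. -/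

import Mathlib

open scoped Quaternion TensorProduct

noncomputable section

/-! ### Path algebras and gentle algebras -/

/-- A finite quiver `(V, E, s, t)`. -/
structure FinQuiver where
  V : Type
  E : Type
  [fintypeV : Fintype V]
  [fintypeE : Fintype E]
  s : E → V
  t : E → V

attribute [instance] FinQuiver.fintypeV FinQuiver.fintypeE

namespace FinQuiver

variable (k : Type) [Field k] (Q : FinQuiver)

/-- The defining relations of the path algebra `kQ` on the generators `e_v` (`v` a vertex) and
`a` (an arrow). Products are written as compositions: `a * b` is the path "first `b`, then `a`". -/
inductive PathRel : FreeAlgebra k (Q.V ⊕ Q.E) → FreeAlgebra k (Q.V ⊕ Q.E) → Prop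
  | idem (v : Q.V) : PathRel
      (FreeAlgebra.ι k (Sum.inl v) * FreeAlgebra.ι k (Sum.inl v)) (FreeAlgebra.ι k (Sum.inl v))
  | ortho (v w : Q.V) (h : v ≠ w) : PathRel
      (FreeAlgebra.ι k (Sum.inl v) * FreeAlgebra.ι k (Sum.inl w)) 0
  | one : PathRel (∑ v : Q.V, FreeAlgebra.ι k (Sum.inl v)) 1
  | target (a : Q.E) : PathRel
      (FreeAlgebra.ι k (Sum.inl (Q.t a)) * FreeAlgebra.ι k (Sum.inr a)) (FreeAlgebra.ι k (Sum.inr a))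
  | source (a : Q.E) : PathRel
      (FreeAlgebra.ι k (Sum.inr a) * FreeAlgebra.ι k (Sum.inl (Q.s a))) (FreeAlgebra.ι k (Sum.inr a))

/-- The path algebra `kQ`. -/
abbrev PathAlg : Type := RingQuot (PathRel k Q)

/-- The trivial path `e_v`. -/
def vertex (v : Q.V) : PathAlg k Q :=
  RingQuot.mkAlgHom k (PathRel k Q) (FreeAlgebra.ι k (Sum.inl v))

/-- The arrow `a`, as an element of the path algebra. -/
def arrow (a : Q.E) : PathAlg k Q :=
  RingQuot.mkAlgHom k (PathRel k Q) (FreeAlgebra.ι k (Sum.inr a))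

variable {k Q}

/-- The vertex `v` of `kQ/I` is a gentle vertex: at most two arrows start and at most two arrows end
at `v`; and if two arrows on one side of `v` are composed with an arrow on the other side, then
exactly one of the two products lies in `I`. -/
structure GentleVertex (I : TwoSidedIdeal (PathAlg k Q)) (v : Q.V) : Prop where
  card_out : {a : Q.E | Q.s a = v}.ncard ≤ 2
  card_in : {a : Q.E | Q.t a = v}.ncard ≤ 2
  xor_in : ∀ a b c : Q.E, Q.s a = v → Q.t b = v → Q.t c = v → b ≠ c →
    Xor (arrow k Q a * arrow k Q b ∈ I) (arrow k Q a * arrow k Q c ∈ I)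
  xor_out : ∀ a b c : Q.E, Q.t a = v → Q.s b = v → Q.s c = v → b ≠ c →
    Xor (arrow k Q b * arrow k Q a ∈ I) (arrow k Q c * arrow k Q a ∈ I)

/-- The ideal is generated by a set of paths of length two. -/
def GeneratedByPathsOfLengthTwo (I : TwoSidedIdeal (PathAlg k Q)) : Prop :=
  ∃ P : Set (Q.E × Q.E), (∀ p ∈ P, Q.s p.1 = Q.t p.2) ∧
    I = TwoSidedIdeal.span ((fun p => arrow k Q p.1 * arrow k Q p.2) '' P)

end FinQuiver

/-- A `k`-algebra is locally gentle if it is Morita equivalent to `kQ/I` for a finite quiver `Q`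
and an ideal `I` generated by paths of length two, such that every vertex is gentle. -/
def IsLocallyGentle (k : Type) [Field k] (A : Type) [Ring A] [Algebra k A] : Prop :=
  ∃ (Q : FinQuiver) (I : TwoSidedIdeal (Q.PathAlg k)),
    (∀ v, FinQuiver.GentleVertex I v) ∧ FinQuiver.GeneratedByPathsOfLengthTwo I ∧
      IsMoritaEquivalent k A I.ringCon.Quotient

/-- A gentle algebra is a finite-dimensional locally gentle algebra. -/
def IsGentle (k : Type) [Field k] (A : Type) [Ring A] [Algebra k A] : Prop :=
  IsLocallyGentle k A ∧ FiniteDimensional k A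

/-! ### Modulated quivers over `ℝ` -/

/-- The quaternion units. They are the matrices `[i 0; 0 -i]`, `[0 1; -1 0]`, `[0 i; i 0]` when
`ℍ` is viewed as the real algebra of complex matrices `[a b; -b̄ ā]`. -/
def qi : ℍ[ℝ] := ⟨0, 1, 0, 0⟩
/-- See `qi`. -/
def qj : ℍ[ℝ] := ⟨0, 0, 1, 0⟩
/-- See `qi`. -/
def qk : ℍ[ℝ] := ⟨0, 0, 0, 1⟩

/-- The names of the three finite-dimensional real division algebras. -/
inductive DivAlg
  | real
  | cpx
  | quat
deriving DecidableEq

/-- The division algebras `ℝ`, `ℂ`, `ℍ`, all three realized inside `ℍ`; here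
`ℂ = ℝ + ℝ qi` consists of the matrices `[a 0; 0 ā]`. -/
def DivAlg.toSub : DivAlg → Subalgebra ℝ ℍ[ℝ]
  | .real => ⊥
  | .cpx => Quaternion.ofComplex.range
  | .quat => ⊤

/-- The simple `D_t`-`D_s`-bimodules, realized inside `ℍ` with both actions given by
multiplication in `ℍ`:
* `ℝ` over `ℝ`-`ℝ`, and `ℍ` over `ℍ`-`ℍ`, `ℝ`-`ℍ` and `ℍ`-`ℝ`;
* `ℂ` over `ℝ`-`ℂ`, `ℂ`-`ℝ` and `ℂ`-`ℂ`;
* the column space `[ℂ; ℂ]` over `ℍ`-`ℂ` is `ℍ`, the column `[a; b]` being the quaternion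
  `[a -b̄; b ā]` with this first column;
* the row space `[ℂ ℂ]` over `ℂ`-`ℍ` is `ℍ`, the row `[a b]` being the quaternion
  `[a b; -b̄ ā]` with this first row;
* if `tw` holds, over `ℂ`-`ℂ`, the conjugate bimodule `ℂ̄` (on which `ℂ` acts from the right
  through conjugation), realized as `ℂ qj`. -/
def simpleBimod (t s : DivAlg) (tw : Bool) : Submodule ℝ ℍ[ℝ] :=
  match t, s with
  | .real, .real => Subalgebra.toSubmodule DivAlg.real.toSub
  | .real, .cpx => Subalgebra.toSubmodule DivAlg.cpx.toSub
  | .cpx, .real => Subalgebra.toSubmodule DivAlg.cpx.toSub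
  | .cpx, .cpx => if tw then
      (Subalgebra.toSubmodule DivAlg.cpx.toSub).map (LinearMap.mulRight ℝ qj)
      else Subalgebra.toSubmodule DivAlg.cpx.toSub
  | .real, .quat => ⊤
  | .quat, .real => ⊤
  | .quat, .cpx => ⊤
  | .cpx, .quat => ⊤
  | .quat, .quat => ⊤

theorem mem_real_iff (x : ℍ[ℝ]) : x ∈ DivAlg.real.toSub ↔ x.imI = 0 ∧ x.imJ = 0 ∧ x.imK = 0 := by
  constructor
  · intro h
    obtain ⟨r, rfl⟩ := Algebra.mem_bot.1 h
    exact ⟨rfl, rfl, rfl⟩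
  · rintro ⟨h1, h2, h3⟩
    refine Algebra.mem_bot.2 ⟨x.re, ?_⟩
    ext
    · rfl
    · exact h1.symm
    · exact h2.symm
    · exact h3.symm

theorem mem_cpx_iff (x : ℍ[ℝ]) : x ∈ DivAlg.cpx.toSub ↔ x.imJ = 0 ∧ x.imK = 0 := by
  constructor
  · rintro ⟨z, rfl⟩
    simp
  · rintro ⟨h1, h2⟩
    refine ⟨⟨x.re, x.imI⟩, ?_⟩
    ext <;> simp [h1, h2]

theorem mem_conj_iff (x : ℍ[ℝ]) :
    x ∈ (Subalgebra.toSubmodule DivAlg.cpx.toSub).map (LinearMap.mulRight ℝ qj) ↔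
      x.re = 0 ∧ x.imI = 0 := by
  constructor
  · rintro ⟨z, hz, rfl⟩
    obtain ⟨h1, h2⟩ := (mem_cpx_iff z).1 hz
    change (z * qj).re = 0 ∧ (z * qj).imI = 0
    have e1 : qj.re = 0 := rfl
    have e2 : qj.imI = 0 := rfl
    have e3 : qj.imK = 0 := rfl
    rw [Quaternion.re_mul, Quaternion.imI_mul]
    simp [e1, e2, e3, h1, h2]
  · rintro ⟨h1, h2⟩
    obtain ⟨z, z1, z2, z3, z4⟩ : ∃ z : ℍ[ℝ], z.re = x.imJ ∧ z.imI = x.imK ∧ z.imJ = 0 ∧ z.imK = 0 :=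
      ⟨⟨x.imJ, x.imK, 0, 0⟩, rfl, rfl, rfl, rfl⟩
    refine ⟨z, (mem_cpx_iff _).2 ⟨z3, z4⟩, ?_⟩
    change z * qj = x
    have e1 : qj.re = 0 := rfl
    have e2 : qj.imI = 0 := rfl
    have e3 : qj.imJ = 1 := rfl
    have e4 : qj.imK = 0 := rfl
    apply Quaternion.ext <;>
      simp [Quaternion.re_mul, Quaternion.imI_mul, Quaternion.imJ_mul, Quaternion.imK_mul,
        e1, e2, e3, e4, z1, z2, z3, z4, h1, h2]

theorem left_mul_mem (t s : DivAlg) (tw : Bool) {d m : ℍ[ℝ]} (hd : d ∈ t.toSub)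
    (hm : m ∈ simpleBimod t s tw) : d * m ∈ simpleBimod t s tw := by
  cases t <;> cases s <;> cases tw <;>
    simp_all [simpleBimod, mem_real_iff, mem_cpx_iff, mem_conj_iff, -Submodule.mem_map]

theorem right_mul_mem (t s : DivAlg) (tw : Bool) {d m : ℍ[ℝ]} (hd : d ∈ s.toSub)
    (hm : m ∈ simpleBimod t s tw) : m * d ∈ simpleBimod t s tw := by
  cases t <;> cases s <;> cases tw <;>
    simp_all [simpleBimod, mem_real_iff, mem_cpx_iff, mem_conj_iff, -Submodule.mem_map]

/-- A modulated quiver over `ℝ`: the vertex `i` carries the division algebra `M i`, and the arrow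
`a` carries the simple `M (t a)`-`M (s a)`-bimodule `simpleBimod (M (t a)) (M (s a)) (tw a)`.
The flag `tw a` only matters if both ends of `a` carry `ℂ`. -/
structure ModQuiver where
  V : Type
  E : Type
  [fintypeV : Fintype V]
  [fintypeE : Fintype E]
  [decEqV : DecidableEq V]
  [decEqE : DecidableEq E]
  s : E → V
  t : E → V
  M : V → DivAlg
  tw : E → Bool

attribute [instance] ModQuiver.fintypeV ModQuiver.fintypeE ModQuiver.decEqV ModQuiver.decEqE

namespace ModQuiver

/-- The opposite modulated quiver. -/
def op (Q : ModQuiver) : ModQuiver where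
  V := Q.V
  E := Q.E
  s := Q.t
  t := Q.s
  M := Q.M
  tw := Q.tw

variable (Q : ModQuiver)

/-- The bimodule of an arrow. -/
abbrev bimod (a : Q.E) : Submodule ℝ ℍ[ℝ] := simpleBimod (Q.M (Q.t a)) (Q.M (Q.s a)) (Q.tw a)

/-- The ring `∏ i, M i`. -/
abbrev Base : Type := ∀ i : Q.V, (Q.M i).toSub

/-- The bimodule `⨁ a, M a` over `∏ i, M i` (the quiver is finite). -/
abbrev Arrows : Type := ∀ a : Q.E, Q.bimod a

/-- The left action of `∏ i, M i` on `⨁ a, M a`. -/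
def lact (x : Q.Base) (m : Q.Arrows) : Q.Arrows :=
  fun a => ⟨x (Q.t a) * m a, left_mul_mem _ _ _ (x (Q.t a)).2 (m a).2⟩

/-- The right action of `∏ i, M i` on `⨁ a, M a`. -/
def ract (m : Q.Arrows) (x : Q.Base) : Q.Arrows :=
  fun a => ⟨m a * x (Q.s a), right_mul_mem _ _ _ (x (Q.s a)).2 (m a).2⟩

/-- The relations which make the real tensor algebra of `S ⊕ X`, with `S = ∏ i, M i` and
`X = ⨁ a, M a`, into the tensor algebra of the `S`-bimodule `X` over `S`. -/
inductive TensorRel :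
    TensorAlgebra ℝ (Q.Base × Q.Arrows) → TensorAlgebra ℝ (Q.Base × Q.Arrows) → Prop
  | one : TensorRel (TensorAlgebra.ι ℝ (1, 0)) 1
  | mul (x y : Q.Base) : TensorRel
      (TensorAlgebra.ι ℝ (x, 0) * TensorAlgebra.ι ℝ (y, 0)) (TensorAlgebra.ι ℝ (x * y, 0))
  | left (x : Q.Base) (m : Q.Arrows) : TensorRel
      (TensorAlgebra.ι ℝ (x, 0) * TensorAlgebra.ι ℝ (0, m)) (TensorAlgebra.ι ℝ (0, Q.lact x m))
  | right (m : Q.Arrows) (x : Q.Base) : TensorRel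
      (TensorAlgebra.ι ℝ (0, m) * TensorAlgebra.ι ℝ (x, 0)) (TensorAlgebra.ι ℝ (0, Q.ract m x))

/-- The tensor algebra `T(Q, M)` of a modulated quiver. -/
abbrev T : Type := RingQuot Q.TensorRel

/-- The canonical map from `(∏ i, M i) ⊕ (⨁ a, M a)` to `T(Q, M)`. -/
def toT : Q.Base × Q.Arrows →ₗ[ℝ] Q.T :=
  (RingQuot.mkAlgHom ℝ Q.TensorRel).toLinearMap ∘ₗ TensorAlgebra.ι ℝ

/-- An element `d` of `M i`, as an element of `T(Q, M)`. -/
def vert (i : Q.V) (d : (Q.M i).toSub) : Q.T := Q.toT (Pi.single i d, 0)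

/-- An element `m` of `M a`, as an element of `T(Q, M)`. -/
def arr (a : Q.E) (m : Q.bimod a) : Q.T := Q.toT (0, Pi.single a m)

open Classical in
/-- The element `x` of `M i ⊆ ℍ`, as an element of `T(Q, M)`; only used if `x` lies in `M i`. -/
def vertEl (i : Q.V) (x : ℍ[ℝ]) : Q.T := if h : x ∈ (Q.M i).toSub then Q.vert i ⟨x, h⟩ else 0

open Classical in
/-- The element `x_a` of `M a ⊆ ℍ`, as an element of `T(Q, M)`; only used if `x` lies in `M a`. -/
def arrEl (a : Q.E) (x : ℍ[ℝ]) : Q.T := if h : x ∈ Q.bimod a then Q.arr a ⟨x, h⟩ else 0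

/-- The square of the arrow ideal, i.e. the ideal `⨁_{n ≥ 2} (⨁ a, M a)^{⊗ n}`. -/
def arrowIdealSq : TwoSidedIdeal Q.T :=
  TwoSidedIdeal.span {z | ∃ (a b : Q.E) (m : Q.bimod a) (n : Q.bimod b), z = Q.arr a m * Q.arr b n}

/-! ### The complexified quiver -/

/-- The vertex `i` has two fibers `(i, false) = i` and `(i, true) = ī` if `M i = ℂ`, and otherwise
one fiber. -/
abbrev GV : Type := {p : Q.V × Bool // p.2 = true → Q.M p.1 = .cpx}

/-- The arrow `a` has one fiber if `M a` is `ℝ` over `ℝ`-`ℝ` or `ℍ` over `ℍ`-`ℍ`, and otherwise two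
fibers `(a, false) = a` and `(a, true) = ā`. -/
abbrev GE : Type := {p : Q.E × Bool // p.2 = true →
  ¬ (Q.M (Q.t p.1) = Q.M (Q.s p.1) ∧ Q.M (Q.s p.1) ≠ .cpx)}

/-- The source of a fiber `a` or `ā`. Over a source `i` with `M i = ℂ` it is `i` resp. `ī`,
and the other way round if `M a` is the conjugate bimodule. -/
def gs (p : Q.GE) : Q.GV :=
  ⟨(Q.s p.1.1, decide (Q.M (Q.s p.1.1) = .cpx) &&
      (p.1.2 ^^ (Q.tw p.1.1 && decide (Q.M (Q.t p.1.1) = .cpx)))), by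
    intro h
    simp only [Bool.and_eq_true, decide_eq_true_eq] at h
    exact h.1⟩

/-- The target of a fiber `a` or `ā`. Over a target `j` with `M j = ℂ` it is `j` resp. `j̄`. -/
def gt (p : Q.GE) : Q.GV :=
  ⟨(Q.t p.1.1, decide (Q.M (Q.t p.1.1) = .cpx) && p.1.2), by
    intro h
    simp only [Bool.and_eq_true, decide_eq_true_eq] at h
    exact h.1⟩

/-- The complexified quiver `Γ`. -/
def Gam : FinQuiver where
  V := Q.GV
  E := Q.GE
  s := Q.gs
  t := Q.gt

/-! ### The isomorphism `Ψ : e (T(Q, M) ⊗ ℂ) e ≅ ℂΓ`, through its inverse -/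

/-- The complexification of the tensor algebra. -/
abbrev TC : Type := ℂ ⊗[ℝ] Q.T

/-- The idempotents of `T(Q, M) ⊗ ℂ` which correspond to the vertices of `Γ`:
`1 ⊗ 1` if `M i = ℝ`, `(1 ⊗ 1 - qi ⊗ i)/2` if `M i = ℍ`, and
`(1 ⊗ 1 - qi ⊗ i)/2`, `(1 ⊗ 1 + qi ⊗ i)/2` for `i`, `ī` if `M i = ℂ`. -/
def eps (w : Q.GV) : Q.TC :=
  if Q.M w.1.1 = .real then 1 ⊗ₜ Q.vertEl w.1.1 1
  else if w.1.2 then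
    (1 / 2 : ℂ) • ((1 : ℂ) ⊗ₜ Q.vertEl w.1.1 1 + Complex.I ⊗ₜ Q.vertEl w.1.1 qi)
  else
    (1 / 2 : ℂ) • ((1 : ℂ) ⊗ₜ Q.vertEl w.1.1 1 - Complex.I ⊗ₜ Q.vertEl w.1.1 qi)

/-- The element of `M a` whose image under the idempotents corresponds to the fiber `a` or `ā`. -/
def gen (p : Q.GE) : ℍ[ℝ] :=
  match Q.M (Q.t p.1.1), Q.M (Q.s p.1.1) with
  | .cpx, .cpx => if Q.tw p.1.1 then qj else 1
  | .quat, .real => if p.1.2 then qj else 1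
  | .quat, .cpx => if p.1.2 then qj else 1
  | .real, .quat => if p.1.2 then -qj else 1
  | .cpx, .quat => if p.1.2 then -qj else 1
  | _, _ => 1

/-- The element of `T(Q, M) ⊗ ℂ` which corresponds to an arrow of `Γ`. -/
def arrC (p : Q.GE) : Q.TC :=
  Q.eps (Q.gt p) * (1 : ℂ) ⊗ₜ[ℝ] Q.arrEl p.1.1 (Q.gen p) * Q.eps (Q.gs p)

/-- The idempotent `e`; its component at the vertex `i` is `1 ⊗ 1` if `M i` is `ℝ` or `ℂ`, and
`(1 ⊗ 1 - qi ⊗ i)/2` if `M i = ℍ`. -/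
def idem : Q.TC := ∑ w : Q.GV, Q.eps w

theorem vert_mul (i : Q.V) (x y : (Q.M i).toSub) : Q.vert i x * Q.vert i y = Q.vert i (x * y) := by
  have h := RingQuot.mkAlgHom_rel ℝ (TensorRel.mul (Q := Q) (Pi.single i x) (Pi.single i y))
  rw [map_mul, ← Pi.single_mul] at h
  exact h

theorem vert_mul_ne {i j : Q.V} (hij : i ≠ j) (x : (Q.M i).toSub) (y : (Q.M j).toSub) :
    Q.vert i x * Q.vert j y = 0 := by
  have h := RingQuot.mkAlgHom_rel ℝ (TensorRel.mul (Q := Q) (Pi.single i x) (Pi.single j y))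
  have h0 : (Pi.single i x * Pi.single j y : Q.Base) = 0 := by
    funext k
    by_cases hk : k = i
    · subst hk; simp [Pi.single_eq_of_ne hij]
    · simp [Pi.single_eq_of_ne hk]
  rw [map_mul, h0, ← Prod.zero_eq_mk, map_zero, map_zero] at h
  exact h

theorem vertEl_mul_ne {i j : Q.V} (hij : i ≠ j) (x y : ℍ[ℝ]) :
    Q.vertEl i x * Q.vertEl j y = 0 := by
  unfold vertEl
  split_ifs <;> simp [vert_mul_ne Q hij]

theorem vertEl_mul (i : Q.V) {x y : ℍ[ℝ]} (hx : x ∈ (Q.M i).toSub) (hy : y ∈ (Q.M i).toSub) :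
    Q.vertEl i x * Q.vertEl i y = Q.vertEl i (x * y) := by
  simp only [vertEl, dif_pos hx, dif_pos hy, dif_pos (mul_mem hx hy)]
  exact Q.vert_mul i _ _

theorem vertEl_neg (i : Q.V) (x : ℍ[ℝ]) : Q.vertEl i (-x) = -Q.vertEl i x := by
  unfold vertEl
  by_cases h : x ∈ (Q.M i).toSub
  · rw [dif_pos h, dif_pos (neg_mem h)]
    have h1 : (Pi.single i (⟨-x, neg_mem h⟩ : (Q.M i).toSub) : Q.Base) =
        -Pi.single i (⟨x, h⟩ : (Q.M i).toSub) := by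
      rw [← Pi.single_neg]; rfl
    unfold vert
    rw [h1, ← map_neg, Prod.neg_mk, neg_zero]
  · rw [dif_neg h, dif_neg (fun h' => h (by simpa using neg_mem h')), neg_zero]

theorem qi_mem {i : Q.V} (h : Q.M i ≠ .real) : qi ∈ (Q.M i).toSub := by
  cases hi : Q.M i
  · exact absurd hi h
  · exact (mem_cpx_iff _).2 ⟨rfl, rfl⟩
  · exact Algebra.mem_top

theorem qi_mul_qi : qi * qi = -1 := by
  have e1 : qi.re = 0 := rfl
  have e2 : qi.imI = 1 := rfl
  have e3 : qi.imJ = 0 := rfl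
  have e4 : qi.imK = 0 := rfl
  apply Quaternion.ext <;>
    simp [Quaternion.re_mul, Quaternion.imI_mul, Quaternion.imJ_mul, Quaternion.imK_mul,
      e1, e2, e3, e4]

theorem eps_aux {i : Q.V} (h : Q.M i ≠ .real) :
    ((1 : ℂ) ⊗ₜ[ℝ] Q.vertEl i 1 * (1 : ℂ) ⊗ₜ[ℝ] Q.vertEl i 1 = (1 : ℂ) ⊗ₜ[ℝ] Q.vertEl i 1) ∧
    ((1 : ℂ) ⊗ₜ[ℝ] Q.vertEl i 1 * Complex.I ⊗ₜ[ℝ] Q.vertEl i qi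
      = Complex.I ⊗ₜ[ℝ] Q.vertEl i qi) ∧
    (Complex.I ⊗ₜ[ℝ] Q.vertEl i qi * (1 : ℂ) ⊗ₜ[ℝ] Q.vertEl i 1
      = Complex.I ⊗ₜ[ℝ] Q.vertEl i qi) ∧
    (Complex.I ⊗ₜ[ℝ] Q.vertEl i qi * Complex.I ⊗ₜ[ℝ] Q.vertEl i qi
      = (1 : ℂ) ⊗ₜ[ℝ] Q.vertEl i 1) := by
  refine ⟨?_, ?_, ?_, ?_⟩
  · rw [Algebra.TensorProduct.tmul_mul_tmul, Q.vertEl_mul i (one_mem _) (one_mem _), mul_one,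
      mul_one]
  · rw [Algebra.TensorProduct.tmul_mul_tmul, Q.vertEl_mul i (one_mem _) (Q.qi_mem h), one_mul,
      one_mul]
  · rw [Algebra.TensorProduct.tmul_mul_tmul, Q.vertEl_mul i (Q.qi_mem h) (one_mem _), mul_one,
      mul_one]
  · rw [Algebra.TensorProduct.tmul_mul_tmul, Q.vertEl_mul i (Q.qi_mem h) (Q.qi_mem h), qi_mul_qi,
      vertEl_neg, Complex.I_mul_I, TensorProduct.tmul_neg]
    have : (-1 : ℂ) = (-1 : ℝ) • (1 : ℂ) := by simp
    rw [this, ← TensorProduct.smul_tmul' (-1 : ℝ) (1 : ℂ) (Q.vertEl i 1), neg_one_smul, neg_neg]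

theorem eps_mul_self (w : Q.GV) : Q.eps w * Q.eps w = Q.eps w := by
  unfold eps
  split_ifs with h hb
  · rw [Algebra.TensorProduct.tmul_mul_tmul, Q.vertEl_mul w.1.1 (one_mem _) (one_mem _), mul_one,
      mul_one]
  · obtain ⟨h1, h2, h3, h4⟩ := Q.eps_aux h
    rw [smul_mul_smul_comm, add_mul, mul_add, mul_add, h1, h2, h3, h4]
    module
  · obtain ⟨h1, h2, h3, h4⟩ := Q.eps_aux h
    rw [smul_mul_smul_comm, sub_mul, mul_sub, mul_sub, h1, h2, h3, h4]
    module

theorem eps_mul_ne {w w' : Q.GV} (hw : w ≠ w') : Q.eps w * Q.eps w' = 0 := by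
  obtain ⟨⟨i, b⟩, hb⟩ := w
  obtain ⟨⟨j, c⟩, hc⟩ := w'
  by_cases hij : i = j
  · subst hij
    have hbc : b ≠ c := fun h => hw (by subst h; rfl)
    have hC : Q.M i = .cpx := by
      cases b
      · cases c
        · exact absurd rfl hbc
        · exact hc rfl
      · exact hb rfl
    have h : Q.M i ≠ .real := by rw [hC]; intro h; cases h
    obtain ⟨h1, h2, h3, h4⟩ := Q.eps_aux h
    cases b <;> cases c
    · exact absurd rfl hbc
    · simp only [eps, if_neg h, if_true, Bool.false_eq_true, if_false]
      rw [smul_mul_smul_comm, sub_mul, mul_add, mul_add, h1, h2, h3, h4]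
      module
    · simp only [eps, if_neg h, if_true, Bool.false_eq_true, if_false]
      rw [smul_mul_smul_comm, add_mul, mul_sub, mul_sub, h1, h2, h3, h4]
      module
    · exact absurd rfl hbc
  · have key (x y : ℍ[ℝ]) (z z' : ℂ) : z ⊗ₜ[ℝ] Q.vertEl i x * z' ⊗ₜ[ℝ] Q.vertEl j y = 0 := by
      rw [Algebra.TensorProduct.tmul_mul_tmul, Q.vertEl_mul_ne hij, TensorProduct.tmul_zero]
    unfold eps
    split_ifs <;>
      simp only [smul_mul_assoc, mul_smul_comm, add_mul, mul_add, sub_mul, mul_sub, key, add_zero,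
        sub_zero, smul_zero]

theorem idem_mul_eps (w : Q.GV) : Q.idem * Q.eps w = Q.eps w := by
  unfold idem
  rw [Finset.sum_mul, Finset.sum_eq_single w (fun v _ hv => Q.eps_mul_ne hv) (by simp),
    eps_mul_self]

theorem eps_mul_idem (w : Q.GV) : Q.eps w * Q.idem = Q.eps w := by
  unfold idem
  rw [Finset.mul_sum, Finset.sum_eq_single w (fun v _ hv => Q.eps_mul_ne hv.symm) (by simp),
    eps_mul_self]

theorem isIdempotentElem_idem : IsIdempotentElem Q.idem := by
  change Q.idem * Q.idem = Q.idem
  conv_lhs => rw [show Q.idem * Q.idem = Q.idem * ∑ w : Q.GV, Q.eps w from rfl, Finset.mul_sum]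
  simp only [idem_mul_eps]
  rfl

theorem idem_mul_arrC (p : Q.GE) : Q.idem * Q.arrC p = Q.arrC p := by
  unfold arrC
  rw [← mul_assoc, ← mul_assoc, idem_mul_eps]

theorem arrC_mul_idem (p : Q.GE) : Q.arrC p * Q.idem = Q.arrC p := by
  unfold arrC
  rw [mul_assoc, eps_mul_idem]

/-- The ring `e (T(Q, M) ⊗ ℂ) e`. -/
abbrev CornerRing : Type := Q.isIdempotentElem_idem.Corner

theorem coe_mul (x y : Q.CornerRing) : (x * y).1 = x.1 * y.1 := rfl

/-- The corner `e (T(Q, M) ⊗ ℂ) e` is a `ℂ`-algebra, `c` being sent to `c e`. -/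
instance : Algebra ℂ Q.CornerRing :=
  RingHom.toAlgebra'
    { toFun := fun c => ⟨c • Q.idem, c • Q.idem, by
        simp only [mul_smul_comm, smul_mul_assoc, Q.isIdempotentElem_idem.eq]⟩
      map_one' := Subtype.ext (one_smul ℂ _)
      map_mul' := fun c d => Subtype.ext (by
        change (c * d) • Q.idem = (c • Q.idem) * (d • Q.idem)
        rw [smul_mul_smul_comm, Q.isIdempotentElem_idem.eq])
      map_zero' := Subtype.ext (zero_smul ℂ _)
      map_add' := fun c d => Subtype.ext (add_smul c d _) }
    (fun c x => Subtype.ext (by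
      have hx := (Subsemigroup.mem_corner_iff Q.isIdempotentElem_idem).1 x.2
      change (c • Q.idem) * x.1 = x.1 * (c • Q.idem)
      rw [smul_mul_assoc, mul_smul_comm, hx.1, hx.2]))

/-- The inclusion of `e (T(Q, M) ⊗ ℂ) e` into `T(Q, M) ⊗ ℂ` (not unital). -/
def cornerIncl : Q.CornerRing →ₙ+* Q.TC where
  toFun := Subtype.val
  map_mul' _ _ := rfl
  map_zero' := rfl
  map_add' _ _ := rfl

/-- The elements of `e (T(Q, M) ⊗ ℂ) e` which correspond to the vertices and arrows of `Γ`. -/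
def psiGen : Q.Gam.V ⊕ Q.Gam.E → Q.CornerRing
  | Sum.inl w => ⟨Q.eps w, (Subsemigroup.mem_corner_iff Q.isIdempotentElem_idem).2
      ⟨Q.idem_mul_eps w, Q.eps_mul_idem w⟩⟩
  | Sum.inr p => ⟨Q.arrC p, (Subsemigroup.mem_corner_iff Q.isIdempotentElem_idem).2
      ⟨Q.idem_mul_arrC p, Q.arrC_mul_idem p⟩⟩

theorem psiGen_rel ⦃x y : FreeAlgebra ℂ (Q.Gam.V ⊕ Q.Gam.E)⦄ (h : Q.Gam.PathRel ℂ x y) :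
    FreeAlgebra.lift ℂ Q.psiGen x = FreeAlgebra.lift ℂ Q.psiGen y := by
  cases h with
  | idem v =>
    rw [map_mul, FreeAlgebra.lift_ι_apply]
    exact Subtype.ext (Q.eps_mul_self v)
  | ortho v w h =>
    rw [map_mul, map_zero, FreeAlgebra.lift_ι_apply, FreeAlgebra.lift_ι_apply]
    exact Subtype.ext (Q.eps_mul_ne h)
  | one =>
    rw [map_sum, map_one]
    apply Subtype.ext
    change Q.cornerIncl (∑ v : Q.Gam.V, _) = Q.idem
    rw [map_sum]
    simp only [FreeAlgebra.lift_ι_apply]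
    rfl
  | target a =>
    rw [map_mul, FreeAlgebra.lift_ι_apply, FreeAlgebra.lift_ι_apply]
    apply Subtype.ext
    change Q.eps (Q.gt a) * Q.arrC a = Q.arrC a
    unfold arrC
    rw [← mul_assoc, ← mul_assoc, eps_mul_self]
  | source a =>
    rw [map_mul, FreeAlgebra.lift_ι_apply, FreeAlgebra.lift_ι_apply]
    apply Subtype.ext
    change Q.arrC a * Q.eps (Q.gs a) = Q.arrC a
    unfold arrC
    rw [mul_assoc, eps_mul_self]

/-- The inverse `ℂΓ → e (T(Q, M) ⊗ ℂ) e` of the isomorphism `Ψ`. -/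
def psiInv : Q.Gam.PathAlg ℂ →ₐ[ℂ] Q.CornerRing :=
  RingQuot.liftAlgHom ℂ ⟨FreeAlgebra.lift ℂ Q.psiGen, Q.psiGen_rel⟩

variable {Q}

/-- The ideal `I ⊗ ℂ` of `T(Q, M) ⊗ ℂ`. -/
def idealC (I : TwoSidedIdeal Q.T) : TwoSidedIdeal Q.TC :=
  TwoSidedIdeal.span ((fun x : Q.T => (1 : ℂ) ⊗ₜ[ℝ] x) '' I)

/-- The ideal `J = Ψ (e (I ⊗ ℂ) e)` of `ℂΓ`: it consists of the elements of `ℂΓ` whose image under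
the inverse of `Ψ`, an element of `e (T(Q, M) ⊗ ℂ) e`, lies in `I ⊗ ℂ`. -/
def idealJ (I : TwoSidedIdeal Q.T) : TwoSidedIdeal (Q.Gam.PathAlg ℂ) :=
  ((idealC I).comap Q.cornerIncl).comap Q.psiInv

/-- The complexified quiver presentation `ℂΓ/J` of `T(Q, M)/I`. -/
abbrev Complexification (I : TwoSidedIdeal Q.T) : Type := (idealJ I).ringCon.Quotient

/-! ### Ordinarily and specially gentle vertices -/

/-- For arrows `a`, `b` with `s a = t b`: the image of `M (a b) = M a ⊗ M b` in `T(Q, M)`. -/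
def pathBimod (a b : Q.E) : Submodule ℝ Q.T :=
  Submodule.span ℝ {z | ∃ (m : Q.bimod a) (n : Q.bimod b), z = Q.arr a m * Q.arr b n}

/-- The ideal `I` includes the bimodule `N`. -/
def Includes (I : TwoSidedIdeal Q.T) (N : Submodule ℝ Q.T) : Prop := ∀ z ∈ N, z ∈ I

/-- The set `N_v` of vertices adjacent to `v`. -/
def nbrs (v : Q.V) : Set Q.V :=
  {u | (∃ a, Q.s a = v ∧ Q.t a = u) ∨ ∃ a, Q.t a = v ∧ Q.s a = u}

/-- The conditions common to all ordinarily gentle vertices. -/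
structure OrdGentleConditions (I : TwoSidedIdeal Q.T) (v : Q.V) : Prop where
  card_out : {a : Q.E | Q.s a = v}.ncard ≤ 2
  card_in : {a : Q.E | Q.t a = v}.ncard ≤ 2
  xor_in : ∀ a b c : Q.E, Q.s a = v → Q.t b = v → Q.t c = v → b ≠ c →
    Xor (Includes I (pathBimod a b)) (Includes I (pathBimod a c))
  xor_out : ∀ a b c : Q.E, Q.t a = v → Q.s b = v → Q.s c = v → b ≠ c →
    Xor (Includes I (pathBimod b a)) (Includes I (pathBimod c a))

/-- `v` is ordinarily gentle with `D`, where `D` is `ℝ` or `ℍ`. -/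
def OrdGentleWith (D : DivAlg) (I : TwoSidedIdeal Q.T) (v : Q.V) : Prop :=
  Q.M v = D ∧ (∀ u ∈ nbrs v, Q.M u = D) ∧ OrdGentleConditions I v

/-- `v` is ordinarily gentle with `ℂ`. -/
def OrdGentleWithC (I : TwoSidedIdeal Q.T) (v : Q.V) : Prop :=
  Q.M v = .cpx ∧ OrdGentleConditions I v ∧
    ∀ a b : Q.E, Q.s a = v → Q.t b = v → Q.M (Q.t a) ≠ .cpx → Q.M (Q.s b) ≠ .cpx →
      Includes I (pathBimod a b) ∨ ∀ z ∈ pathBimod a b, z ∈ I → z = 0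

/-- `v` is an ordinarily gentle vertex in `T(Q, M)/I`. -/
def OrdinarilyGentle (I : TwoSidedIdeal Q.T) (v : Q.V) : Prop :=
  OrdGentleWith .real I v ∨ OrdGentleWith .quat I v ∨ OrdGentleWithC I v

/-- The arrows ending at `v` are `b` and `b'`, and they start at a common vertex `u`; they are two
parallel arrows if `M u = M v`, and one single arrow `b = b'` otherwise. -/
def InSide (v : Q.V) (b b' : Q.E) : Prop :=
  (∀ c, Q.t c = v ↔ c = b ∨ c = b') ∧ Q.s b = Q.s b' ∧ (b ≠ b' ↔ Q.M (Q.s b) = Q.M v)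

/-- The arrows starting at `v` are `a` and `a'`, and they end at a common vertex `w`; they are two
parallel arrows if `M w = M v`, and one single arrow `a = a'` otherwise. -/
def OutSide (v : Q.V) (a a' : Q.E) : Prop :=
  (∀ c, Q.s c = v ↔ c = a ∨ c = a') ∧ Q.t a = Q.t a' ∧ (a ≠ a' ↔ Q.M (Q.t a) = Q.M v)

/-- The element `x_a ⊗ y_b` of `M (a b)`. -/
def ten (a : Q.E) (x : ℍ[ℝ]) (b : Q.E) (y : ℍ[ℝ]) : Q.T := Q.arrEl a x * Q.arrEl b y

/-- The generators `r₀` (and `r₀ⁱ`) for a vertex `v` with ingoing arrows `b, b'` from `u` and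
outgoing arrows `a, a'` to `w`, in terms of `M u`, `M v`, `M w`. Here `i ∈ ℂ`, the row `[1 0]` and
the column `[1; 0]` are the elements `qi`, `1` and `1` of the bimodule in `ℍ`. -/
def gens0 (Mu Mv Mw : DivAlg) (a a' b b' : Q.E) : Set Q.T :=
  match Mu, Mv, Mw with
  | .real, .real, .real =>
      {ten a 1 b 1 - ten a' 1 b' 1, -ten a 1 b' 1 - ten a' 1 b 1}
  | .real, .real, .quat => {ten a 1 b 1 + ten a qi b' 1}
  | .real, .real, .cpx => {ten a 1 b 1 + ten a qi b' 1}
  | .quat, .quat, .real => {ten a 1 b 1 + ten a 1 b' qi}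
  | .quat, .quat, .quat =>
      {ten a 1 b 1 - ten a' 1 b' 1 + ten a 1 b' qi + ten a' 1 b qi}
  | .quat, .quat, .cpx => {ten a 1 b 1 + ten a 1 b' qi}
  | .quat, .real, .real => {ten a 1 b 1 + ten a' 1 b qi}
  | .cpx, .real, .real => {ten a 1 b 1 + ten a' 1 b qi}
  | .real, .quat, .quat => {ten a 1 b 1 + ten a' 1 b qi}
  | .cpx, .quat, .quat => {ten a 1 b 1 + ten a' qi b 1}
  | .quat, .real, .quat => {ten a 1 b 1 - ten a qi b qi}
  | .quat, .real, .cpx => {ten a 1 b 1 - ten a qi b qi}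
  | .cpx, .real, .quat => {ten a 1 b 1 - ten a qi b qi}
  | .cpx, .real, .cpx => {ten a 1 b 1 - ten a qi b qi}
  | .real, .quat, .cpx => {ten a 1 b 1}
  | .cpx, .quat, .real => {ten a 1 b 1}
  | .cpx, .quat, .cpx => {ten a 1 b 1}
  | .real, .quat, .real => {ten a 1 b 1, ten a 1 b qi}
  | _, .cpx, _ => ∅

/-- The generators `r₁` (and `r₁ⁱ`), in the notation of `gens0`; the column `[0; 1]` is the element
`-qj` of the bimodule in `ℍ`. -/
def gens1 (Mu Mv Mw : DivAlg) (a a' b b' : Q.E) : Set Q.T :=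
  match Mu, Mv, Mw with
  | .real, .real, .real =>
      {ten a 1 b 1 + ten a' 1 b' 1, ten a 1 b' 1 - ten a' 1 b 1}
  | .real, .real, .quat => {ten a 1 b 1 - ten a qi b' 1}
  | .real, .real, .cpx => {ten a 1 b 1 - ten a qi b' 1}
  | .quat, .quat, .real => {ten a 1 b qj - ten a 1 b' qk}
  | .quat, .quat, .quat =>
      {ten a 1 b qj + ten a' 1 b' qj - ten a 1 b' qk + ten a' 1 b qk}
  | .quat, .quat, .cpx => {ten a 1 b qj - ten a 1 b' qk}
  | .quat, .real, .real => {ten a 1 b 1 - ten a' 1 b qi}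
  | .cpx, .real, .real => {ten a 1 b 1 - ten a' 1 b qi}
  | .real, .quat, .quat => {ten a 1 b qj + ten a' 1 b qk}
  | .cpx, .quat, .quat => {ten a qj b 1 + ten a' qk b 1}
  | .quat, .real, .quat => {ten a 1 b 1 + ten a qi b qi}
  | .quat, .real, .cpx => {ten a 1 b 1 + ten a qi b qi}
  | .cpx, .real, .quat => {ten a 1 b 1 + ten a qi b qi}
  | .cpx, .real, .cpx => {ten a 1 b 1 + ten a qi b qi}
  | .real, .quat, .cpx => {ten a 1 b qj}
  | .cpx, .quat, .real => {-ten a qj b 1}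
  | .cpx, .quat, .cpx => {ten a 1 b (-qj)}
  | .real, .quat, .real => {ten a 1 b qj, ten a 1 b qk}
  | _, .cpx, _ => ∅

/-- The `M w`-`M u`-bimodule generated by a set `R`. -/
def bimodGen (w u : Q.V) (R : Set Q.T) : Submodule ℝ Q.T :=
  Submodule.span ℝ
    {z | ∃ r ∈ R, ∃ (x : (Q.M w).toSub) (y : (Q.M u).toSub), z = Q.vert w x * r * Q.vert u y}

/-- `v` is a specially gentle vertex in `T(Q, M)/I`. In the first case `v` is neither a source nor
a sink, and `I` includes exactly one of the bimodules `I_v⁰` and `I_v¹`; in the degenerate cases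
`v` is a source or a sink (or both). -/
def SpeciallyGentle (I : TwoSidedIdeal Q.T) (v : Q.V) : Prop :=
  Q.M v ≠ .cpx ∧
    ((∃ a a' b b' : Q.E, OutSide v a a' ∧ InSide v b b' ∧
        Xor
          (Includes I (bimodGen (Q.t a) (Q.s b)
            (gens0 (Q.M (Q.s b)) (Q.M v) (Q.M (Q.t a)) a a' b b')))
          (Includes I (bimodGen (Q.t a) (Q.s b)
            (gens1 (Q.M (Q.s b)) (Q.M v) (Q.M (Q.t a)) a a' b b')))) ∨
      ((∀ c, Q.t c ≠ v) ∧ ∃ a a' : Q.E, OutSide v a a') ∨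
      ((∀ c, Q.s c ≠ v) ∧ ∃ b b' : Q.E, InSide v b b') ∨
      ((∀ c, Q.t c ≠ v) ∧ ∀ c, Q.s c ≠ v))

end ModQuiver

/-! ### Paths, and configurations gluing two vertices -/

open DivAlg

/-- `A → B → C`. -/
def pathQuiver (A B C : DivAlg) : ModQuiver where
  V := Fin 3
  E := Fin 2
  s := ![0, 1]
  t := ![1, 2]
  M := ![A, B, C]
  tw := fun _ => false

/-- `D → D_u ⇉ D_v → B`, where the vertices are `0`, `u = 1`, `v = 2`, `3`. -/
def glueQuiver (D B : DivAlg) : ModQuiver where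
  V := Fin 4
  E := Fin 4
  s := ![0, 1, 1, 2]
  t := ![1, 2, 2, 3]
  M := ![D, D, D, B]
  tw := fun _ => false

/-- `D → D_u ⇉ D_v ⇉ D`, where the vertices are `0`, `u = 1`, `v = 2`, `3`. -/
def glueQuiver₂ (D : DivAlg) : ModQuiver where
  V := Fin 4
  E := Fin 5
  s := ![0, 1, 1, 2, 2]
  t := ![1, 2, 2, 3, 3]
  M := fun _ => D
  tw := fun _ => false

/-- The paths `ℝ → ℝ → ℍ`, `ℝ → ℝ → ℂ`, `ℍ → ℍ → ℝ`, `ℍ → ℍ → ℂ`. -/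
inductive PathCase : ModQuiver → Prop
  | rrh : PathCase (pathQuiver real real quat)
  | rrc : PathCase (pathQuiver real real cpx)
  | hhr : PathCase (pathQuiver quat quat real)
  | hhc : PathCase (pathQuiver quat quat cpx)

/-- The modulated quivers `D → D_u ⇉ D_v → B` with `(D, B) = (ℝ, ℍ), (ℝ, ℂ), (ℍ, ℝ), (ℍ, ℂ)`, and
`D → D_u ⇉ D_v ⇉ D` with `D = ℝ, ℍ`, together with their vertices `u` and `v`. -/
inductive GlueCase : (Q : ModQuiver) → Q.V → Q.V → Prop
  | rr : GlueCase (glueQuiver₂ real) (1 : Fin 4) (2 : Fin 4)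
  | rh : GlueCase (glueQuiver real quat) (1 : Fin 4) (2 : Fin 4)
  | rc : GlueCase (glueQuiver real cpx) (1 : Fin 4) (2 : Fin 4)
  | hr : GlueCase (glueQuiver quat real) (1 : Fin 4) (2 : Fin 4)
  | hh : GlueCase (glueQuiver₂ quat) (1 : Fin 4) (2 : Fin 4)
  | hc : GlueCase (glueQuiver quat cpx) (1 : Fin 4) (2 : Fin 4)

end

/-! Write `A` for `ℂΓ/J` and suppose that `A` is Morita equivalent to `B = ℂQ'/I'`, where `I'` is
generated by paths of length two and all vertices are gentle. The idea is to carry the gentle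
conditions at a suitable vertex of `Q'` back to `A` and to contradict them there.

Transfer. Every quiver in question has a level function that increases by one along each arrow, and
the ideal is admissible (in the second case this is proved from the gentleness of `u` and `v`, in
`SpecialArrows.le_arrowIdealSq`). Hence the vertex idempotents satisfy `e_i A e_i = ℂ e_i`, and for
`i ≠ j` one of `e_i A e_j`, `e_j A e_i` is zero. On the side of `B` only the separated filtration by
path length is used: it shows that a nonzero projective module with scalar endomorphisms is some `B
f_w`. So the equivalence gives a bijection of vertices and multiplicative isomorphisms of Peirce
components (`exists_peirce_equiv_of_morita`). Counting dimensions between neighbouring levels gives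
an injection of the arrows of `Γ` into those of `Q'` that respects end points
(`PeirceIso.exists_arrow_map`). An arrow of `Q'` corresponds only to some nonzero element of a
Peirce component of `A`, so what has to be shown about `A` concerns whole components.

Paths. In `D → D → C` with `D ≠ C`, the bimodule of the composite is isomorphic to that of the arrow
between `D` and `C`, hence simple. So the ideal contains it or meets it trivially. After
complexification one arrow at the middle vertex meets two arrows on the other side, and the products
of nonzero elements all vanish or never vanish; gentleness requires exactly one of two to vanish
(`not_isLocallyGentle_path_out`, `not_isLocallyGentle_path_in`).

Glued vertices. Let `c` end at `u` and let `b, b'` be the parallel arrows from `u` to `v`. Ordinary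
gentleness of `u` puts one of `M(bc)`, `M(b'c)` into `I`. The relations at `v` say that, modulo `I`,
multiplication by `b` and by `b'` on the arrows leaving `v` differ by a complex structure
(`rotates_in`). Thus if `bc` vanishes, then so do all `abc` and with them all `ab'c`: every path of
length three through `c` is zero. In `Q'`, however, the gentle conditions at `u` and then at `v`
produce consecutive nonzero products, and in a quadratic monomial algebra the resulting path of
length three is nonzero (`qa_mul_mul_ne_zero`). The opposite quivers are treated by the mirror
images.

Nonvanishing in `A` is detected by the representations `model κ` by quaternionic matrices: `κ = 0`
sees vertices, the indicator of an arrow sees that arrow and kills products, and `κ = 1` sees paths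
of length two. -/

open scoped Quaternion TensorProduct

noncomputable section

/-! ### Projective modules generated by idempotents -/

section Peirce

variable {k : Type} [Field k] {A : Type} [Ring A] [Algebra k A]

variable (k) in
/-- The Peirce component `e A f` of an algebra, for idempotents `e` and `f`. -/
def peirceCorner (e f : A) : Submodule k A where
  carrier := {x | e * x = x ∧ x * f = x}
  add_mem' := by
    rintro a b ⟨h1, h2⟩ ⟨h3, h4⟩
    exact ⟨by rw [mul_add, h1, h3], by rw [add_mul, h2, h4]⟩
  zero_mem' := by simp
  smul_mem' := by
    rintro c a ⟨h1, h2⟩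
    exact ⟨by rw [mul_smul_comm, h1], by rw [smul_mul_assoc, h2]⟩

theorem mul_mem_peirceCorner {e f g x y : A} (hx : x ∈ peirceCorner k e f) (hy : y ∈ peirceCorner k f g) :
    x * y ∈ peirceCorner k e g :=
  ⟨by rw [← mul_assoc, hx.1], by rw [mul_assoc, hy.2]⟩

/-- The left ideal `A e`, for an idempotent `e`. -/
def leftIdeal (e : A) : Submodule A A where
  carrier := {x | x * e = x}
  add_mem' := by
    intro a b h1 h2
    change (a + b) * e = a + b
    rw [add_mul, h1, h2]
  zero_mem' := by simp
  smul_mem' := by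
    intro c a h
    change c * a * e = c * a
    rw [mul_assoc, h]

theorem mem_leftIdeal {e x : A} : x ∈ leftIdeal e ↔ x * e = x := Iff.rfl

/-- The generator `e` of `A e`. -/
def leftIdealGen (e : A) (he : e * e = e) : leftIdeal e := ⟨e, he⟩

/-- The linear map `A e → M` with `e ↦ m`. -/
def leftIdealLift (e : A) {M : Type*} [AddCommGroup M] [Module A M] (m : M) :
    leftIdeal e →ₗ[A] M where
  toFun x := x.1 • m
  map_add' _ _ := add_smul _ _ _
  map_smul' _ _ := mul_smul _ _ _

theorem leftIdeal_hom_apply {e : A} (he : e * e = e) {M : Type*} [AddCommGroup M] [Module A M]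
    (g : leftIdeal e →ₗ[A] M) (x : leftIdeal e) : g x = x.1 • g (leftIdealGen e he) := by
  rw [← map_smul]
  congr 1
  exact Subtype.ext x.2.symm

theorem smul_hom_leftIdealGen {e : A} (he : e * e = e) {M : Type*} [AddCommGroup M] [Module A M]
    (g : leftIdeal e →ₗ[A] M) : e • g (leftIdealGen e he) = g (leftIdealGen e he) :=
  (leftIdeal_hom_apply he g (leftIdealGen e he)).symm

/-- Right multiplication by `x`, as a linear map `A e → A f`. -/
def leftIdealMulRight (e : A) {f : A} (x : A) (hx : x * f = x) : leftIdeal e →ₗ[A] leftIdeal f :=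
  leftIdealLift e (⟨x, hx⟩ : leftIdeal f)

theorem projective_leftIdeal {e : A} (he : e * e = e) : Module.Projective A (leftIdeal e) := by
  refine Module.Projective.of_split (M := A) (leftIdeal e).subtype
    { toFun := fun x => ⟨x * e, by rw [mem_leftIdeal, mul_assoc, he]⟩
      map_add' := fun x y => Subtype.ext (add_mul _ _ _)
      map_smul' := fun c x => Subtype.ext (mul_assoc _ _ _) } ?_
  ext x
  exact x.2

/-- The isomorphism `Hom(A e, A f) ≅ e A f`. -/
def homPeirce {e : A} (he : e * e = e) (f : A) :
    (leftIdeal e →ₗ[A] leftIdeal f) ≃+ peirceCorner k e f where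
  toFun g := ⟨(g (leftIdealGen e he)).1,
    congrArg Subtype.val (smul_hom_leftIdealGen he g), (g (leftIdealGen e he)).2⟩
  invFun x := leftIdealMulRight e x.1 x.2.2
  left_inv g := by
    ext x
    rw [leftIdeal_hom_apply he g x]
    rfl
  right_inv x := Subtype.ext x.2.1
  map_add' g h := rfl

/-- Homomorphisms between the modules `A e` are right multiplications, so the factors appear in the
order opposite to the composition. -/
theorem homPeirce_comp {e f g : A} (he : e * e = e) (hf : f * f = f)
    (u : leftIdeal e →ₗ[A] leftIdeal f) (v : leftIdeal f →ₗ[A] leftIdeal g) :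
    (homPeirce (k := k) he g (v ∘ₗ u)).1 =
      (homPeirce (k := k) he f u).1 * (homPeirce (k := k) hf g v).1 := by
  change (v (u (leftIdealGen e he))).1 = (u (leftIdealGen e he)).1 * (v (leftIdealGen f hf)).1
  rw [leftIdeal_hom_apply hf v]
  rfl

end Peirce

/-! ### Algebras with a filtration adapted to a family of idempotents -/

/-- A separated multiplicative filtration of `B` and characters `χ w` dual to the idempotents `f w`,
such that the common kernel of the characters is the first step of the filtration. -/
structure AdaptedFiltration (k : Type) [Field k] {B : Type} [Ring B] [Algebra k B] {κ : Type}
    (f : κ → B) where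
  F : ℕ → AddSubgroup B
  χ : κ → B →ₐ[k] k
  mem_zero : ∀ b, b ∈ F 0
  mul_mem : ∀ m n a b, a ∈ F m → b ∈ F n → a * b ∈ F (m + n)
  separated : ∀ b, (∀ n, b ∈ F n) → b = 0
  mem_one : ∀ b, (∀ w, χ w b = 0) → b ∈ F 1
  idem : ∀ w, f w * f w = f w
  χ_self : ∀ w, χ w (f w) = 1
  χ_ne : ∀ w x, w ≠ x → χ w (f x) = 0

namespace AdaptedFiltration

variable {k : Type} [Field k] {B : Type} [Ring B] [Algebra k B] {κ : Type} {f : κ → B}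
  (H : AdaptedFiltration k f)

include H

/-- Nakayama's lemma without finiteness: if all functionals took values in `F 1`, a dual basis would
write `g y` as a sum of elements of `F 1` times values of `g`, so inductively all values would lie
in every `F n` and be zero by separatedness. The coordinates of each `y` would then vanish. -/
theorem exists_functional_notMem {Y : Type} [AddCommGroup Y] [Module B Y] [Module.Projective B Y]
    [Nontrivial Y] : ∃ (g : Y →ₗ[B] B) (y : Y), g y ∉ H.F 1 := by
  by_contra! hcon
  obtain ⟨s, hs⟩ := (Module.projective_def (R := B) (P := Y)).1 inferInstance
  have hall (n : ℕ) : ∀ (g : Y →ₗ[B] B) (y : Y), g y ∈ H.F n := by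
    induction n with
    | zero => exact fun g y => H.mem_zero _
    | succ n ih =>
      intro g y
      have h1 : g y = (s y).sum fun c b => b * g c := by
        conv_lhs => rw [← hs y, Finsupp.linearCombination_apply, Finsupp.sum, map_sum]
        simp [Finsupp.sum]
      rw [h1, Finsupp.sum, add_comm]
      refine AddSubgroup.sum_mem _ fun c _ => H.mul_mem 1 n _ _ ?_ (ih g c)
      exact hcon (Finsupp.lapply c ∘ₗ s) y
  obtain ⟨y, hy⟩ := exists_ne (0 : Y)
  apply hy
  have h0 : s y = 0 := by
    ext c
    exact H.separated _ fun n => hall n (Finsupp.lapply c ∘ₗ s) y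
  have := hs y
  rwa [h0, map_zero, eq_comm] at this

/-- Such an idempotent lies in `F 1`, and being equal to all its powers it lies in every `F n`. -/
theorem eq_zero_of_idempotent {q : B} (hq : q * q = q) (h : ∀ w, H.χ w q = 0) : q = 0 := by
  refine H.separated q fun n => ?_
  induction n with
  | zero => exact H.mem_zero q
  | succ n ih => rw [← hq]; exact H.mul_mem _ _ _ _ ih (H.mem_one q h)

/-- A nonzero projective module all of whose endomorphisms are scalars is of the form `B f_w`. -/
theorem exists_equiv_leftIdeal {Y : Type} [AddCommGroup Y] [Module B Y]
    [Module.Projective B Y] [Nontrivial Y]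
    (hend : ∀ g : Y →ₗ[B] Y, ∃ c : k, ∀ y, g y = algebraMap k B c • y) :
    ∃ w, Nonempty (Y ≃ₗ[B] leftIdeal (f w)) := by
  obtain ⟨g, y, hgy⟩ := H.exists_functional_notMem (Y := Y)
  obtain ⟨w, hw⟩ : ∃ w, H.χ w (g y) ≠ 0 := by
    by_contra! hcon
    exact hgy (H.mem_one _ hcon)
  have hf := H.idem w
  -- The candidate isomorphism. Its inverse should be a multiple of the map `f w ↦ f w • y`; the
  -- composite endomorphism of `Y` is a scalar `c`.
  let g' : Y →ₗ[B] leftIdeal (f w) :=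
    { toFun := fun y => ⟨g y * f w, by rw [mem_leftIdeal, mul_assoc, hf]⟩
      map_add' := fun a b => Subtype.ext (by simp [add_mul])
      map_smul' := fun c a => Subtype.ext (by simp [mul_assoc]) }
  obtain ⟨c, hc⟩ := hend (leftIdealLift (f w) (f w • y) ∘ₗ g')
  have hc' (z : Y) : (g z * f w) • y = algebraMap k B c • z := by
    rw [← hc z]
    change _ = (g z * f w) • (f w • y)
    rw [← mul_smul, mul_assoc, hf]
  -- The other composite is right multiplication by `p`. The plan is `p² = c p` with `c = χ w (g y)
  -- ≠ 0`, so that `c⁻¹ p` is an idempotent below `f w`.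
  set p : B := f w * g y * f w with hp
  have hpp : p * p = algebraMap k B c * p := by
    have h1 := congrArg (fun z => f w * g z * f w) (hc' y)
    simp only [map_smul, smul_eq_mul] at h1
    calc p * p = f w * (g y * f w * g y) * f w := by
          rw [hp]; simp only [mul_assoc]; rw [← mul_assoc (f w) (f w), hf]
      _ = f w * (algebraMap k B c * g y) * f w := h1
      _ = _ := by rw [hp, ← mul_assoc (f w), ← Algebra.commutes c (f w)]; simp only [mul_assoc]
  have hχp : H.χ w p = H.χ w (g y) := by simp [hp, H.χ_self]
  have hcχ : c = H.χ w (g y) := by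
    have := congrArg (H.χ w) hpp
    rw [map_mul (H.χ w) p p, map_mul (H.χ w) _ p, hχp, AlgHom.commutes] at this
    exact (mul_right_cancel₀ hw this).symm
  have hc0 : c ≠ 0 := hcχ ▸ hw
  have hfp : f w * p = p := by rw [hp]; simp only [← mul_assoc, hf]
  have hpf : p * f w = p := by rw [hp, mul_assoc, hf]
  have hcm (d : k) (x : B) : algebraMap k B d * x = d • x := (Algebra.smul_def d x).symm
  -- The complementary idempotent is killed by every character, at `w` because of the value of `c`,
  -- elsewhere because it is a multiple of `f w`. Hence it vanishes.
  have hq0 : f w - c⁻¹ • p = 0 := by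
    apply H.eq_zero_of_idempotent
    · simp only [sub_mul, mul_sub, mul_smul_comm, smul_mul_assoc, hpp, hfp, hpf, hf, hcm,
        smul_smul, inv_mul_cancel₀ hc0, one_smul]
      simp
    · intro x
      by_cases hx : x = w
      · subst hx
        rw [map_sub, map_smul, hχp, H.χ_self, ← hcχ, smul_eq_mul, inv_mul_cancel₀ hc0, sub_self]
      · have : f w - c⁻¹ • p = f w * (1 - c⁻¹ • p) := by
          rw [mul_sub, mul_one, mul_smul_comm, hfp]
        rw [this, map_mul, H.χ_ne x w hx, zero_mul]
  refine ⟨w, ⟨LinearEquiv.ofLinearMap g'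
    (leftIdealLift (f w) (algebraMap k B c⁻¹ • f w • y)) ?_ ?_⟩⟩
  · ext z
    change g (z.1 • algebraMap k B c⁻¹ • f w • y) * f w = z.1
    have h1 : c⁻¹ • p = f w := (sub_eq_zero.1 hq0).symm
    have h2 : z.1 * (algebraMap k B c⁻¹ * p) = z.1 := by
      rw [← Algebra.smul_def, h1]
      exact z.2
    conv_rhs => rw [← h2, hp]
    simp only [map_smul, smul_eq_mul, mul_assoc]
  · ext z
    change (g z * f w) • algebraMap k B c⁻¹ • f w • y = z
    rw [← mul_smul, ← Algebra.commutes, mul_smul, ← mul_smul (g z * f w), mul_assoc, hf, hc',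
      ← mul_smul, ← map_mul, inv_mul_cancel₀ hc0, map_one, one_smul]

end AdaptedFiltration

/-! ### Morita equivalences and Peirce components -/

/-- A complete family of orthogonal idempotents with `e i A e i = k e i`, such that for `i ≠ j` at
most one of `e i A e j` and `e j A e i` does not vanish. -/
structure IsDirectedFamily (k : Type) [Field k] {A : Type} [Ring A] [Algebra k A] {ι : Type}
    [Fintype ι] (e : ι → A) : Prop where
  idem : ∀ i, e i * e i = e i
  sum_eq_one : ∑ i, e i = 1
  ne_zero : ∀ i, e i ≠ 0
  scalar : ∀ i, ∀ x ∈ peirceCorner k (e i) (e i), ∃ c : k, x = c • e i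
  directed : ∀ i j, i ≠ j → (∀ x ∈ peirceCorner k (e i) (e j), x = 0) ∨
    ∀ x ∈ peirceCorner k (e j) (e i), x = 0

section Morita

open CategoryTheory
open scoped ModuleCat.Algebra

variable {k : Type} [Field k] {A B : Type} [Ring A] [Algebra k A] [Ring B] [Algebra k B]

/-- The projective module `A e`. -/
abbrev projMod (e : A) : ModuleCat.{0} A := ModuleCat.of A (leftIdeal e)

/-- The multiple `c g` of a homomorphism of `A`-modules. -/
def homScale {M N : ModuleCat.{0} A} (c : k) (g : M ⟶ N) : M ⟶ N := c • g

theorem homScale_apply {M N : ModuleCat.{0} A} (c : k) (g : M ⟶ N) (m : M) :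
    (homScale c g).hom m = algebraMap k A c • g.hom m := rfl

theorem map_homScale (F : ModuleCat.{0} A ⥤ ModuleCat.{0} B) [F.Additive] [F.Linear k]
    {M N : ModuleCat.{0} A} (c : k) (g : M ⟶ N) :
    F.map (homScale c g) = homScale c (F.map g) := F.map_smul c g

section

variable {ι : Type} [Fintype ι] {e : ι → A} (he : IsDirectedFamily k e)

include he

theorem IsDirectedFamily.end_eq_smul (i : ι) (g : projMod (e i) ⟶ projMod (e i)) :
    ∃ c : k, g = homScale c (𝟙 _) := by
  obtain ⟨c, hc⟩ := he.scalar i _ (homPeirce (k := k) (he.idem i) (e i) g.hom).2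
  refine ⟨c, ?_⟩
  ext x
  rw [homScale_apply, leftIdeal_hom_apply (he.idem i) g.hom x]
  change x.1 * (homPeirce (k := k) (he.idem i) (e i) g.hom).1 = algebraMap k A c * x.1
  rw [hc, mul_smul_comm, x.2, Algebra.smul_def]

/-- An isomorphism would factor `e i` as an element of `e i A e j` times one of `e j A e i`, and one
of these components is zero if `i ≠ j`. -/
theorem IsDirectedFamily.eq_of_iso {i j : ι} (φ : projMod (e i) ≅ projMod (e j)) : i = j := by
  by_contra hij
  have h1 := homPeirce_comp (k := k) (he.idem i) (he.idem j) φ.hom.hom φ.inv.hom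
  have h2 : φ.inv.hom ∘ₗ φ.hom.hom = LinearMap.id := by
    rw [← ModuleCat.hom_comp, φ.hom_inv_id]; rfl
  rw [h2] at h1
  change e i = _ at h1
  apply he.ne_zero i
  rw [h1]
  rcases he.directed i j hij with h | h
  · rw [h _ (homPeirce (k := k) (he.idem i) (e j) φ.hom.hom).2, zero_mul]
  · rw [h _ (homPeirce (k := k) (he.idem j) (e i) φ.inv.hom).2, mul_zero]

variable (E : ModuleCat.{0} A ≌ ModuleCat.{0} B)

/-- Being projective, being nonzero and having only scalar endomorphisms are preserved by a linear
equivalence, and `AdaptedFiltration.exists_equiv_leftIdeal` recognizes modules with these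
properties. -/
theorem exists_image_equiv {κ : Type} {f : κ → B} (hf : AdaptedFiltration k f)
    [E.functor.Linear k] (i : ι) :
    ∃ w, Nonempty (E.functor.obj (projMod (e i)) ≃ₗ[B] leftIdeal (f w)) := by
  have : E.functor.Additive := E.functor.additive_of_preserves_binary_products
  have hproj : Module.Projective B (E.functor.obj (projMod (e i))) := by
    rw [IsProjective.iff_projective]
    have h0 : Projective (projMod (e i)) :=
      (IsProjective.iff_projective _).1 (projective_leftIdeal (he.idem i))
    exact (E.map_projective_iff _).2 h0
  have hnt : Nontrivial (E.functor.obj (projMod (e i))) := by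
    by_contra hcon
    rw [not_nontrivial_iff_subsingleton] at hcon
    have h1 : 𝟙 (projMod (e i)) = 0 := by
      apply E.functor.map_injective
      ext x
      exact Subsingleton.elim _ _
    apply he.ne_zero i
    have := congrArg (fun g => (g.hom (leftIdealGen (e i) (he.idem i)) : leftIdeal (e i)).1) h1
    exact this
  apply hf.exists_equiv_leftIdeal
  intro g
  obtain ⟨c, hc⟩ := he.end_eq_smul i (E.functor.preimage (ModuleCat.ofHom g))
  refine ⟨c, fun y => ?_⟩
  have h1 := congrArg E.functor.map hc
  rw [E.functor.map_preimage, map_homScale, E.functor.map_id] at h1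
  have h2 := congrArg (fun u => u.hom y) h1
  exact h2

-- The modules `A e i` generate, since the `e i` sum to one. This is what makes the map on vertices
-- surjective.
omit [Algebra k B] in
theorem exists_image_hom_ne_zero (M : ModuleCat.{0} B) (m : M) (hm : m ≠ 0) :
    ∃ i, ∃ g : E.functor.obj (projMod (e i)) ⟶ M, g ≠ 0 := by
  have : E.functor.Additive := E.functor.additive_of_preserves_binary_products
  have : E.inverse.Additive := E.inverse.additive_of_preserves_binary_products
  obtain ⟨x, hx⟩ : ∃ x : E.inverse.obj M, x ≠ 0 := by
    by_contra! hcon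
    have h1 : 𝟙 M = 0 := by
      apply E.inverse.map_injective
      ext x
      rw [hcon x, map_zero, map_zero]
    apply hm
    have := congrArg (fun u => u.hom m) h1
    exact this
  obtain ⟨i, hi⟩ : ∃ i, e i • x ≠ 0 := by
    by_contra! hcon
    apply hx
    rw [← one_smul A x, ← he.sum_eq_one, Finset.sum_smul]
    exact Finset.sum_eq_zero fun i _ => hcon i
  let g : projMod (e i) ⟶ E.inverse.obj M := ModuleCat.ofHom (leftIdealLift (e i) x)
  have hg : g ≠ 0 := by
    intro h
    apply hi
    have := congrArg (fun u => u.hom (leftIdealGen (e i) (he.idem i))) h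
    exact this
  refine ⟨i, (E.toAdjunction.homEquiv _ _).symm g, fun h => hg ?_⟩
  have h2 := (E.toAdjunction.homEquiv _ _).apply_symm_apply g
  rw [h, Adjunction.homEquiv_unit, E.inverse.map_zero, Limits.comp_zero] at h2
  exact h2.symm

end

/-- A Morita equivalence identifies the Peirce components of a directed family of idempotents with
those of a family of idempotents adapted to a separated filtration. -/
theorem exists_peirce_equiv_of_morita {ι κ : Type} [Fintype ι] {e : ι → A} {f : κ → B}
    (he : IsDirectedFamily k e) (hf : AdaptedFiltration k f) (hM : IsMoritaEquivalent k A B) :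
    ∃ (σ : ι ≃ κ) (φ : ∀ i j, peirceCorner k (e i) (e j) ≃ₗ[k]
        peirceCorner k (f (σ i)) (f (σ j))),
      ∀ i j l (x : peirceCorner k (e i) (e j)) (y : peirceCorner k (e j) (e l)),
        (φ i l ⟨x.1 * y.1, mul_mem_peirceCorner x.2 y.2⟩).1 = (φ i j x).1 * (φ j l y).1 := by
  obtain ⟨⟨E, hlin⟩⟩ := hM.cond
  have hadd : E.functor.Additive := E.functor.additive_of_preserves_binary_products
  choose σ hσ using exists_image_equiv he E hf
  have τ (i : ι) : E.functor.obj (projMod (e i)) ≃ₗ[B] leftIdeal (f (σ i)) := (hσ i).some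
  have hinj : Function.Injective σ := by
    intro i j hij
    have u : E.functor.obj (projMod (e i)) ≃ₗ[B] E.functor.obj (projMod (e j)) :=
      (τ i).trans ((LinearEquiv.ofEq _ _ (by rw [hij])).trans (τ j).symm)
    exact he.eq_of_iso (E.functor.preimageIso u.toModuleIso)
  -- Test against the one-dimensional module `B ⧸ ker χ_w`. It receives a nonzero map from the image
  -- of some `A e i`, but `f (σ i)` annihilates it unless `σ i = w`.
  have hsurj : Function.Surjective σ := by
    intro w
    let L : Ideal B := RingHom.ker (hf.χ w)
    obtain ⟨i, g, hg⟩ := exists_image_hom_ne_zero he E (ModuleCat.of B (B ⧸ L))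
      (Submodule.Quotient.mk 1) (by
        rw [Ne, Submodule.Quotient.mk_eq_zero, RingHom.mem_ker, map_one]
        exact one_ne_zero)
    refine ⟨i, by_contra fun hi => hg ?_⟩
    ext y
    obtain ⟨z, rfl⟩ := (τ i).symm.surjective y
    have h1 := leftIdeal_hom_apply (hf.idem (σ i)) (g.hom ∘ₗ (τ i).symm.toLinearMap) z
    have h2 := smul_hom_leftIdealGen (hf.idem (σ i)) (g.hom ∘ₗ (τ i).symm.toLinearMap)
    have h3 (b : B ⧸ L) : f (σ i) • b = 0 := by
      obtain ⟨b, rfl⟩ := Submodule.Quotient.mk_surjective L b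
      rw [← Submodule.Quotient.mk_smul, Submodule.Quotient.mk_eq_zero, RingHom.mem_ker,
        smul_eq_mul, map_mul, hf.χ_ne w (σ i) (Ne.symm hi), zero_mul]
    change (g.hom ∘ₗ (τ i).symm.toLinearMap) z = 0
    rw [h1, ← h2]
    erw [h3]
    rw [smul_zero]
  -- The functor on homomorphisms, conjugated by the chosen isomorphisms `τ`. Its compatibility with
  -- composition becomes the multiplicativity of `φ`.
  let Φ (i j : ι) (g : leftIdeal (e i) →ₗ[A] leftIdeal (e j)) :
      leftIdeal (f (σ i)) →ₗ[B] leftIdeal (f (σ j)) :=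
    (τ j).toLinearMap ∘ₗ (E.functor.map (ModuleCat.ofHom g)).hom ∘ₗ (τ i).symm.toLinearMap
  have hΦadd (i j g h) : Φ i j (g + h) = Φ i j g + Φ i j h := by
    simp only [Φ]
    rw [ModuleCat.ofHom_add, E.functor.map_add, ModuleCat.hom_add, LinearMap.add_comp,
      LinearMap.comp_add]
  have hΦcomp (i j l g h) : Φ i l (h ∘ₗ g) = Φ j l h ∘ₗ Φ i j g := by
    ext x
    simp only [Φ]
    rw [ModuleCat.ofHom_comp, E.functor.map_comp, ModuleCat.hom_comp]
    simp
  have hΦsmul (i j) (g h : leftIdeal (e i) →ₗ[A] leftIdeal (e j)) (c : k)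
      (hgh : ∀ x, h x = algebraMap k A c • g x) (x) : Φ i j h x = algebraMap k B c • Φ i j g x := by
    have h1 : ModuleCat.ofHom h = homScale c (ModuleCat.ofHom g) := by
      ext x
      exact congrArg Subtype.val (hgh x)
    simp only [Φ]
    rw [h1, map_homScale]
    change τ j (algebraMap k B c • (E.functor.map (ModuleCat.ofHom g)).hom ((τ i).symm x)) = _
    rw [map_smul]
    rfl
  have hΦbij (i j) : Function.Bijective (Φ i j) := by
    constructor
    · intro g h hgh
      have h1 : E.functor.map (ModuleCat.ofHom g) = E.functor.map (ModuleCat.ofHom h) := by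
        ext x
        obtain ⟨x, rfl⟩ := (τ i).symm.surjective x
        exact (τ j).injective (congrArg (fun u => u x) hgh)
      exact congrArg ModuleCat.Hom.hom (E.functor.map_injective h1)
    · intro g
      refine ⟨(E.functor.preimage (ModuleCat.ofHom
        ((τ j).symm.toLinearMap ∘ₗ g ∘ₗ (τ i).toLinearMap))).hom, ?_⟩
      simp only [Φ]
      rw [ModuleCat.ofHom_hom, E.functor.map_preimage]
      ext x
      simp
  refine ⟨Equiv.ofBijective σ ⟨hinj, hsurj⟩, fun i j => LinearEquiv.ofBijective
    { toFun := fun x => homPeirce (hf.idem (σ i)) (f (σ j))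
        (Φ i j ((homPeirce (k := k) (he.idem i) (e j)).symm x))
      map_add' := ?_
      map_smul' := ?_ } ?_, ?_⟩
  · intro x y
    rw [map_add, hΦadd, map_add]
  · intro c x
    apply Subtype.ext
    have h1 := hΦsmul i j ((homPeirce (k := k) (he.idem i) (e j)).symm x)
      ((homPeirce (k := k) (he.idem i) (e j)).symm (c • x)) c (fun y => Subtype.ext (by
        change y.1 * (c • x.1) = algebraMap k A c * (y.1 * x.1)
        rw [mul_smul_comm, Algebra.smul_def])) (leftIdealGen (f (σ i)) (hf.idem (σ i)))
    have h2 := congrArg Subtype.val h1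
    refine h2.trans ?_
    exact (Algebra.smul_def c _).symm
  · exact (homPeirce (hf.idem (σ i)) (f (σ j))).bijective.comp
      ((hΦbij i j).comp (homPeirce (k := k) (he.idem i) (e j)).symm.bijective)
  · intro i j l x y
    have h1 : (homPeirce (k := k) (he.idem i) (e l)).symm ⟨x.1 * y.1, mul_mem_peirceCorner x.2 y.2⟩
        = (homPeirce (k := k) (he.idem j) (e l)).symm y ∘ₗ
          (homPeirce (k := k) (he.idem i) (e j)).symm x := by
      ext z
      exact (mul_assoc z.1 x.1 y.1).symm
    change (homPeirce (k := k) (hf.idem (σ i)) (f (σ l)) (Φ i l _)).1 = _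
    rw [h1, hΦcomp, homPeirce_comp (hf.idem (σ i)) (hf.idem (σ j))]
    rfl

end Morita

/-! ### Quotients by two-sided ideals -/

section TwoSidedQuotient

variable {k : Type} [Field k] {R : Type} [Ring R] [Algebra k R]

variable (k) in
/-- The projection to the quotient by a two-sided ideal. -/
def quotMk (I : TwoSidedIdeal R) : R →ₐ[k] I.ringCon.Quotient :=
  { I.ringCon.mk' with commutes' := fun _ => rfl }

theorem quotMk_surjective (I : TwoSidedIdeal R) : Function.Surjective (quotMk k I) :=
  I.ringCon.mk'_surjective

theorem quotMk_eq_zero {I : TwoSidedIdeal R} {x : R} : quotMk k I x = 0 ↔ x ∈ I :=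
  (RingCon.eq I.ringCon (a := x) (b := 0)).trans Iff.rfl

/-- The homomorphism out of a quotient by a two-sided ideal. -/
def quotLift (I : TwoSidedIdeal R) {C : Type} [Ring C] [Algebra k C] (g : R →ₐ[k] C)
    (h : ∀ x ∈ I, g x = 0) : I.ringCon.Quotient →ₐ[k] C :=
  { I.ringCon.lift g.toRingHom (fun x y hxy => by
      rw [RingCon.ker_apply]
      exact sub_eq_zero.1 (((map_sub g x y).symm).trans (h _ ((I.rel_iff x y).1 hxy)))) with
    commutes' := fun c => g.commutes c }

theorem eq_zero_of_mem_span {s : Set R} {C : Type} [Ring C] [Algebra k C] (g : R →ₐ[k] C)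
    (h : ∀ x ∈ s, g x = 0) {x : R} (hx : x ∈ TwoSidedIdeal.span s) : g x = 0 := by
  have : TwoSidedIdeal.span s ≤ TwoSidedIdeal.ker g :=
    TwoSidedIdeal.span_le.2 fun y hy => (TwoSidedIdeal.mem_ker g).2 (h y hy)
  exact (TwoSidedIdeal.mem_ker g).1 (this hx)

end TwoSidedQuotient

/-! ### Paths -/

namespace FinQuiver

variable {k : Type} [Field k] {Q : FinQuiver}

theorem vertex_mul_self (v : Q.V) : vertex k Q v * vertex k Q v = vertex k Q v := by
  have := RingQuot.mkAlgHom_rel k (PathRel.idem (k := k) v)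
  rwa [map_mul] at this

theorem vertex_mul_ne {v w : Q.V} (h : v ≠ w) : vertex k Q v * vertex k Q w = 0 := by
  have := RingQuot.mkAlgHom_rel k (PathRel.ortho (k := k) v w h)
  rwa [map_mul, map_zero] at this

theorem sum_vertex : ∑ v, vertex k Q v = 1 := by
  have := RingQuot.mkAlgHom_rel k (PathRel.one (k := k) (Q := Q))
  rwa [map_sum, map_one] at this

theorem vertex_mul_arrow (a : Q.E) : vertex k Q (Q.t a) * arrow k Q a = arrow k Q a := by
  have := RingQuot.mkAlgHom_rel k (PathRel.target (k := k) a)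
  rwa [map_mul] at this

theorem arrow_mul_vertex (a : Q.E) : arrow k Q a * vertex k Q (Q.s a) = arrow k Q a := by
  have := RingQuot.mkAlgHom_rel k (PathRel.source (k := k) a)
  rwa [map_mul] at this

/-- The homomorphism from the path algebra defined by the images of vertices and arrows. -/
def pathLift {C : Type} [Ring C] [Algebra k C] (f : Q.V → C) (g : Q.E → C)
    (h1 : ∀ v, f v * f v = f v) (h2 : ∀ v w, v ≠ w → f v * f w = 0) (h3 : ∑ v, f v = 1)
    (h4 : ∀ a, f (Q.t a) * g a = g a) (h5 : ∀ a, g a * f (Q.s a) = g a) :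
    Q.PathAlg k →ₐ[k] C :=
  RingQuot.liftAlgHom k ⟨FreeAlgebra.lift k (Sum.elim f g), by
    intro x y h
    cases h <;> simp [h1, h3, h4, h5]
    exact h2 _ _ ‹_›⟩

section pathLift

variable {C : Type} [Ring C] [Algebra k C] {f : Q.V → C} {g : Q.E → C}
    {h1 : ∀ v, f v * f v = f v} {h2 : ∀ v w, v ≠ w → f v * f w = 0} {h3 : ∑ v, f v = 1}
    {h4 : ∀ a, f (Q.t a) * g a = g a} {h5 : ∀ a, g a * f (Q.s a) = g a}

theorem pathLift_vertex (v : Q.V) : pathLift f g h1 h2 h3 h4 h5 (vertex k Q v) = f v := by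
  unfold pathLift vertex
  rw [RingQuot.liftAlgHom_mkAlgHom_apply, FreeAlgebra.lift_ι_apply]
  rfl

theorem pathLift_arrow (a : Q.E) : pathLift f g h1 h2 h3 h4 h5 (arrow k Q a) = g a := by
  unfold pathLift arrow
  rw [RingQuot.liftAlgHom_mkAlgHom_apply, FreeAlgebra.lift_ι_apply]
  rfl

end pathLift

/-- `IsPath n i j x` if `x` is a path of length `n` from `i` to `j`. -/
inductive IsPath : ℕ → Q.V → Q.V → Q.PathAlg k → Prop
  | nil (v : Q.V) : IsPath 0 v v (vertex k Q v)
  | cons {n : ℕ} {i : Q.V} (a : Q.E) {x : Q.PathAlg k} (h : IsPath n i (Q.s a) x) :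
      IsPath (n + 1) i (Q.t a) (arrow k Q a * x)

theorem IsPath.vertex_mul {n : ℕ} {i j : Q.V} {x : Q.PathAlg k} (h : IsPath n i j x) :
    vertex k Q j * x = x := by
  cases h with
  | nil => exact vertex_mul_self _
  | cons a h => rw [← mul_assoc, vertex_mul_arrow]

theorem IsPath.mul_vertex {n : ℕ} {i j : Q.V} {x : Q.PathAlg k} (h : IsPath n i j x) :
    x * vertex k Q i = x := by
  induction h with
  | nil => exact vertex_mul_self _
  | cons a h ih => rw [mul_assoc, ih]

-- The span of the paths is stable under left multiplication by the generators and contains `1`, the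
-- sum of the trivial paths. Linear independence of paths plays no role below.
variable (k Q) in
theorem span_isPath : Submodule.span k {x : Q.PathAlg k | ∃ n i j, IsPath n i j x} = ⊤ := by
  set S := Submodule.span k {x : Q.PathAlg k | ∃ n i j, IsPath n i j x} with hS
  have hmul (y : Q.PathAlg k) : ∀ x ∈ S, y * x ∈ S := by
    obtain ⟨y, rfl⟩ := RingQuot.mkAlgHom_surjective k (PathRel k Q) y
    induction y using FreeAlgebra.induction with
    | grade0 r =>
      intro x hx
      rw [AlgHom.commutes, ← Algebra.smul_def]
      exact S.smul_mem r hx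
    | grade1 z =>
      intro x hx
      induction hx using Submodule.span_induction with
      | zero => rw [mul_zero]; exact S.zero_mem
      | add a b _ _ h1 h2 => rw [mul_add]; exact S.add_mem h1 h2
      | smul c a _ h1 => rw [mul_smul_comm]; exact S.smul_mem c h1
      | mem x h =>
        obtain ⟨n, i, j, h⟩ := h
        rw [← h.vertex_mul, ← mul_assoc]
        rcases z with v | a
        · change vertex k Q v * vertex k Q j * x ∈ S
          by_cases hv : v = j
          · subst hv
            rw [vertex_mul_self, h.vertex_mul]
            exact Submodule.subset_span ⟨n, i, _, h⟩
          · rw [vertex_mul_ne hv, zero_mul]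
            exact S.zero_mem
        · change arrow k Q a * vertex k Q j * x ∈ S
          by_cases hv : Q.s a = j
          · subst hv
            rw [arrow_mul_vertex]
            exact Submodule.subset_span ⟨_, i, _, IsPath.cons a h⟩
          · rw [← arrow_mul_vertex, mul_assoc (arrow k Q a), vertex_mul_ne hv, mul_zero, zero_mul]
            exact S.zero_mem
    | mul a b h1 h2 => intro x hx; rw [map_mul, mul_assoc]; exact h1 _ (h2 _ hx)
    | add a b h1 h2 => intro x hx; rw [map_add, add_mul]; exact S.add_mem (h1 _ hx) (h2 _ hx)
  rw [eq_top_iff]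
  intro y _
  rw [← mul_one y]
  refine hmul y 1 ?_
  rw [← sum_vertex]
  exact Submodule.sum_mem _ fun v _ => Submodule.subset_span ⟨0, v, v, IsPath.nil v⟩

/-- A path of length `0` is trivial. -/
theorem IsPath.eq_vertex {i j : Q.V} {x : Q.PathAlg k} (h : IsPath 0 i j x) :
    i = j ∧ x = vertex k Q i := by
  cases h
  exact ⟨rfl, rfl⟩

/-- A path of length `1` is an arrow. -/
theorem IsPath.eq_arrow {i j : Q.V} {x : Q.PathAlg k} (h : IsPath 1 i j x) :
    ∃ a, Q.s a = i ∧ Q.t a = j ∧ x = arrow k Q a := by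
  cases h with
  | cons a h =>
    obtain ⟨h1, h2⟩ := h.eq_vertex
    refine ⟨a, h1.symm, rfl, ?_⟩
    rw [h2, h1, arrow_mul_vertex]

/-- A path of length `2` is a product of two arrows. -/
theorem IsPath.eq_arrow_mul {i j : Q.V} {x : Q.PathAlg k} (h : IsPath 2 i j x) :
    ∃ a b, Q.s b = i ∧ Q.t b = Q.s a ∧ Q.t a = j ∧ x = arrow k Q a * arrow k Q b := by
  cases h with
  | cons a h =>
    obtain ⟨b, h1, h2, h3⟩ := h.eq_arrow
    exact ⟨a, b, h1, h2, rfl, by rw [h3]⟩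

section Quotient

variable (I : TwoSidedIdeal (Q.PathAlg k))

/-- The vertex idempotents of a quotient of the path algebra. -/
def qv (v : Q.V) : I.ringCon.Quotient := quotMk k I (vertex k Q v)

/-- The arrows of a quotient of the path algebra. -/
def qa (a : Q.E) : I.ringCon.Quotient := quotMk k I (arrow k Q a)

theorem qv_mul_self (v : Q.V) : qv I v * qv I v = qv I v := by
  rw [qv, ← map_mul, vertex_mul_self]

theorem qv_mul_ne {v w : Q.V} (h : v ≠ w) : qv I v * qv I w = 0 := by
  rw [qv, qv, ← map_mul, vertex_mul_ne h, map_zero]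

theorem sum_qv : ∑ v, qv I v = 1 := by
  simp only [qv]
  rw [← map_sum, sum_vertex, map_one]

theorem qa_mem_peirce (a : Q.E) : qa I a ∈ peirceCorner k (qv I (Q.t a)) (qv I (Q.s a)) := by
  constructor
  · rw [qv, qa, ← map_mul, vertex_mul_arrow]
  · rw [qv, qa, ← map_mul, arrow_mul_vertex]

theorem qa_mul_eq_zero {a b : Q.E} : qa I a * qa I b = 0 ↔ arrow k Q a * arrow k Q b ∈ I := by
  rw [qa, qa, ← map_mul, quotMk_eq_zero]

/-- Peirce components are spanned by paths. -/
theorem mem_span_of_mem_peirce {i j : Q.V} {x : I.ringCon.Quotient}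
    (hx : x ∈ peirceCorner k (qv I j) (qv I i)) :
    x ∈ Submodule.span k (quotMk k I '' {y | ∃ n, IsPath n i j y}) := by
  obtain ⟨y, rfl⟩ := quotMk_surjective (k := k) I x
  have h1 : quotMk k I y = quotMk k I (vertex k Q j * y * vertex k Q i) := by
    rw [map_mul, map_mul]
    change _ = qv I j * _ * qv I i
    rw [hx.1, hx.2]
  rw [h1]
  change _ ∈ Submodule.span k ((quotMk k I).toLinearMap '' _)
  rw [Submodule.span_image]
  refine Submodule.mem_map_of_mem (f := (quotMk k I).toLinearMap) ?_
  have hy : y ∈ Submodule.span k {x : Q.PathAlg k | ∃ n i j, IsPath n i j x} := by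
    rw [span_isPath]; trivial
  clear h1 hx
  induction hy using Submodule.span_induction with
  | zero => simp
  | add a b _ _ h1 h2 => rw [mul_add, add_mul]; exact Submodule.add_mem _ h1 h2
  | smul c a _ h1 =>
    rw [mul_smul_comm, smul_mul_assoc]; exact Submodule.smul_mem _ c h1
  | mem x h =>
    obtain ⟨n, i', j', h⟩ := h
    by_cases hi : i' = i
    · by_cases hj : j = j'
      · subst hi hj
        rw [h.vertex_mul, h.mul_vertex]
        exact Submodule.subset_span ⟨n, h⟩
      · rw [← h.vertex_mul, ← mul_assoc, vertex_mul_ne hj, zero_mul, zero_mul]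
        exact Submodule.zero_mem _
    · rw [← h.mul_vertex, mul_assoc, mul_assoc, vertex_mul_ne hi, mul_zero, mul_zero]
      exact Submodule.zero_mem _

end Quotient

/-! ### Graded quivers -/

section Levels

variable (Q) in
/-- A function on the vertices which increases by one along each arrow. -/
def IsLevel (ρ : Q.V → ℕ) : Prop := ∀ a, ρ (Q.t a) = ρ (Q.s a) + 1

variable {ρ : Q.V → ℕ} (hρ : Q.IsLevel ρ) (I : TwoSidedIdeal (Q.PathAlg k))

include hρ

theorem IsLevel.of_isPath {n : ℕ} {i j : Q.V} {x : Q.PathAlg k} (h : IsPath n i j x) :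
    ρ j = ρ i + n := by
  induction h with
  | nil => rfl
  | cons a h ih => rw [hρ a, ih]; rfl

/-- The level function forces the length of every path between two given vertices. -/
theorem IsLevel.mem_span {i j : Q.V} {n : ℕ} (hn : ρ j = ρ i + n) {x : I.ringCon.Quotient}
    (hx : x ∈ peirceCorner k (qv I j) (qv I i)) :
    x ∈ Submodule.span k (quotMk k I '' {y | IsPath n i j y}) := by
  refine Submodule.span_mono (Set.image_mono ?_) (mem_span_of_mem_peirce I hx)
  rintro y ⟨m, hm⟩
  have := hρ.of_isPath hm
  obtain rfl : m = n := by omega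
  exact hm

theorem IsLevel.eq_zero {i j : Q.V} (hij : i ≠ j) (hle : ρ j ≤ ρ i) {x : I.ringCon.Quotient}
    (hx : x ∈ peirceCorner k (qv I j) (qv I i)) : x = 0 := by
  have h0 : {y : Q.PathAlg k | ∃ n, IsPath n i j y} = ∅ := by
    ext y
    simp only [Set.mem_ofPred_eq, Set.mem_empty_iff_false, iff_false]
    rintro ⟨n, hn⟩
    have := hρ.of_isPath hn
    obtain rfl : n = 0 := by omega
    exact hij hn.eq_vertex.1
  have := mem_span_of_mem_peirce I hx
  rw [h0, Set.image_empty, Submodule.span_empty] at this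
  exact this

theorem IsLevel.mem_span_arrows {i j : Q.V} (hn : ρ j = ρ i + 1) {x : I.ringCon.Quotient}
    (hx : x ∈ peirceCorner k (qv I j) (qv I i)) :
    x ∈ Submodule.span k (qa I '' {a | Q.s a = i ∧ Q.t a = j}) := by
  refine Submodule.span_mono ?_ (hρ.mem_span I hn hx)
  rintro _ ⟨y, hy, rfl⟩
  obtain ⟨a, h1, h2, h3⟩ := hy.eq_arrow
  exact ⟨a, ⟨h1, h2⟩, by rw [h3]; rfl⟩

/-- Closed paths are trivial in a graded quiver, and a nonzero component between different vertices
can only go up in level. -/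
theorem IsLevel.isDirectedFamily (hI : ∀ v, vertex k Q v ∉ I) : IsDirectedFamily k (qv I) where
  idem := qv_mul_self I
  sum_eq_one := sum_qv I
  ne_zero v h := hI v (quotMk_eq_zero.1 h)
  scalar v x hx := by
    have h1 := hρ.mem_span I (n := 0) rfl hx
    have h2 : quotMk k I '' {y | IsPath 0 v v y} ⊆ {qv I v} := by
      rintro _ ⟨y, hy, rfl⟩
      rw [hy.eq_vertex.2]
      rfl
    obtain ⟨c, hc⟩ := Submodule.mem_span_singleton.1 (Submodule.span_mono h2 h1)
    exact ⟨c, hc.symm⟩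
  directed i j hij := by
    rcases le_total (ρ i) (ρ j) with h | h
    · exact Or.inl fun x hx => hρ.eq_zero I hij.symm h hx
    · exact Or.inr fun x hx => hρ.eq_zero I hij h hx

end Levels

end FinQuiver

namespace FinQuiver

/-! ### Quadratic monomial quotients of path algebras -/

section Monomial

variable {k : Type} [Field k] {Q : FinQuiver}

open Polynomial

/-- The homomorphism `kQ → (kQ/I)[X]` which multiplies each arrow by `X`. -/
def gradingHom (I : TwoSidedIdeal (Q.PathAlg k)) : Q.PathAlg k →ₐ[k] I.ringCon.Quotient[X] :=
  pathLift (fun v => C (qv I v)) (fun a => C (qa I a) * X)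
    (fun v => by rw [← C_mul, qv_mul_self])
    (fun v w h => by rw [← C_mul, qv_mul_ne I h, C_0])
    (by rw [← map_sum, sum_qv, C_1])
    (fun a => by rw [← mul_assoc, ← C_mul, (qa_mem_peirce I a).1])
    (fun a => by rw [mul_assoc, X_mul_C, ← mul_assoc, ← C_mul, (qa_mem_peirce I a).2])

theorem gradingHom_eq_zero {I : TwoSidedIdeal (Q.PathAlg k)} (hI : GeneratedByPathsOfLengthTwo I)
    {x : Q.PathAlg k} (hx : x ∈ I) : gradingHom I x = 0 := by
  obtain ⟨P, -, hP⟩ := hI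
  rw [hP] at hx
  refine eq_zero_of_mem_span (gradingHom I) ?_ hx
  rintro _ ⟨p, hp, rfl⟩
  have h : qa I p.1 * qa I p.2 = 0 := by
    rw [qa_mul_eq_zero, hP]
    exact TwoSidedIdeal.subset_span ⟨p, hp, rfl⟩
  unfold gradingHom
  rw [map_mul, pathLift_arrow, pathLift_arrow, mul_assoc, ← mul_assoc X, X_mul_C, mul_assoc,
    ← mul_assoc (C _), ← C_mul, h, C_0, zero_mul]

/-- The comultiplication `kQ/I → (kQ/I)[X]` of the grading by path length. -/
def grading {I : TwoSidedIdeal (Q.PathAlg k)} (hI : GeneratedByPathsOfLengthTwo I) :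
    I.ringCon.Quotient →ₐ[k] I.ringCon.Quotient[X] :=
  quotLift I (gradingHom I) fun _ hx => gradingHom_eq_zero hI hx

/-- Evaluation at `X = 1` is a left inverse. -/
theorem grading_injective {I : TwoSidedIdeal (Q.PathAlg k)} (hI : GeneratedByPathsOfLengthTwo I) :
    Function.Injective (grading hI) := by
  let ev : I.ringCon.Quotient[X] →+* I.ringCon.Quotient :=
    eval₂RingHom' (RingHom.id _) 1 (fun a => Commute.one_right a)
  let ev' : I.ringCon.Quotient[X] →ₐ[k] I.ringCon.Quotient :=
    { ev with
      commutes' := fun c => by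
        change eval₂ (RingHom.id _) 1 (C (algebraMap k _ c)) = _
        rw [eval₂_C]; rfl }
  have h1 : ev'.comp (gradingHom I) = quotMk k I := by
    apply RingQuot.ringQuot_ext'
    apply FreeAlgebra.hom_ext
    funext z
    rcases z with v | a
    · change ev (gradingHom I (vertex k Q v)) = qv I v
      unfold gradingHom
      rw [pathLift_vertex]
      exact eval₂_C _ _
    · change ev (gradingHom I (arrow k Q a)) = qa I a
      unfold gradingHom
      rw [pathLift_arrow, map_mul]
      change eval₂ _ _ (C _) * eval₂ _ _ X = _
      rw [eval₂_C, eval₂_X, mul_one]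
      rfl
  refine Function.LeftInverse.injective (g := ev') fun b => ?_
  obtain ⟨x, rfl⟩ := quotMk_surjective (k := k) I b
  exact congrArg (fun u => u x) h1

/-- The character of the path algebra at the vertex `w`. -/
def vertexCharHom (w : Q.V) : Q.PathAlg k →ₐ[k] k := by
  classical
  exact pathLift (fun v => if w = v then 1 else 0) (fun _ => 0)
    (fun v => by simp) (fun v v' h => by
      by_cases h1 : w = v
      · have : w ≠ v' := fun h2 => h (h1.symm.trans h2)
        simp [this]
      · simp [h1]) (by simp) (by simp) (by simp)

theorem vertexCharHom_self (w : Q.V) : vertexCharHom w (vertex k Q w) = 1 := by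
  unfold vertexCharHom
  rw [pathLift_vertex, if_pos rfl]

theorem vertexCharHom_ne {w v : Q.V} (h : w ≠ v) : vertexCharHom w (vertex k Q v) = 0 := by
  unfold vertexCharHom
  rw [pathLift_vertex, if_neg h]

theorem vertexCharHom_arrow (w : Q.V) (a : Q.E) : vertexCharHom w (arrow k Q a) = 0 := by
  unfold vertexCharHom
  rw [pathLift_arrow]

/-- The character of `kQ/I` at the vertex `w`. -/
def vertexChar {I : TwoSidedIdeal (Q.PathAlg k)} (hI : GeneratedByPathsOfLengthTwo I) (w : Q.V) :
    I.ringCon.Quotient →ₐ[k] k :=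
  quotLift I (vertexCharHom w) fun x hx => by
    obtain ⟨P, -, hP⟩ := hI
    rw [hP] at hx
    refine eq_zero_of_mem_span (vertexCharHom w) ?_ hx
    rintro _ ⟨p, hp, rfl⟩
    rw [map_mul, vertexCharHom_arrow, zero_mul]

theorem vertexChar_qa {I : TwoSidedIdeal (Q.PathAlg k)} (hI : GeneratedByPathsOfLengthTwo I)
    (w : Q.V) (a : Q.E) : vertexChar hI w (qa I a) = 0 :=
  vertexCharHom_arrow w a

theorem vertexChar_qv_self {I : TwoSidedIdeal (Q.PathAlg k)} (hI : GeneratedByPathsOfLengthTwo I)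
    (w : Q.V) : vertexChar hI w (qv I w) = 1 :=
  vertexCharHom_self w

/-- The part of degree zero of an element is the combination of the vertices whose coefficients are
the values of the characters, as is seen on paths. -/
theorem mem_filtration_one {I : TwoSidedIdeal (Q.PathAlg k)} (hI : GeneratedByPathsOfLengthTwo I)
    (b : I.ringCon.Quotient) (hb : ∀ w, vertexChar hI w b = 0) : (grading hI b).coeff 0 = 0 := by
  have key (x : Q.PathAlg k) :
      (gradingHom I x).coeff 0 = ∑ w, vertexCharHom w x • qv I w := by
    have hx : x ∈ Submodule.span k {x : Q.PathAlg k | ∃ n i j, IsPath n i j x} := by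
      rw [span_isPath]; trivial
    induction hx using Submodule.span_induction with
    | zero => simp
    | add a b _ _ h1 h2 => simp only [map_add, coeff_add, h1, h2, add_smul, Finset.sum_add_distrib]
    | smul c a _ h1 =>
      rw [map_smul, coeff_smul, h1, Finset.smul_sum]
      simp only [map_smul, smul_smul, smul_eq_mul]
    | mem x h =>
      obtain ⟨n, i, j, h⟩ := h
      cases h with
      | nil =>
        unfold gradingHom
        rw [pathLift_vertex, coeff_C_zero, Finset.sum_eq_single i, vertexCharHom_self, one_smul]
        · intro w _ hw
          rw [vertexCharHom_ne hw, zero_smul]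
        · simp
      | cons a h =>
        simp only [map_mul, vertexCharHom_arrow, zero_mul, zero_smul, Finset.sum_const_zero]
        unfold gradingHom
        rw [pathLift_arrow, mul_coeff_zero, coeff_mul_X_zero, zero_mul]
  obtain ⟨x, rfl⟩ := quotMk_surjective (k := k) I b
  refine (key x).trans (Finset.sum_eq_zero fun w _ => ?_)
  have : vertexCharHom w x = 0 := hb w
  rw [this, zero_smul]

/-- The filtration of a quadratic monomial algebra by path length. -/
def adaptedFiltration {I : TwoSidedIdeal (Q.PathAlg k)} (hI : GeneratedByPathsOfLengthTwo I) :
    AdaptedFiltration k (qv I) where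
  F n :=
    { carrier := {b | ∀ d < n, (grading hI b).coeff d = 0}
      add_mem' := fun h1 h2 d hd => by rw [map_add, coeff_add, h1 d hd, h2 d hd, add_zero]
      zero_mem' := fun d _ => by rw [map_zero, coeff_zero]
      neg_mem' := fun h d hd => by rw [map_neg, coeff_neg, h d hd, neg_zero] }
  χ := vertexChar hI
  mem_zero _ _ hd := absurd hd (Nat.not_lt_zero _)
  mul_mem m n a b ha hb d hd := by
    rw [map_mul, coeff_mul]
    refine Finset.sum_eq_zero fun p hp => ?_
    rw [Finset.HasAntidiagonal.mem_antidiagonal] at hp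
    by_cases h : p.1 < m
    · rw [ha _ h, zero_mul]
    · rw [hb p.2 (by omega), mul_zero]
  separated b hb := by
    apply grading_injective hI
    rw [map_zero]
    ext d
    rw [hb (d + 1) d d.lt_succ_self, coeff_zero]
  mem_one b hb d hd := by
    obtain rfl : d = 0 := by omega
    exact mem_filtration_one hI b hb
  idem := qv_mul_self I
  χ_self := vertexChar_qv_self hI
  χ_ne w x h := vertexCharHom_ne h

end Monomial

/-! ### Paths of length three in quadratic monomial algebras -/

section String

variable {k : Type} [Field k] {Q : FinQuiver}

theorem diagonal_mul_single' {n : Type} [Fintype n] [DecidableEq n] (d : n → k) (i j : n) (c : k) :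
    Matrix.diagonal d * Matrix.single i j c = Matrix.single i j (d i * c) := by
  ext p q
  rw [Matrix.diagonal_mul, Matrix.single_apply, Matrix.single_apply]
  split_ifs with h
  · rw [h.1]
  · rw [mul_zero]

theorem single_mul_diagonal' {n : Type} [Fintype n] [DecidableEq n] (d : n → k) (i j : n) (c : k) :
    Matrix.single i j c * Matrix.diagonal d = Matrix.single i j (c * d j) := by
  ext p q
  rw [Matrix.mul_diagonal, Matrix.single_apply, Matrix.single_apply]
  split_ifs with h
  · rw [h.2]
  · rw [zero_mul]

open Classical in
/-- The image of an arrow in the string module of `a b c`. -/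
def stringArrow (k : Type) [Field k] (a b c x : Q.E) : Matrix (Fin 4) (Fin 4) k :=
  Matrix.single 1 0 (if x = c then 1 else 0) + Matrix.single 2 1 (if x = b then 1 else 0) +
    Matrix.single 3 2 (if x = a then 1 else 0)

open Classical in
/-- The string module of a path `a b c` of length three. -/
def stringHom (a b c : Q.E) (hab : Q.s a = Q.t b) (hbc : Q.s b = Q.t c) :
    Q.PathAlg k →ₐ[k] Matrix (Fin 4) (Fin 4) k :=
  pathLift
    -- The basis vectors are the four positions along the path and not its vertices, so the path may
    -- visit a vertex or an arrow repeatedly.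
    (fun v => Matrix.diagonal fun p : Fin 4 => if ![Q.s c, Q.s b, Q.s a, Q.t a] p = v then 1 else 0)
    (stringArrow k a b c)
    (fun v => by
      rw [Matrix.diagonal_mul_diagonal]
      congr 1
      funext p
      simp)
    (fun v w h => by
      rw [Matrix.diagonal_mul_diagonal, ← Matrix.diagonal_zero]
      congr 1
      funext p
      by_cases h1 : ![Q.s c, Q.s b, Q.s a, Q.t a] p = v
      · rw [if_neg (fun h2 => h (h1.symm.trans h2)), mul_zero]
      · rw [if_neg h1, zero_mul])
    (by
      ext p q
      rw [Matrix.sum_apply]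
      by_cases hpq : p = q
      · subst hpq
        simp
      · simp [Matrix.diagonal_apply_ne _ hpq, Matrix.one_apply_ne hpq])
    (fun x => by
      unfold stringArrow
      simp only [mul_add, diagonal_mul_single']
      congr 1
      · congr 1
        · congr 1
          split_ifs with h <;> simp_all
        · congr 1
          split_ifs with h <;> simp_all
      · congr 1
        split_ifs with h <;> simp_all)
    (fun x => by
      unfold stringArrow
      simp only [add_mul, single_mul_diagonal']
      congr 1
      · congr 1
        · congr 1
          split_ifs with h <;> simp_all
        · congr 1
          split_ifs with h <;> simp_all
      · congr 1
        split_ifs with h <;> simp_all)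

/-- A product of two arrows acts nontrivially on the string module only if it is `a b` or `b c`.
Neither is a relation, so the generators of `I` act by zero, while `a b c` moves the first basis
vector to the last. -/
theorem qa_mul_mul_ne_zero {I : TwoSidedIdeal (Q.PathAlg k)} (hI : GeneratedByPathsOfLengthTwo I)
    {a b c : Q.E} (hab : Q.s a = Q.t b) (hbc : Q.s b = Q.t c)
    (h1 : arrow k Q a * arrow k Q b ∉ I) (h2 : arrow k Q b * arrow k Q c ∉ I) :
    qa I a * qa I b * qa I c ≠ 0 := by
  classical
  intro h0
  rw [qa, qa, qa, ← map_mul, ← map_mul, quotMk_eq_zero] at h0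
  obtain ⟨P, -, rfl⟩ := hI
  have hP1 : (a, b) ∉ P := fun h => h1 (TwoSidedIdeal.subset_span ⟨_, h, rfl⟩)
  have hP2 : (b, c) ∉ P := fun h => h2 (TwoSidedIdeal.subset_span ⟨_, h, rfl⟩)
  have h3 := eq_zero_of_mem_span (stringHom (k := k) a b c hab hbc) (by
    rintro _ ⟨⟨x, y⟩, hp, rfl⟩
    unfold stringHom
    rw [map_mul, pathLift_arrow, pathLift_arrow]
    have e1 : ¬ (x = a ∧ y = b) := by rintro ⟨rfl, rfl⟩; exact hP1 hp
    have e2 : ¬ (x = b ∧ y = c) := by rintro ⟨rfl, rfl⟩; exact hP2 hp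
    unfold stringArrow
    ext p q
    fin_cases p <;> fin_cases q <;>
      simp [Matrix.mul_apply, Matrix.single_apply] <;> tauto) h0
  unfold stringHom at h3
  rw [map_mul, map_mul, pathLift_arrow, pathLift_arrow, pathLift_arrow] at h3
  have h4 := congrFun (congrFun h3 3) 0
  unfold stringArrow at h4
  simp [Matrix.mul_apply, Matrix.single_apply] at h4

end String

end FinQuiver

namespace FinQuiver

/-! ### Recovering a graded quiver from a Morita equivalent quadratic monomial algebra -/

section Transfer

variable {k : Type} [Field k] {Γ Q : FinQuiver} {J : TwoSidedIdeal (Γ.PathAlg k)}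
  {I : TwoSidedIdeal (Q.PathAlg k)}

/-- A multiplicative family of isomorphisms between Peirce components. -/
structure PeirceIso (J : TwoSidedIdeal (Γ.PathAlg k)) (I : TwoSidedIdeal (Q.PathAlg k)) where
  σ : Γ.V ≃ Q.V
  φ : ∀ i j, peirceCorner k (qv J i) (qv J j) ≃ₗ[k] peirceCorner k (qv I (σ i)) (qv I (σ j))
  mul_compat : ∀ i j l (x : peirceCorner k (qv J i) (qv J j)) (y : peirceCorner k (qv J j) (qv J l)),
    (φ i l ⟨x.1 * y.1, mul_mem_peirceCorner x.2 y.2⟩).1 = (φ i j x).1 * (φ j l y).1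

namespace PeirceIso

variable (Φ : PeirceIso J I) {ρ : Γ.V → ℕ}

theorem eq_zero (hρ : Γ.IsLevel ρ) {i j : Γ.V} (hij : i ≠ j) (hle : ρ j ≤ ρ i)
    {x : I.ringCon.Quotient} (hx : x ∈ peirceCorner k (qv I (Φ.σ j)) (qv I (Φ.σ i))) : x = 0 := by
  have h1 : (Φ.φ j i).symm ⟨x, hx⟩ = 0 :=
    Subtype.ext (hρ.eq_zero J hij hle ((Φ.φ j i).symm ⟨x, hx⟩).2)
  have h2 := (LinearEquiv.map_eq_zero_iff _).1 h1
  exact congrArg Subtype.val h2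

theorem exists_smul (hρ : Γ.IsLevel ρ) (hJ : ∀ v, vertex k Γ v ∉ J) (hI : ∀ v, qv I v ≠ 0)
    {i : Γ.V} {x : I.ringCon.Quotient}
    (hx : x ∈ peirceCorner k (qv I (Φ.σ i)) (qv I (Φ.σ i))) : ∃ c : k, x = c • qv I (Φ.σ i) := by
  have hdir := hρ.isDirectedFamily J hJ
  have key (z : peirceCorner k (qv I (Φ.σ i)) (qv I (Φ.σ i))) :
      ∃ c : k, z.1 = c • (Φ.φ i i ⟨qv J i, hdir.idem i, hdir.idem i⟩).1 := by
    obtain ⟨c, hc⟩ := hdir.scalar i _ ((Φ.φ i i).symm z).2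
    refine ⟨c, ?_⟩
    have h1 : (Φ.φ i i).symm z = c • ⟨qv J i, hdir.idem i, hdir.idem i⟩ := Subtype.ext hc
    have h2 := congrArg (Φ.φ i i) h1
    rw [LinearEquiv.apply_symm_apply, map_smul] at h2
    exact congrArg Subtype.val h2
  obtain ⟨c, hc⟩ := key ⟨x, hx⟩
  -- A `PeirceIso` is not required to send idempotents to idempotents. Both `x` and the idempotent
  -- are compared with the image of `qv J i`, which spans the component.
  obtain ⟨d, hd⟩ := key ⟨qv I (Φ.σ i), qv_mul_self I _, qv_mul_self I _⟩
  have hd0 : d ≠ 0 := by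
    rintro rfl
    rw [zero_smul] at hd
    exact hI _ hd
  refine ⟨c * d⁻¹, ?_⟩
  change qv I (Φ.σ i) = _ at hd
  rw [hd, smul_smul, mul_assoc, inv_mul_cancel₀ hd0, mul_one]
  exact hc

section

variable (hρ : Γ.IsLevel ρ) (hJ : ∀ v, vertex k Γ v ∉ J) (hI : GeneratedByPathsOfLengthTwo I)

include hρ hJ hI

/-- Components that do not go up vanish, except on the diagonal. A loop would be a multiple of its
vertex, but the character of the vertex kills arrows. -/
theorem level_lt_of_qa_ne_zero {a : Q.E} (ha : qa I a ≠ 0) :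
    ρ (Φ.σ.symm (Q.s a)) < ρ (Φ.σ.symm (Q.t a)) := by
  obtain ⟨i, hi⟩ := Φ.σ.surjective (Q.s a)
  obtain ⟨j, hj⟩ := Φ.σ.surjective (Q.t a)
  have hmem := qa_mem_peirce I a
  rw [← hi, ← hj] at hmem ⊢
  rw [Equiv.symm_apply_apply, Equiv.symm_apply_apply]
  by_contra hle
  by_cases hij : i = j
  · subst hij
    have hqv (v : Q.V) : qv I v ≠ 0 := by
      intro h
      have := vertexChar_qv_self hI v
      rw [h, map_zero] at this
      exact zero_ne_one this
    obtain ⟨c, hc⟩ := Φ.exists_smul hρ hJ hqv hmem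
    have h1 := vertexChar_qa hI (Φ.σ i) a
    rw [hc, map_smul, vertexChar_qv_self, smul_eq_mul, mul_one] at h1
    rw [h1, zero_smul] at hc
    exact ha hc
  · exact ha (Φ.eq_zero hρ hij (not_lt.1 hle) hmem)

theorem level_of_isPath {n : ℕ} {v w : Q.V} {y : Q.PathAlg k} (h : IsPath n v w y)
    (hy : quotMk k I y ≠ 0) : ρ (Φ.σ.symm v) + n ≤ ρ (Φ.σ.symm w) := by
  induction h with
  | nil => exact le_rfl
  | cons a h ih =>
    rw [map_mul] at hy
    have h1 := ih (right_ne_zero_of_mul hy)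
    have h2 := Φ.level_lt_of_qa_ne_zero hρ hJ hI (left_ne_zero_of_mul hy)
    omega

/-- A path of length `n` that is nonzero in the quotient climbs at least `n` levels, so between
neighbouring levels only single arrows survive. -/
theorem mem_span_arrows {i j : Γ.V} (hij : ρ j = ρ i + 1) {x : I.ringCon.Quotient}
    (hx : x ∈ peirceCorner k (qv I (Φ.σ j)) (qv I (Φ.σ i))) :
    x ∈ Submodule.span k (qa I '' {a | Q.s a = Φ.σ i ∧ Q.t a = Φ.σ j ∧ qa I a ≠ 0}) := by
  have h1 := mem_span_of_mem_peirce I hx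
  refine Submodule.span_le.2 ?_ h1
  rintro _ ⟨y, ⟨n, hn⟩, rfl⟩
  by_cases hy : quotMk k I y = 0
  · rw [hy]
    exact Submodule.zero_mem _
  · have h2 := Φ.level_of_isPath hρ hJ hI hn hy
    rw [Equiv.symm_apply_apply, Equiv.symm_apply_apply, hij] at h2
    have hn2 : n = 0 ∨ n = 1 := by omega
    rcases hn2 with rfl | rfl
    · have h3 := Φ.σ.injective hn.eq_vertex.1
      rw [h3] at hij
      omega
    · obtain ⟨a, h3, h4, rfl⟩ := hn.eq_arrow
      exact Submodule.subset_span ⟨a, ⟨h3, h4, hy⟩, rfl⟩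

/-- Between two vertices of neighbouring levels, the arrows of `Γ` are independent in a component
whose image is spanned by the nonzero arrows of `Q`, so there are at least as many of the latter.
The injections for the various pairs of vertices are chosen freely: `θ p` need not correspond to the
class of `p` under `φ`. -/
theorem exists_arrow_map (hlin : LinearIndependent k (qa J)) :
    ∃ θ : Γ.E → Q.E, Function.Injective θ ∧
      ∀ p, Q.s (θ p) = Φ.σ (Γ.s p) ∧ Q.t (θ p) = Φ.σ (Γ.t p) ∧ qa I (θ p) ≠ 0 := by
  classical
  have key (i j : Γ.V) (hij : ρ j = ρ i + 1) :
      Nonempty ({p : Γ.E // Γ.s p = i ∧ Γ.t p = j} ↪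
        {a : Q.E // Q.s a = Φ.σ i ∧ Q.t a = Φ.σ j ∧ qa I a ≠ 0}) := by
    let u : {p : Γ.E // Γ.s p = i ∧ Γ.t p = j} → peirceCorner k (qv J j) (qv J i) :=
      fun p => ⟨qa J p.1, by
        have := qa_mem_peirce J p.1
        rwa [p.2.1, p.2.2] at this⟩
    have hu : LinearIndependent k u :=
      LinearIndependent.of_comp (peirceCorner k (qv J j) (qv J i)).subtype
        (hlin.comp Subtype.val Subtype.val_injective)
    have hv : LinearIndependent k fun p => ((Φ.φ j i) (u p)).1 :=
      (hu.map' (Φ.φ j i).toLinearMap (Φ.φ j i).ker).map' (Submodule.subtype _)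
        (Submodule.ker_subtype _)
    refine Function.Embedding.nonempty_of_card_le
      ((linearIndependent_le_span_aux' _ hv
        (qa I '' {a | Q.s a = Φ.σ i ∧ Q.t a = Φ.σ j ∧ qa I a ≠ 0}) ?_).trans ?_)
    · rintro _ ⟨p, rfl⟩
      exact Φ.mem_span_arrows hρ hJ hI hij (Φ.φ j i (u p)).2
    · exact Fintype.card_le_of_surjective
        (fun a : {a : Q.E // Q.s a = Φ.σ i ∧ Q.t a = Φ.σ j ∧ qa I a ≠ 0} =>
          (⟨qa I a.1, a.1, a.2, rfl⟩ :
            ↥(qa I '' {a | Q.s a = Φ.σ i ∧ Q.t a = Φ.σ j ∧ qa I a ≠ 0})))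
        (by rintro ⟨_, a, ha, rfl⟩; exact ⟨⟨a, ha⟩, rfl⟩)
  let f (i j : Γ.V) (hij : ρ j = ρ i + 1) := (key i j hij).some
  let θ (p : Γ.E) : Q.E := (f (Γ.s p) (Γ.t p) (hρ p) ⟨p, rfl, rfl⟩).1
  have hθ (i j : Γ.V) (hij : ρ j = ρ i + 1) (p : Γ.E) (hp : Γ.s p = i ∧ Γ.t p = j) :
      θ p = (f i j hij ⟨p, hp⟩).1 := by
    obtain ⟨rfl, rfl⟩ := hp
    rfl
  have hst (p : Γ.E) : Q.s (θ p) = Φ.σ (Γ.s p) ∧ Q.t (θ p) = Φ.σ (Γ.t p) ∧ qa I (θ p) ≠ 0 :=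
    (f (Γ.s p) (Γ.t p) (hρ p) ⟨p, rfl, rfl⟩).2
  refine ⟨θ, fun p q hpq => ?_, hst⟩
  -- The image of an arrow determines its end points, which reduces injectivity to one pair of
  -- vertices.
  have h1 : Γ.s q = Γ.s p := Φ.σ.injective (by rw [← (hst p).1, ← (hst q).1, hpq])
  have h2 : Γ.t q = Γ.t p := Φ.σ.injective (by rw [← (hst p).2.1, ← (hst q).2.1, hpq])
  have h3 : f _ _ (hρ p) ⟨p, rfl, rfl⟩ = f _ _ (hρ p) ⟨q, h1, h2⟩ :=
    Subtype.ext ((hθ _ _ (hρ p) p ⟨rfl, rfl⟩).symm.trans (hpq.trans (hθ _ _ (hρ p) q ⟨h1, h2⟩)))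
  exact congrArg Subtype.val ((f _ _ (hρ p)).injective h3)

end

theorem exists_preimage (i j : Γ.V) {x : I.ringCon.Quotient}
    (hx : x ∈ peirceCorner k (qv I (Φ.σ i)) (qv I (Φ.σ j))) :
    ∃ y : peirceCorner k (qv J i) (qv J j), (Φ.φ i j y).1 = x ∧ (x ≠ 0 → y.1 ≠ 0) := by
  refine ⟨(Φ.φ i j).symm ⟨x, hx⟩, ?_, ?_⟩
  · rw [LinearEquiv.apply_symm_apply]
  · intro h0 h1
    apply h0
    have h2 : (Φ.φ i j).symm ⟨x, hx⟩ = 0 := Subtype.ext h1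
    exact congrArg Subtype.val ((LinearEquiv.map_eq_zero_iff _).1 h2)

/-- Nonzero elements of the target lift along a composition. -/
theorem exists_preimage_mul (i j l : Γ.V) {x y : I.ringCon.Quotient}
    (hx : x ∈ peirceCorner k (qv I (Φ.σ i)) (qv I (Φ.σ j)))
    (hy : y ∈ peirceCorner k (qv I (Φ.σ j)) (qv I (Φ.σ l))) (hx0 : x ≠ 0) (hy0 : y ≠ 0) :
    ∃ x' ∈ peirceCorner k (qv J i) (qv J j), ∃ y' ∈ peirceCorner k (qv J j) (qv J l),
      x' ≠ 0 ∧ y' ≠ 0 ∧ (x' * y' = 0 ↔ x * y = 0) := by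
  obtain ⟨x', rfl, hx'⟩ := Φ.exists_preimage i j hx
  obtain ⟨y', rfl, hy'⟩ := Φ.exists_preimage j l hy
  refine ⟨x'.1, x'.2, y'.1, y'.2, hx' hx0, hy' hy0, ?_⟩
  rw [← Φ.mul_compat]
  constructor
  · intro h
    have : (⟨x'.1 * y'.1, mul_mem_peirceCorner x'.2 y'.2⟩ :
      peirceCorner k (qv J i) (qv J l)) = 0 := Subtype.ext h
    rw [this]
    exact congrArg Subtype.val (LinearEquiv.map_zero (Φ.φ i l))
  · intro h
    have h2 := (LinearEquiv.map_eq_zero_iff (Φ.φ i l)).1 (Subtype.ext h)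
    exact congrArg Subtype.val h2

end PeirceIso

/-- The hypotheses on a graded quiver `Γ` with an ideal `J` under which the quiver can be recovered
from the module category. -/
structure IsGradedPresentation (J : TwoSidedIdeal (Γ.PathAlg k)) : Prop where
  level : ∃ ρ : Γ.V → ℕ, Γ.IsLevel ρ
  vertex_notMem : ∀ v, vertex k Γ v ∉ J
  arrows : LinearIndependent k (qa J)

theorem IsGradedPresentation.exists_peirceIso (hJ : IsGradedPresentation J)
    (hI : GeneratedByPathsOfLengthTwo I)
    (hM : IsMoritaEquivalent k J.ringCon.Quotient I.ringCon.Quotient) :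
    ∃ (Φ : PeirceIso J I) (θ : Γ.E → Q.E), Function.Injective θ ∧
      ∀ p, Q.s (θ p) = Φ.σ (Γ.s p) ∧ Q.t (θ p) = Φ.σ (Γ.t p) ∧ qa I (θ p) ≠ 0 := by
  obtain ⟨ρ, hρ⟩ := hJ.level
  obtain ⟨σ, φ, h⟩ := exists_peirce_equiv_of_morita (hρ.isDirectedFamily J hJ.vertex_notMem)
    (adaptedFiltration hI) hM
  exact ⟨⟨σ, φ, h⟩, PeirceIso.exists_arrow_map ⟨σ, φ, h⟩ hρ hJ.vertex_notMem hI hJ.arrows⟩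

/-- Two arrows start at the end of the arrow `c`; the products of the elements over the
arrows all vanish, or never vanish. -/
theorem IsGradedPresentation.not_isLocallyGentle_out (hJ : IsGradedPresentation J) {c b b' : Γ.E}
    (hbb : b ≠ b') (hb : Γ.s b = Γ.t c) (hb' : Γ.s b' = Γ.t c)
    (h : (∀ d, Γ.s d = Γ.t c → ∀ x ∈ peirceCorner k (qv J (Γ.t d)) (qv J (Γ.t c)),
        ∀ y ∈ peirceCorner k (qv J (Γ.t c)) (qv J (Γ.s c)), x * y = 0) ∨
      ∀ d, Γ.s d = Γ.t c → ∀ x ∈ peirceCorner k (qv J (Γ.t d)) (qv J (Γ.t c)),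
        ∀ y ∈ peirceCorner k (qv J (Γ.t c)) (qv J (Γ.s c)), x * y = 0 → x = 0 ∨ y = 0) :
    ¬ IsLocallyGentle k J.ringCon.Quotient := by
  rintro ⟨Q, I, hg, hI, hM⟩
  obtain ⟨Φ, θ, hθ, hst⟩ := hJ.exists_peirceIso hI hM
  have hmem (p : Γ.E) : qa I (θ p) ∈ peirceCorner k (qv I (Φ.σ (Γ.t p))) (qv I (Φ.σ (Γ.s p))) := by
    rw [← (hst p).1, ← (hst p).2.1]
    exact qa_mem_peirce I _
  have hx := (hg (Φ.σ (Γ.t c))).xor_out (θ c) (θ b) (θ b') (hst c).2.1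
    (by rw [(hst b).1, hb]) (by rw [(hst b').1, hb']) (hθ.ne hbb)
  rw [← qa_mul_eq_zero, ← qa_mul_eq_zero] at hx
  -- The classes of `θ d` and `θ c` come from nonzero elements over `d` and `c` whose product
  -- vanishes exactly when that of `θ d` and `θ c` does. Either alternative in `h` then contradicts
  -- that exactly one of the two products vanishes.
  have key (d : Γ.E) (hd : Γ.s d = Γ.t c) := Φ.exists_preimage_mul (Γ.t d) (Γ.t c) (Γ.s c)
    (hd ▸ hmem d) (hmem c) (hst d).2.2 (hst c).2.2
  obtain ⟨x, hx1, y, hy1, hx0, hy0, hxy⟩ := key b hb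
  obtain ⟨x', hx1', y', hy1', hx0', hy0', hxy'⟩ := key b' hb'
  rw [← hxy, ← hxy'] at hx
  rcases h with h | h
  · have h1 := h b hb x hx1 y hy1
    have h2 := h b' hb' x' hx1' y' hy1'
    rcases hx with hx | hx
    · exact hx.2 h2
    · exact hx.2 h1
  · rcases hx with hx | hx
    · exact (h b hb x hx1 y hy1 hx.1).elim hx0 hy0
    · exact (h b' hb' x' hx1' y' hy1' hx.1).elim hx0' hy0'

/-- Two arrows end at the start of the arrow `c`; the products of the elements over the
arrows all vanish, or never vanish. -/
theorem IsGradedPresentation.not_isLocallyGentle_in (hJ : IsGradedPresentation J) {c b b' : Γ.E}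
    (hbb : b ≠ b') (hb : Γ.t b = Γ.s c) (hb' : Γ.t b' = Γ.s c)
    (h : (∀ d, Γ.t d = Γ.s c → ∀ x ∈ peirceCorner k (qv J (Γ.t c)) (qv J (Γ.s c)),
        ∀ y ∈ peirceCorner k (qv J (Γ.s c)) (qv J (Γ.s d)), x * y = 0) ∨
      ∀ d, Γ.t d = Γ.s c → ∀ x ∈ peirceCorner k (qv J (Γ.t c)) (qv J (Γ.s c)),
        ∀ y ∈ peirceCorner k (qv J (Γ.s c)) (qv J (Γ.s d)), x * y = 0 → x = 0 ∨ y = 0) :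
    ¬ IsLocallyGentle k J.ringCon.Quotient := by
  rintro ⟨Q, I, hg, hI, hM⟩
  obtain ⟨Φ, θ, hθ, hst⟩ := hJ.exists_peirceIso hI hM
  have hmem (p : Γ.E) : qa I (θ p) ∈ peirceCorner k (qv I (Φ.σ (Γ.t p))) (qv I (Φ.σ (Γ.s p))) := by
    rw [← (hst p).1, ← (hst p).2.1]
    exact qa_mem_peirce I _
  have hx := (hg (Φ.σ (Γ.s c))).xor_in (θ c) (θ b) (θ b') (hst c).1
    (by rw [(hst b).2.1, hb]) (by rw [(hst b').2.1, hb']) (hθ.ne hbb)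
  rw [← qa_mul_eq_zero, ← qa_mul_eq_zero] at hx
  have key (d : Γ.E) (hd : Γ.t d = Γ.s c) := Φ.exists_preimage_mul (Γ.t c) (Γ.s c) (Γ.s d)
    (hmem c) (hd ▸ hmem d) (hst c).2.2 (hst d).2.2
  obtain ⟨x, hx1, y, hy1, hx0, hy0, hxy⟩ := key b hb
  obtain ⟨x', hx1', y', hy1', hx0', hy0', hxy'⟩ := key b' hb'
  rw [← hxy, ← hxy'] at hx
  rcases h with h | h
  · have h1 := h b hb x hx1 y hy1
    have h2 := h b' hb' x' hx1' y' hy1'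
    rcases hx with hx | hx
    · exact hx.2 h2
    · exact hx.2 h1
  · rcases hx with hx | hx
    · exact (h b hb x hx1 y hy1 hx.1).elim hx0 hy0
    · exact (h b' hb' x' hx1' y' hy1' hx.1).elim hx0' hy0'

/-- Two parallel arrows `b, b'` follow the arrow `c` and are followed by two arrows `a, a'`,
and all paths of length three vanish. -/
theorem IsGradedPresentation.not_isLocallyGentle_glue_out (hJ : IsGradedPresentation J)
    {a a' b b' c : Γ.E} (haa : a ≠ a') (hbb : b ≠ b') (hb : Γ.s b = Γ.t c) (hb' : Γ.s b' = Γ.t c)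
    (htb : Γ.t b' = Γ.t b) (ha : Γ.s a = Γ.t b) (ha' : Γ.s a' = Γ.t b)
    (h : ∀ d, Γ.s d = Γ.t b → ∀ x ∈ peirceCorner k (qv J (Γ.t d)) (qv J (Γ.s c)), x = 0) :
    ¬ IsLocallyGentle k J.ringCon.Quotient := by
  rintro ⟨Q, I, hg, hI, hM⟩
  obtain ⟨Φ, θ, hθ, hst⟩ := hJ.exists_peirceIso hI hM
  have hmem (p : Γ.E) : qa I (θ p) ∈ peirceCorner k (qv I (Φ.σ (Γ.t p))) (qv I (Φ.σ (Γ.s p))) := by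
    rw [← (hst p).1, ← (hst p).2.1]
    exact qa_mem_peirce I _
  have hx := (hg (Φ.σ (Γ.t c))).xor_out (θ c) (θ b) (θ b') (hst c).2.1
    (by rw [(hst b).1, hb]) (by rw [(hst b').1, hb']) (hθ.ne hbb)
  -- One of the parallel arrows continues `θ c` without a relation. Both have the same target, so
  -- whichever it is, the arrows `θ a` and `θ a'` follow it, and one of them again satisfies no
  -- relation with it.
  obtain ⟨β, hβs, hβt, hβ⟩ : ∃ β, Γ.s β = Γ.t c ∧ Γ.t β = Γ.t b ∧
      arrow k Q (θ β) * arrow k Q (θ c) ∉ I := by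
    rcases hx with hx | hx
    · exact ⟨b', hb', htb, hx.2⟩
    · exact ⟨b, hb, rfl, hx.2⟩
  have hy := (hg (Φ.σ (Γ.t b))).xor_out (θ β) (θ a) (θ a') (by rw [(hst β).2.1, hβt])
    (by rw [(hst a).1, ha]) (by rw [(hst a').1, ha']) (hθ.ne haa)
  obtain ⟨α, hαs, hα⟩ : ∃ α, Γ.s α = Γ.t b ∧ arrow k Q (θ α) * arrow k Q (θ β) ∉ I := by
    rcases hy with hy | hy
    · exact ⟨a', ha', hy.2⟩
    · exact ⟨a, ha, hy.2⟩
  -- Two consecutive nonzero products give a nonzero path of length three, in a component that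
  -- vanishes in `ℂΓ/J` by `h`.
  have hne := qa_mul_mul_ne_zero hI (by rw [(hst α).1, (hst β).2.1, hαs, hβt])
    (by rw [(hst β).1, (hst c).2.1, hβs]) hα hβ
  have h1 : qa I (θ α) * qa I (θ β) * qa I (θ c) ∈
      peirceCorner k (qv I (Φ.σ (Γ.t α))) (qv I (Φ.σ (Γ.s c))) :=
    mul_mem_peirceCorner (mul_mem_peirceCorner (hmem α) (by
      have := hmem β
      rwa [hβt, ← hαs] at this)) (by
      have := hmem c
      rwa [← hβs] at this)
  obtain ⟨y, -, hy0⟩ := Φ.exists_preimage _ _ h1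
  exact hy0 hne (h α hαs y.1 y.2)

/-- Two parallel arrows `b, b'` are followed by the arrow `c` and follow two arrows `a, a'`,
and all paths of length three vanish. -/
theorem IsGradedPresentation.not_isLocallyGentle_glue_in (hJ : IsGradedPresentation J)
    {a a' b b' c : Γ.E} (haa : a ≠ a') (hbb : b ≠ b') (hb : Γ.t b = Γ.s c) (hb' : Γ.t b' = Γ.s c)
    (hsb : Γ.s b' = Γ.s b) (ha : Γ.t a = Γ.s b) (ha' : Γ.t a' = Γ.s b)
    (h : ∀ d, Γ.t d = Γ.s b → ∀ x ∈ peirceCorner k (qv J (Γ.t c)) (qv J (Γ.s d)), x = 0) :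
    ¬ IsLocallyGentle k J.ringCon.Quotient := by
  rintro ⟨Q, I, hg, hI, hM⟩
  obtain ⟨Φ, θ, hθ, hst⟩ := hJ.exists_peirceIso hI hM
  have hmem (p : Γ.E) : qa I (θ p) ∈ peirceCorner k (qv I (Φ.σ (Γ.t p))) (qv I (Φ.σ (Γ.s p))) := by
    rw [← (hst p).1, ← (hst p).2.1]
    exact qa_mem_peirce I _
  have hx := (hg (Φ.σ (Γ.s c))).xor_in (θ c) (θ b) (θ b') (hst c).1
    (by rw [(hst b).2.1, hb]) (by rw [(hst b').2.1, hb']) (hθ.ne hbb)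
  obtain ⟨β, hβt, hβs, hβ⟩ : ∃ β, Γ.t β = Γ.s c ∧ Γ.s β = Γ.s b ∧
      arrow k Q (θ c) * arrow k Q (θ β) ∉ I := by
    rcases hx with hx | hx
    · exact ⟨b', hb', hsb, hx.2⟩
    · exact ⟨b, hb, rfl, hx.2⟩
  have hy := (hg (Φ.σ (Γ.s b))).xor_in (θ β) (θ a) (θ a') (by rw [(hst β).1, hβs])
    (by rw [(hst a).2.1, ha]) (by rw [(hst a').2.1, ha']) (hθ.ne haa)
  obtain ⟨α, hαt, hα⟩ : ∃ α, Γ.t α = Γ.s b ∧ arrow k Q (θ β) * arrow k Q (θ α) ∉ I := by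
    rcases hy with hy | hy
    · exact ⟨a', ha', hy.2⟩
    · exact ⟨a, ha, hy.2⟩
  have hne := qa_mul_mul_ne_zero hI (by rw [(hst c).1, (hst β).2.1, hβt])
    (by rw [(hst β).1, (hst α).2.1, hβs, hαt]) hβ hα
  have h1 : qa I (θ c) * qa I (θ β) * qa I (θ α) ∈
      peirceCorner k (qv I (Φ.σ (Γ.t c))) (qv I (Φ.σ (Γ.s α))) :=
    mul_mem_peirceCorner (mul_mem_peirceCorner (hmem c) (by
      have := hmem β
      rwa [hβt] at this)) (by
      have := hmem α
      rwa [hαt, ← hβs] at this)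
  obtain ⟨y, -, hy0⟩ := Φ.exists_preimage _ _ h1
  exact hy0 hne (h α hαt y.1 y.2)

end Transfer

end FinQuiver

namespace ModQuiver

variable (Q : ModQuiver)

/-! ### The tensor algebra of a modulated quiver -/

section TensorAlgebra

theorem vert_add (i : Q.V) (d d' : (Q.M i).toSub) : Q.vert i (d + d') = Q.vert i d + Q.vert i d' := by
  unfold vert
  rw [← map_add, Prod.mk_add_mk, add_zero, Pi.single_add]

theorem vert_smul (r : ℝ) (i : Q.V) (d : (Q.M i).toSub) : Q.vert i (r • d) = r • Q.vert i d := by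
  unfold vert
  rw [← map_smul, Prod.smul_mk, smul_zero, Pi.single_smul]

theorem arr_add (a : Q.E) (m n : Q.bimod a) : Q.arr a (m + n) = Q.arr a m + Q.arr a n := by
  unfold arr
  rw [← map_add, Prod.mk_add_mk, add_zero, Pi.single_add]

theorem arr_smul (r : ℝ) (a : Q.E) (m : Q.bimod a) : Q.arr a (r • m) = r • Q.arr a m := by
  unfold arr
  rw [← map_smul, Prod.smul_mk, smul_zero, Pi.single_smul]

/-- The inclusion of the bimodule of an arrow. -/
def arrHom (a : Q.E) : Q.bimod a →ₗ[ℝ] Q.T where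
  toFun := Q.arr a
  map_add' := Q.arr_add a
  map_smul' r := Q.arr_smul r a

theorem arr_zero (a : Q.E) : Q.arr a 0 = 0 := (Q.arrHom a).map_zero

theorem arrEl_of_mem {a : Q.E} {x : ℍ[ℝ]} (h : x ∈ Q.bimod a) : Q.arrEl a x = Q.arr a ⟨x, h⟩ :=
  dif_pos h

theorem vertEl_of_mem {i : Q.V} {x : ℍ[ℝ]} (h : x ∈ (Q.M i).toSub) :
    Q.vertEl i x = Q.vert i ⟨x, h⟩ :=
  dif_pos h

theorem arrEl_coe (a : Q.E) (m : Q.bimod a) : Q.arrEl a m.1 = Q.arr a m := Q.arrEl_of_mem m.2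

theorem toT_arrows (m : Q.Arrows) : Q.toT (0, m) = ∑ a, Q.arr a (m a) := by
  unfold arr
  rw [← map_sum]
  congr 1
  refine Prod.ext ?_ ?_
  · rw [Prod.fst_sum]
    simp
  · rw [Prod.snd_sum]
    exact (Finset.univ_sum_single m).symm

theorem toT_base (x : Q.Base) : Q.toT (x, 0) = ∑ i, Q.vert i (x i) := by
  unfold vert
  rw [← map_sum]
  congr 1
  refine Prod.ext ?_ ?_
  · rw [Prod.fst_sum]
    exact (Finset.univ_sum_single x).symm
  · rw [Prod.snd_sum]
    simp

theorem sum_vert_one : ∑ i, Q.vert i 1 = 1 := by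
  have h := RingQuot.mkAlgHom_rel ℝ (TensorRel.one (Q := Q))
  rw [map_one] at h
  rw [← h]
  exact (Q.toT_base 1).symm

theorem vert_mul_arr (a : Q.E) (d : (Q.M (Q.t a)).toSub) (m : Q.bimod a) :
    Q.vert (Q.t a) d * Q.arr a m = Q.arr a ⟨d * m, left_mul_mem _ _ _ d.2 m.2⟩ := by
  have h := RingQuot.mkAlgHom_rel ℝ
    (TensorRel.left (Q := Q) (Pi.single (Q.t a) d) (Pi.single a m))
  rw [map_mul] at h
  refine h.trans ?_
  change Q.toT _ = Q.toT _
  congr 2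
  funext b
  apply Subtype.ext
  by_cases hb : b = a
  · subst hb
    simp [lact]
  · simp [lact, Pi.single_eq_of_ne hb]

theorem arr_mul_vert (a : Q.E) (m : Q.bimod a) (d : (Q.M (Q.s a)).toSub) :
    Q.arr a m * Q.vert (Q.s a) d = Q.arr a ⟨m * d, right_mul_mem _ _ _ d.2 m.2⟩ := by
  have h := RingQuot.mkAlgHom_rel ℝ
    (TensorRel.right (Q := Q) (Pi.single a m) (Pi.single (Q.s a) d))
  rw [map_mul] at h
  refine h.trans ?_
  change Q.toT _ = Q.toT _
  congr 2
  funext b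
  apply Subtype.ext
  by_cases hb : b = a
  · subst hb
    simp [ract]
  · simp [ract, Pi.single_eq_of_ne hb]

theorem vert_one_mul_arr (a : Q.E) (m : Q.bimod a) : Q.vert (Q.t a) 1 * Q.arr a m = Q.arr a m := by
  rw [vert_mul_arr]; congr 1; exact Subtype.ext (one_mul _)

theorem arr_mul_vert_one (a : Q.E) (m : Q.bimod a) : Q.arr a m * Q.vert (Q.s a) 1 = Q.arr a m := by
  rw [arr_mul_vert]; congr 1; exact Subtype.ext (mul_one _)

theorem arr_mul_vert_ne {i : Q.V} {a : Q.E} (hi : Q.s a ≠ i) (m : Q.bimod a) (d : (Q.M i).toSub) :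
    Q.arr a m * Q.vert i d = 0 := by
  rw [← arr_mul_vert_one, mul_assoc, vert_mul_ne Q hi, mul_zero]

theorem vertEl_mul_arrEl {a : Q.E} {d x : ℍ[ℝ]} (hd : d ∈ (Q.M (Q.t a)).toSub)
    (hx : x ∈ Q.bimod a) : Q.vertEl (Q.t a) d * Q.arrEl a x = Q.arrEl a (d * x) := by
  rw [vertEl_of_mem Q hd, arrEl_of_mem Q hx, arrEl_of_mem Q (left_mul_mem _ _ _ hd hx),
    vert_mul_arr]

theorem arrEl_mul_vertEl {a : Q.E} {d x : ℍ[ℝ]} (hx : x ∈ Q.bimod a)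
    (hd : d ∈ (Q.M (Q.s a)).toSub) : Q.arrEl a x * Q.vertEl (Q.s a) d = Q.arrEl a (x * d) := by
  rw [vertEl_of_mem Q hd, arrEl_of_mem Q hx, arrEl_of_mem Q (right_mul_mem _ _ _ hd hx),
    arr_mul_vert]

/-- The elements of the middle division algebra move through a product of two arrows. -/
theorem arrEl_mul_arrEl_assoc {a b : Q.E} (hab : Q.s a = Q.t b) {x d y : ℍ[ℝ]} (hx : x ∈ Q.bimod a)
    (hd : d ∈ (Q.M (Q.s a)).toSub) (hy : y ∈ Q.bimod b) :
    Q.arrEl a (x * d) * Q.arrEl b y = Q.arrEl a x * Q.arrEl b (d * y) := by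
  have hd' : d ∈ (Q.M (Q.t b)).toSub := hab ▸ hd
  rw [← arrEl_mul_vertEl Q hx hd, mul_assoc, hab, vertEl_mul_arrEl Q hd' hy]

end TensorAlgebra

/-! ### Paths in the tensor algebra -/

variable {Q}

/-- `TPath n i j x` if `x` is a product of `n` elements of arrow bimodules along a path from
`i` to `j`, times an element of `M i`. -/
inductive TPath : ℕ → Q.V → Q.V → Q.T → Prop
  | nil (i : Q.V) (d : (Q.M i).toSub) : TPath 0 i i (Q.vert i d)
  | cons {n : ℕ} {i : Q.V} (a : Q.E) (m : Q.bimod a) {x : Q.T} (h : TPath n i (Q.s a) x) :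
      TPath (n + 1) i (Q.t a) (Q.arr a m * x)

theorem TPath.vert_mul {n : ℕ} {i j : Q.V} {x : Q.T} (h : TPath n i j x) :
    Q.vert j 1 * x = x := by
  cases h with
  | nil d => rw [ModQuiver.vert_mul, one_mul]
  | cons a m h => rw [← mul_assoc, vert_one_mul_arr]

theorem TPath.mul_vert {n : ℕ} {i j : Q.V} {x : Q.T} (h : TPath n i j x) :
    x * Q.vert i 1 = x := by
  induction h with
  | nil i d => rw [ModQuiver.vert_mul, mul_one]
  | cons a m h ih => rw [mul_assoc, ih]

theorem TPath.vert_mul' {n : ℕ} {i j : Q.V} {x : Q.T} (h : TPath n i j x) (d : (Q.M j).toSub) :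
    TPath n i j (Q.vert j d * x) := by
  cases h with
  | nil _ d' => rw [ModQuiver.vert_mul]; exact .nil _ _
  | cons a m h => rw [← mul_assoc, vert_mul_arr]; exact .cons a _ h

variable (Q) in
theorem span_tPath : Submodule.span ℝ {x : Q.T | ∃ n i j, TPath n i j x} = ⊤ := by
  set S := Submodule.span ℝ {x : Q.T | ∃ n i j, TPath n i j x} with hS
  have hmul (y : Q.T) : ∀ x ∈ S, y * x ∈ S := by
    obtain ⟨y, rfl⟩ := RingQuot.mkAlgHom_surjective ℝ Q.TensorRel y
    induction y using TensorAlgebra.induction with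
    | algebraMap r =>
      intro x hx
      rw [AlgHom.commutes, ← Algebra.smul_def]
      exact S.smul_mem r hx
    | ι z =>
      intro x hx
      obtain ⟨d, m⟩ := z
      have h0 : RingQuot.mkAlgHom ℝ Q.TensorRel (TensorAlgebra.ι ℝ (d, m)) =
          ∑ i, Q.vert i (d i) + ∑ a, Q.arr a (m a) := by
        rw [← toT_base, ← toT_arrows, ← map_add, Prod.mk_add_mk, add_zero, zero_add]
        rfl
      rw [h0, add_mul, Finset.sum_mul, Finset.sum_mul]
      induction hx using Submodule.span_induction with
      | zero => simp
      | add a b _ _ h1 h2 =>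
        have := S.add_mem h1 h2
        simp only [mul_add, Finset.sum_add_distrib]
        convert this using 1
        abel
      | smul c a _ h1 =>
        have := S.smul_mem c h1
        simpa only [mul_smul_comm, smul_add, Finset.smul_sum] using this
      | mem x h =>
        obtain ⟨n, i, j, h⟩ := h
        refine S.add_mem (S.sum_mem fun v _ => ?_) (S.sum_mem fun a _ => ?_)
        · by_cases hv : v = j
          · subst hv
            exact Submodule.subset_span ⟨n, i, _, h.vert_mul' _⟩
          · rw [← h.vert_mul, ← mul_assoc, vert_mul_ne Q hv, zero_mul]
            exact S.zero_mem
        · by_cases hv : Q.s a = j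
          · subst hv
            exact Submodule.subset_span ⟨_, i, _, .cons a _ h⟩
          · rw [← h.vert_mul, ← mul_assoc, arr_mul_vert_ne Q hv, zero_mul]
            exact S.zero_mem
    | mul a b h1 h2 => intro x hx; rw [map_mul, mul_assoc]; exact h1 _ (h2 _ hx)
    | add a b h1 h2 => intro x hx; rw [map_add, add_mul]; exact S.add_mem (h1 _ hx) (h2 _ hx)
  rw [eq_top_iff]
  intro y _
  rw [← mul_one y]
  refine hmul y 1 ?_
  rw [← sum_vert_one]
  exact Submodule.sum_mem _ fun v _ => Submodule.subset_span ⟨0, v, v, .nil v 1⟩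

theorem mem_span_tPath (i j : Q.V) (x : Q.T) :
    Q.vert j 1 * x * Q.vert i 1 ∈ Submodule.span ℝ {y | ∃ n, TPath n i j y} := by
  have hx : x ∈ Submodule.span ℝ {x : Q.T | ∃ n i j, TPath n i j x} := by
    rw [span_tPath]; trivial
  induction hx using Submodule.span_induction with
  | zero => simp
  | add a b _ _ h1 h2 => rw [mul_add, add_mul]; exact Submodule.add_mem _ h1 h2
  | smul c a _ h1 => rw [mul_smul_comm, smul_mul_assoc]; exact Submodule.smul_mem _ c h1
  | mem x h =>
    obtain ⟨n, i', j', h⟩ := h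
    by_cases hi : i' = i
    · by_cases hj : j = j'
      · subst hi hj
        rw [h.vert_mul, h.mul_vert]
        exact Submodule.subset_span ⟨n, h⟩
      · rw [← h.vert_mul, ← mul_assoc, vert_mul_ne Q hj, zero_mul, zero_mul]
        exact Submodule.zero_mem _
    · rw [← h.mul_vert, mul_assoc, mul_assoc, vert_mul_ne Q hi, mul_zero, mul_zero]
      exact Submodule.zero_mem _

theorem TPath.exists_vert {i j : Q.V} {x : Q.T} (h : TPath 0 i j x) :
    i = j ∧ ∃ d, x = Q.vert i d := by
  cases h
  exact ⟨rfl, _, rfl⟩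

theorem TPath.exists_arr {i j : Q.V} {x : Q.T} (h : TPath 1 i j x) :
    ∃ a m, Q.s a = i ∧ Q.t a = j ∧ x = Q.arr a m := by
  cases h with
  | cons a m h =>
    obtain ⟨rfl, d, rfl⟩ := h.exists_vert
    exact ⟨a, _, rfl, rfl, arr_mul_vert Q a m d⟩

theorem TPath.exists_arr_mul {i j : Q.V} {x : Q.T} (h : TPath 2 i j x) :
    ∃ a m b n, Q.s b = i ∧ Q.t b = Q.s a ∧ Q.t a = j ∧ x = Q.arr a m * Q.arr b n := by
  cases h with
  | cons a m h =>
    obtain ⟨b, n, h1, h2, rfl⟩ := h.exists_arr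
    exact ⟨a, m, b, n, h1, h2, rfl, rfl⟩

theorem TPath.mem_arrowIdealSq {n : ℕ} {i j : Q.V} {x : Q.T} (h : TPath (n + 2) i j x) :
    x ∈ Q.arrowIdealSq := by
  cases h with
  | cons a m h =>
    generalize Q.s a = j at h
    cases h with
    | cons b m' h =>
      rw [← mul_assoc]
      exact TwoSidedIdeal.mul_mem_right _ _ _ (TwoSidedIdeal.subset_span ⟨a, b, m, m', rfl⟩)

/-! ### Graded modulated quivers -/

variable (Q) in
/-- A function on the vertices which increases by one along each arrow. -/
def IsLevel (ρ : Q.V → ℕ) : Prop := ∀ a, ρ (Q.t a) = ρ (Q.s a) + 1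

section Levels

variable {ρ : Q.V → ℕ} (hρ : Q.IsLevel ρ)

include hρ

theorem IsLevel.gam : Q.Gam.IsLevel fun w : Q.GV => ρ w.1.1 := fun p => hρ p.1.1

theorem IsLevel.of_tPath {n : ℕ} {i j : Q.V} {x : Q.T} (h : TPath n i j x) :
    ρ j = ρ i + n := by
  induction h with
  | nil => rfl
  | cons a m h ih => rw [hρ a, ih]; rfl

theorem IsLevel.mem_span_tPath {i j : Q.V} {n : ℕ} (hn : ρ j = ρ i + n) (x : Q.T) :
    Q.vert j 1 * x * Q.vert i 1 ∈ Submodule.span ℝ {y | TPath n i j y} := by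
  refine Submodule.span_mono ?_ (ModQuiver.mem_span_tPath i j x)
  rintro y ⟨m, hm⟩
  have := hρ.of_tPath hm
  obtain rfl : m = n := by omega
  exact hm

theorem IsLevel.vert_mul_mul_vert_eq_zero {i j : Q.V} (hn : ρ j < ρ i) (x : Q.T) :
    Q.vert j 1 * x * Q.vert i 1 = 0 := by
  have h := ModQuiver.mem_span_tPath i j x
  have h0 : {y : Q.T | ∃ n, TPath n i j y} = ∅ := by
    ext y
    simp only [Set.mem_ofPred_eq, Set.mem_empty_iff_false, iff_false]
    rintro ⟨n, hn⟩
    have := hρ.of_tPath hn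
    omega
  rw [h0, Submodule.span_empty] at h
  exact h

/-- An ideal is admissible if it meets the vertex algebras and the arrow bimodules trivially. -/
theorem IsLevel.le_arrowIdealSq {I : TwoSidedIdeal Q.T}
    (hv : ∀ i d, Q.vert i d ∈ I → d = 0)
    (ha : ∀ i j (m : ∀ a, Q.bimod a), (∀ a, ¬ (Q.s a = i ∧ Q.t a = j) → m a = 0) →
      ∑ a, Q.arr a (m a) ∈ I → ∀ a, m a = 0) : I ≤ Q.arrowIdealSq := by
  -- It suffices to treat the corners of an element of `I`. By the level function, a corner consists
  -- of paths of a single length `n`.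
  have key (i j : Q.V) (x : Q.T) (hx : x ∈ I) : Q.vert j 1 * x * Q.vert i 1 ∈ Q.arrowIdealSq := by
    have hI : Q.vert j 1 * x * Q.vert i 1 ∈ I := I.mul_mem_right _ _ (I.mul_mem_left _ _ hx)
    rcases Nat.lt_or_ge (ρ j) (ρ i) with hlt | hle
    · rw [hρ.vert_mul_mul_vert_eq_zero hlt]
      exact TwoSidedIdeal.zero_mem _
    obtain ⟨n, hn⟩ := Nat.exists_eq_add_of_le hle
    have hspan := hρ.mem_span_tPath hn x
    generalize Q.vert j 1 * x * Q.vert i 1 = z at hI hspan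
    -- Lengths zero and one are excluded by `hv` and `ha`, which make the corner zero. Longer
    -- products of arrows lie in the square of the arrow ideal.
    match n with
    | 0 =>
      have h0 : z = 0 := by
        by_cases hij : i = j
        · subst hij
          obtain ⟨d, rfl⟩ : ∃ d, z = Q.vert i d := by
            clear hI
            induction hspan using Submodule.span_induction with
            | zero => exact ⟨0, by simpa using (Q.vert_smul 0 i 0).symm⟩
            | add a b _ _ h1 h2 =>
              obtain ⟨d, rfl⟩ := h1
              obtain ⟨d', rfl⟩ := h2
              exact ⟨d + d', (vert_add Q i d d').symm⟩
            | smul c a _ h1 =>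
              obtain ⟨d, rfl⟩ := h1
              exact ⟨c • d, (vert_smul Q c i d).symm⟩
            | mem x h => exact h.exists_vert.2
          rw [hv i d hI]
          simpa using Q.vert_smul 0 i 0
        · have h0 : {y : Q.T | TPath 0 i j y} = ∅ := by
            ext y
            simp only [Set.mem_ofPred_eq, Set.mem_empty_iff_false, iff_false]
            exact fun h => hij h.exists_vert.1
          rw [h0, Submodule.span_empty] at hspan
          exact hspan
      rw [h0]
      exact TwoSidedIdeal.zero_mem _
    | 1 =>
      obtain ⟨m, hm, rfl⟩ : ∃ m : ∀ a, Q.bimod a, (∀ a, ¬ (Q.s a = i ∧ Q.t a = j) → m a = 0) ∧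
          z = ∑ a, Q.arr a (m a) := by
        clear hI
        induction hspan using Submodule.span_induction with
        | zero => exact ⟨0, fun _ _ => rfl, by simp [arr_zero]⟩
        | add a b _ _ h1 h2 =>
          obtain ⟨m, hm, rfl⟩ := h1
          obtain ⟨m', hm', rfl⟩ := h2
          refine ⟨m + m', fun a h => by rw [Pi.add_apply, hm a h, hm' a h, add_zero], ?_⟩
          simp [arr_add, Finset.sum_add_distrib]
        | smul c a _ h1 =>
          obtain ⟨m, hm, rfl⟩ := h1
          refine ⟨c • m, fun a h => by rw [Pi.smul_apply, hm a h, smul_zero], ?_⟩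
          simp [arr_smul, Finset.smul_sum]
        | mem x h =>
          obtain ⟨a, m, rfl, rfl, rfl⟩ := h.exists_arr
          refine ⟨Pi.single a m, fun b hb => ?_, ?_⟩
          · rw [Pi.single_eq_of_ne]
            rintro rfl
            exact hb ⟨rfl, rfl⟩
          · rw [Finset.sum_eq_single a]
            · rw [Pi.single_eq_same]
            · intro b _ hb
              rw [Pi.single_eq_of_ne hb, arr_zero]
            · simp
      rw [Finset.sum_eq_zero fun a _ => by rw [ha i j m hm hI a, arr_zero]]
      exact TwoSidedIdeal.zero_mem _
    | n + 2 =>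
      clear hI
      induction hspan using Submodule.span_induction with
      | zero => exact TwoSidedIdeal.zero_mem _
      | add a b _ _ h1 h2 => exact TwoSidedIdeal.add_mem _ h1 h2
      | smul c a _ h1 => rw [Algebra.smul_def]; exact TwoSidedIdeal.mul_mem_left _ _ _ h1
      | mem x h => exact h.mem_arrowIdealSq
  intro x hx
  have hx1 : x = ∑ j, ∑ i, Q.vert j 1 * x * Q.vert i 1 := by
    simp only [← Finset.mul_sum, ← Finset.sum_mul, sum_vert_one, one_mul, mul_one]
  rw [hx1]
  exact sum_mem fun j _ => sum_mem fun i _ => key i j x hx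

end Levels

end ModQuiver

/-! ### Quaternions over `ℝ` and `ℂ` -/

/-- The quaternion with complex coefficients defined by a quaternion. -/
def quatCFun (q : ℍ[ℝ]) : ℍ[ℂ] := ⟨q.re, q.imI, q.imJ, q.imK⟩

theorem quatCFun_re (q : ℍ[ℝ]) : (quatCFun q).re = q.re := rfl

theorem quatCFun_imI (q : ℍ[ℝ]) : (quatCFun q).imI = q.imI := rfl

theorem quatCFun_imJ (q : ℍ[ℝ]) : (quatCFun q).imJ = q.imJ := rfl

theorem quatCFun_imK (q : ℍ[ℝ]) : (quatCFun q).imK = q.imK := rfl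

/-- The inclusion of the quaternions into the quaternions with complex coefficients. -/
def quatC : ℍ[ℝ] →ₐ[ℝ] ℍ[ℂ] where
  toFun := quatCFun
  map_one' := by
    ext <;> simp [quatCFun_re, quatCFun_imI, quatCFun_imJ, quatCFun_imK]
  map_mul' p q := by
    ext <;> simp [quatCFun_re, quatCFun_imI, quatCFun_imJ, quatCFun_imK]
  map_zero' := by
    ext <;> simp [quatCFun_re, quatCFun_imI, quatCFun_imJ, quatCFun_imK]
  map_add' p q := by
    ext <;> simp [quatCFun_re, quatCFun_imI, quatCFun_imJ, quatCFun_imK]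
  commutes' r := by
    ext <;> simp [quatCFun_re, quatCFun_imI, quatCFun_imJ, quatCFun_imK,
      Algebra.algebraMap_eq_smul_one]

namespace ModQuiver

/-! ### Representations by quaternionic matrices -/

section Model

variable (Q : ModQuiver)

/-- The vertex algebras as diagonal matrices. -/
def modelBase : Q.Base →ₗ[ℝ] Matrix Q.V Q.V ℍ[ℝ] where
  toFun x := Matrix.diagonal fun i => (x i : ℍ[ℝ])
  map_add' x y := by rw [Matrix.diagonal_add]; rfl
  map_smul' r x := by rw [RingHom.id_apply, ← Matrix.diagonal_smul]; rfl

/-- The arrow bimodules as matrix entries, rescaled by `κ`. -/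
def modelArrows (κ : Q.E → ℝ) : Q.Arrows →ₗ[ℝ] Matrix Q.V Q.V ℍ[ℝ] where
  toFun m := ∑ a, Matrix.single (Q.t a) (Q.s a) (κ a • (m a : ℍ[ℝ]))
  map_add' x y := by
    rw [← Finset.sum_add_distrib]
    refine Finset.sum_congr rfl fun a _ => ?_
    rw [← Matrix.single_add, ← smul_add]
    rfl
  map_smul' r x := by
    rw [RingHom.id_apply, Finset.smul_sum]
    refine Finset.sum_congr rfl fun a _ => ?_
    rw [Matrix.smul_single, smul_comm]
    rfl

theorem diagonal_mul_single {n R : Type} [Fintype n] [DecidableEq n] [Ring R] (d : n → R) (i j : n)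
    (c : R) : Matrix.diagonal d * Matrix.single i j c = Matrix.single i j (d i * c) := by
  ext p q
  rw [Matrix.diagonal_mul, Matrix.single_apply, Matrix.single_apply]
  split_ifs with h
  · rw [h.1]
  · rw [mul_zero]

theorem single_mul_diagonal {n R : Type} [Fintype n] [DecidableEq n] [Ring R] (d : n → R) (i j : n)
    (c : R) : Matrix.single i j c * Matrix.diagonal d = Matrix.single i j (c * d j) := by
  ext p q
  rw [Matrix.mul_diagonal, Matrix.single_apply, Matrix.single_apply]
  split_ifs with h
  · rw [h.2]
  · rw [zero_mul]

/-- The representation of the tensor algebra by matrices over `ℍ` in which the bimodule of the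
arrow `a` acts through multiplication by elements of `ℍ`, rescaled by `κ a`. -/
def model (κ : Q.E → ℝ) : Q.T →ₐ[ℝ] Matrix Q.V Q.V ℍ[ℝ] :=
  RingQuot.liftAlgHom ℝ ⟨TensorAlgebra.lift ℝ (Q.modelBase.coprod (Q.modelArrows κ)), by
    intro x y h
    cases h with
    | one =>
      rw [map_one, TensorAlgebra.lift_ι_apply, LinearMap.coprod_apply, map_zero, add_zero]
      exact Matrix.diagonal_one
    | mul x y =>
      rw [map_mul]
      simp only [TensorAlgebra.lift_ι_apply, LinearMap.coprod_apply, map_zero, add_zero]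
      exact Matrix.diagonal_mul_diagonal _ _
    | left x m =>
      rw [map_mul]
      simp only [TensorAlgebra.lift_ι_apply, LinearMap.coprod_apply, map_zero, add_zero, zero_add]
      change Matrix.diagonal _ * ∑ a, _ = ∑ a, _
      rw [Finset.mul_sum]
      refine Finset.sum_congr rfl fun a _ => ?_
      rw [diagonal_mul_single, mul_smul_comm]
      rfl
    | right m x =>
      rw [map_mul]
      simp only [TensorAlgebra.lift_ι_apply, LinearMap.coprod_apply, map_zero, add_zero, zero_add]
      change (∑ a, _) * Matrix.diagonal _ = ∑ a, _
      rw [Finset.sum_mul]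
      refine Finset.sum_congr rfl fun a _ => ?_
      rw [single_mul_diagonal, smul_mul_assoc]
      rfl⟩

theorem model_toT (κ : Q.E → ℝ) (z : Q.Base × Q.Arrows) :
    Q.model κ (Q.toT z) = Q.modelBase z.1 + Q.modelArrows κ z.2 := by
  unfold model toT
  rw [LinearMap.comp_apply]
  change RingQuot.liftAlgHom ℝ _ (RingQuot.mkAlgHom ℝ _ _) = _
  rw [RingQuot.liftAlgHom_mkAlgHom_apply, TensorAlgebra.lift_ι_apply, LinearMap.coprod_apply]

theorem model_vert (κ : Q.E → ℝ) (i : Q.V) (d : (Q.M i).toSub) :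
    Q.model κ (Q.vert i d) = Matrix.single i i (d : ℍ[ℝ]) := by
  unfold vert
  rw [model_toT, map_zero, add_zero]
  ext p q : 1
  change Matrix.diagonal (fun i' => ((Pi.single i d : Q.Base) i' : ℍ[ℝ])) p q = _
  rw [Matrix.diagonal_apply, Matrix.single_apply]
  by_cases hp : p = i
  · subst hp
    simp
  · rw [Pi.single_eq_of_ne hp, if_neg fun h : i = p ∧ i = q => hp h.1.symm]
    simp

theorem model_arr (κ : Q.E → ℝ) (a : Q.E) (m : Q.bimod a) :
    Q.model κ (Q.arr a m) = Matrix.single (Q.t a) (Q.s a) (κ a • (m : ℍ[ℝ])) := by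
  unfold arr
  rw [model_toT, map_zero, zero_add]
  change ∑ b, Matrix.single (Q.t b) (Q.s b) (κ b • ((Pi.single a m : Q.Arrows) b : ℍ[ℝ])) = _
  rw [Finset.sum_eq_single a]
  · rw [Pi.single_eq_same]
  · intro b _ hb
    rw [Pi.single_eq_of_ne hb]
    simp
  · simp

theorem model_vertEl (κ : Q.E → ℝ) {i : Q.V} {x : ℍ[ℝ]} (hx : x ∈ (Q.M i).toSub) :
    Q.model κ (Q.vertEl i x) = Matrix.single i i x := by
  rw [vertEl_of_mem Q hx, model_vert]

theorem model_arrEl (κ : Q.E → ℝ) {a : Q.E} {x : ℍ[ℝ]} (hx : x ∈ Q.bimod a) :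
    Q.model κ (Q.arrEl a x) = Matrix.single (Q.t a) (Q.s a) (κ a • x) := by
  rw [arrEl_of_mem Q hx, model_arr]

/-- If products of arrows act by zero, then the square of the arrow ideal acts by zero. -/
theorem model_eq_zero_of_mem {κ : Q.E → ℝ} (hκ : ∀ a b, Q.s a = Q.t b → κ a * κ b = 0) {x : Q.T}
    (hx : x ∈ Q.arrowIdealSq) : Q.model κ x = 0 := by
  have hle : Q.arrowIdealSq ≤ TwoSidedIdeal.ker (Q.model κ) := by
    refine TwoSidedIdeal.span_le.2 ?_
    rintro _ ⟨a, b, m, n, rfl⟩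
    refine (TwoSidedIdeal.mem_ker _).2 ?_
    rw [map_mul, model_arr, model_arr]
    by_cases h : Q.s a = Q.t b
    · rw [h, Matrix.single_mul_single_same, smul_mul_smul_comm, hκ a b h, zero_smul,
        Matrix.single_zero]
    · rw [Matrix.single_mul_single_of_ne _ _ _ _ h]
  exact (TwoSidedIdeal.mem_ker _).1 (hle hx)

/-- The complexification of `model`. -/
def modelC (κ : Q.E → ℝ) : Q.TC →ₐ[ℂ] Matrix Q.V Q.V ℍ[ℂ] :=
  Algebra.TensorProduct.lift (Algebra.ofId ℂ _)
    ((quatC.mapMatrix (m := Q.V)).comp (Q.model κ))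
    (fun z _ => (Algebra.commutes z _ : _ * _ = _ * _))

theorem modelC_tmul (κ : Q.E → ℝ) (z : ℂ) (x : Q.T) :
    Q.modelC κ (z ⊗ₜ[ℝ] x) = z • (Q.model κ x).map quatC := by
  exact (Algebra.TensorProduct.lift_tmul _ _ _ _ _).trans (Algebra.smul_def z _).symm

theorem modelC_tmul_vertEl (κ : Q.E → ℝ) (z : ℂ) {i : Q.V} {x : ℍ[ℝ]} (hx : x ∈ (Q.M i).toSub) :
    Q.modelC κ (z ⊗ₜ[ℝ] Q.vertEl i x) = Matrix.single i i (z • quatC x) := by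
  rw [modelC_tmul, model_vertEl Q κ hx, Matrix.map_single, Matrix.smul_single]

theorem modelC_tmul_arrEl (κ : Q.E → ℝ) (z : ℂ) {a : Q.E} {x : ℍ[ℝ]} (hx : x ∈ Q.bimod a) :
    Q.modelC κ (z ⊗ₜ[ℝ] Q.arrEl a x) =
      Matrix.single (Q.t a) (Q.s a) (((κ a : ℂ) * z) • quatC x) := by
  rw [modelC_tmul, model_arrEl Q κ hx, Matrix.map_single, Matrix.smul_single]
  congr 1
  rw [map_smul, mul_comm, mul_smul]
  rfl

end Model

/-! ### Real and imaginary parts -/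

section RealImag

variable {Q : ModQuiver}

/-- The real part of an element of `T ⊗ ℂ`. -/
def reC : Q.TC →ₗ[ℝ] Q.T := (TensorProduct.lid ℝ Q.T).toLinearMap ∘ₗ Complex.reLm.rTensor Q.T

/-- The imaginary part of an element of `T ⊗ ℂ`. -/
def imC : Q.TC →ₗ[ℝ] Q.T := (TensorProduct.lid ℝ Q.T).toLinearMap ∘ₗ Complex.imLm.rTensor Q.T

theorem reC_tmul (z : ℂ) (x : Q.T) : reC (z ⊗ₜ[ℝ] x) = z.re • x := rfl

theorem imC_tmul (z : ℂ) (x : Q.T) : imC (z ⊗ₜ[ℝ] x) = z.im • x := rfl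

theorem reC_add_imC (z : Q.TC) : (1 : ℂ) ⊗ₜ[ℝ] reC z + Complex.I ⊗ₜ[ℝ] imC z = z := by
  induction z using TensorProduct.induction_on with
  | zero => simp
  | add x y hx hy =>
    rw [map_add, map_add, TensorProduct.tmul_add, TensorProduct.tmul_add]
    nth_rewrite 3 [← hx]
    nth_rewrite 3 [← hy]
    abel
  | tmul z x =>
    rw [reC_tmul, imC_tmul, TensorProduct.tmul_smul, TensorProduct.tmul_smul,
      TensorProduct.smul_tmul', TensorProduct.smul_tmul', ← TensorProduct.add_tmul]
    congr 1
    simp only [Complex.real_smul, mul_one]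
    exact Complex.re_add_im z

theorem T_neg_smul (r : ℝ) (y : Q.T) : (-r) • y = -(r • y) := by
  rw [Algebra.smul_def, Algebra.smul_def, map_neg]
  exact neg_mul (algebraMap ℝ Q.T r) y

theorem reC_mul_tmul (w : Q.TC) (z : ℂ) (x : Q.T) :
    reC (w * z ⊗ₜ[ℝ] x) = z.re • (reC w * x) - z.im • (imC w * x) ∧
      imC (w * z ⊗ₜ[ℝ] x) = z.im • (reC w * x) + z.re • (imC w * x) := by
  have h := reC_add_imC w
  generalize reC w = a at h ⊢
  generalize imC w = b at h ⊢
  subst h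
  simp only [add_mul, Algebra.TensorProduct.tmul_mul_tmul, map_add, reC_tmul, imC_tmul]
  simp only [Complex.mul_re, Complex.mul_im, Complex.one_re, Complex.one_im, Complex.I_re,
    Complex.I_im, one_mul, mul_one, zero_mul, mul_zero, sub_zero, zero_sub, zero_add, add_zero]
  rw [T_neg_smul, sub_eq_add_neg]
  exact ⟨rfl, trivial⟩

theorem reC_tmul_mul (w : Q.TC) (z : ℂ) (x : Q.T) :
    reC (z ⊗ₜ[ℝ] x * w) = z.re • (x * reC w) - z.im • (x * imC w) ∧
      imC (z ⊗ₜ[ℝ] x * w) = z.im • (x * reC w) + z.re • (x * imC w) := by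
  have h := reC_add_imC w
  generalize reC w = a at h ⊢
  generalize imC w = b at h ⊢
  subst h
  simp only [mul_add, Algebra.TensorProduct.tmul_mul_tmul, map_add, reC_tmul, imC_tmul]
  simp only [Complex.mul_re, Complex.mul_im, Complex.one_re, Complex.one_im, Complex.I_re,
    Complex.I_im, one_mul, mul_one, zero_mul, mul_zero, sub_zero, zero_sub, zero_add, add_zero]
  rw [T_neg_smul, sub_eq_add_neg]
  exact ⟨rfl, trivial⟩

theorem smul_mem_ideal (I : TwoSidedIdeal Q.T) (r : ℝ) {x : Q.T} (hx : x ∈ I) : r • x ∈ I := by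
  rw [Algebra.smul_def]
  exact I.mul_mem_left _ _ hx

/-- The elements with real and imaginary part in `I` form a two-sided ideal of the complexification.
Hence a real linear condition on `I` can be tested on `I ⊗ ℂ` through these two parts. -/
theorem reC_mem_of_mem_idealC {I : TwoSidedIdeal Q.T} {z : Q.TC} (hz : z ∈ idealC I) :
    reC z ∈ I ∧ imC z ∈ I := by
  let K : TwoSidedIdeal Q.TC := TwoSidedIdeal.mk' {z | reC z ∈ I ∧ imC z ∈ I}
    (by simp [I.zero_mem])
    (fun {x y} hx hy => by
      simp only [Set.mem_ofPred_eq, map_add]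
      exact ⟨I.add_mem hx.1 hy.1, I.add_mem hx.2 hy.2⟩)
    (fun {x} hx => by
      simp only [Set.mem_ofPred_eq, map_neg]
      exact ⟨I.neg_mem hx.1, I.neg_mem hx.2⟩)
    (fun {x y} hy => by
      induction x using TensorProduct.induction_on with
      | zero => simp [I.zero_mem]
      | add a b ha hb =>
        simp only [Set.mem_ofPred_eq, add_mul, map_add] at ha hb ⊢
        exact ⟨I.add_mem ha.1 hb.1, I.add_mem ha.2 hb.2⟩
      | tmul z x =>
        simp only [Set.mem_ofPred_eq]
        rw [(reC_tmul_mul y z x).1, (reC_tmul_mul y z x).2]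
        have h1 := I.mul_mem_left x _ hy.1
        have h2 := I.mul_mem_left x _ hy.2
        exact ⟨I.sub_mem (smul_mem_ideal I _ h1) (smul_mem_ideal I _ h2),
          I.add_mem (smul_mem_ideal I _ h1) (smul_mem_ideal I _ h2)⟩)
    (fun {x y} hx => by
      induction y using TensorProduct.induction_on with
      | zero => simp [I.zero_mem]
      | add a b ha hb =>
        simp only [Set.mem_ofPred_eq, mul_add, map_add] at ha hb ⊢
        exact ⟨I.add_mem ha.1 hb.1, I.add_mem ha.2 hb.2⟩
      | tmul z y =>
        simp only [Set.mem_ofPred_eq]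
        rw [(reC_mul_tmul x z y).1, (reC_mul_tmul x z y).2]
        have h1 := I.mul_mem_right _ y hx.1
        have h2 := I.mul_mem_right _ y hx.2
        exact ⟨I.sub_mem (smul_mem_ideal I _ h1) (smul_mem_ideal I _ h2),
          I.add_mem (smul_mem_ideal I _ h1) (smul_mem_ideal I _ h2)⟩)
  have hle : idealC I ≤ K := by
    refine TwoSidedIdeal.span_le.2 ?_
    rintro _ ⟨x, hx, rfl⟩
    refine (TwoSidedIdeal.mem_mk' _ _ _ _ _ _ _).2 ?_
    simp only [Set.mem_ofPred_eq]
    rw [reC_tmul, imC_tmul]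
    exact ⟨smul_mem_ideal I _ hx, smul_mem_ideal I _ hx⟩
  have h := hle hz
  rw [TwoSidedIdeal.mem_mk'] at h
  exact h

theorem tmul_mem_idealC {I : TwoSidedIdeal Q.T} (z : ℂ) {x : Q.T} (hx : x ∈ I) :
    z ⊗ₜ[ℝ] x ∈ idealC I := by
  have h1 : z ⊗ₜ[ℝ] x = z ⊗ₜ[ℝ] (1 : Q.T) * (1 : ℂ) ⊗ₜ[ℝ] x := by
    rw [Algebra.TensorProduct.tmul_mul_tmul, mul_one, one_mul]
  rw [h1]
  exact TwoSidedIdeal.mul_mem_left _ _ _ (TwoSidedIdeal.subset_span ⟨x, hx, rfl⟩)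

/-- Membership in `J` is tested in `T ⊗ ℂ`, so the values of `psiInv` on vertices and arrows suffice
for all computations. -/
theorem mem_idealJ {I : TwoSidedIdeal Q.T} {x : Q.Gam.PathAlg ℂ} :
    x ∈ idealJ I ↔ (Q.psiInv x).1 ∈ idealC I := by
  unfold idealJ
  rw [TwoSidedIdeal.mem_comap, TwoSidedIdeal.mem_comap]
  rfl

theorem psiInv_vertex (w : Q.GV) : (Q.psiInv (FinQuiver.vertex ℂ Q.Gam w)).1 = Q.eps w := by
  unfold psiInv FinQuiver.vertex
  rw [RingQuot.liftAlgHom_mkAlgHom_apply, FreeAlgebra.lift_ι_apply]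
  rfl

theorem psiInv_arrow (p : Q.GE) : (Q.psiInv (FinQuiver.arrow ℂ Q.Gam p)).1 = Q.arrC p := by
  unfold psiInv FinQuiver.arrow
  rw [RingQuot.liftAlgHom_mkAlgHom_apply, FreeAlgebra.lift_ι_apply]
  rfl

theorem psiInv_mul (x y : Q.Gam.PathAlg ℂ) :
    (Q.psiInv (x * y)).1 = (Q.psiInv x).1 * (Q.psiInv y).1 := by
  rw [map_mul]
  rfl

theorem psiInv_add (x y : Q.Gam.PathAlg ℂ) :
    (Q.psiInv (x + y)).1 = (Q.psiInv x).1 + (Q.psiInv y).1 := by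
  rw [map_add]
  rfl

theorem psiInv_smul (c : ℂ) (x : Q.Gam.PathAlg ℂ) :
    (Q.psiInv (c • x)).1 = c • (Q.psiInv x).1 := by
  rw [map_smul, Algebra.smul_def]
  change (c • Q.idem) * (Q.psiInv x).1 = _
  rw [smul_mul_assoc, ((Subsemigroup.mem_corner_iff Q.isIdempotentElem_idem).1 (Q.psiInv x).2).1]

/-- The inverse of `Ψ` as a linear map to `T ⊗ ℂ`. -/
def psiLin : Q.Gam.PathAlg ℂ →ₗ[ℂ] Q.TC where
  toFun x := (Q.psiInv x).1
  map_add' := psiInv_add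
  map_smul' := psiInv_smul

end RealImag

end ModQuiver

/-! ### Matrices of the fibers of an arrow -/

/-- The quaternion by which the idempotent of a fiber of a vertex carrying `D` acts. -/
def epsQuat (D : DivAlg) (b : Bool) : ℍ[ℂ] :=
  if D = .real then 1
  else if b then ⟨1 / 2, Complex.I / 2, 0, 0⟩ else ⟨1 / 2, -(Complex.I / 2), 0, 0⟩

/-- `ModQuiver.gen` in terms of the bimodule. -/
def genQuat (t s : DivAlg) (tw b : Bool) : ℍ[ℝ] :=
  match t, s with
  | .cpx, .cpx => if tw then qj else 1
  | .quat, .real => if b then qj else 1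
  | .quat, .cpx => if b then qj else 1
  | .real, .quat => if b then -qj else 1
  | .cpx, .quat => if b then -qj else 1
  | _, _ => 1

/-- The quaternion by which a fiber of an arrow acts. -/
def fiberQuat (t s : DivAlg) (tw b : Bool) : ℍ[ℂ] :=
  epsQuat t (decide (t = .cpx) && b) * quatC (genQuat t s tw b) *
    epsQuat s (decide (s = .cpx) && (b ^^ (tw && decide (t = .cpx))))

theorem genQuat_mem (t s : DivAlg) (tw b : Bool) : genQuat t s tw b ∈ simpleBimod t s tw := by
  have e1 : qj.re = 0 := rfl
  have e2 : qj.imI = 0 := rfl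
  cases t <;> cases s <;> cases tw <;> cases b <;>
    simp [simpleBimod, genQuat, mem_real_iff, mem_cpx_iff, mem_conj_iff, -Submodule.mem_map, e1, e2]

theorem epsQuat_mul_self (D : DivAlg) (b : Bool) : epsQuat D b * epsQuat D b = epsQuat D b := by
  have hI := Complex.I_mul_I
  cases D
  · exact one_mul _
  all_goals
    cases b <;> apply Quaternion.ext <;>
      simp only [Quaternion.re_mul, Quaternion.imI_mul, Quaternion.imJ_mul, Quaternion.imK_mul,
        epsQuat] <;> simp <;> grind

theorem epsQuat_ne_zero (D : DivAlg) (b : Bool) : epsQuat D b ≠ 0 := by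
  intro h
  have h1 := congrArg QuaternionAlgebra.re h
  cases D <;> cases b <;> simp [epsQuat] at h1

theorem fiberQuat_false_ne_zero {D : DivAlg} (hD : D ≠ .cpx) (tw : Bool) :
    fiberQuat D D tw false ≠ 0 := by
  cases D
  · simp [fiberQuat, genQuat, epsQuat]
  · exact absurd rfl hD
  · simp [fiberQuat, genQuat, epsQuat_mul_self, epsQuat_ne_zero]

/-- The two quaternions are complementary idempotents, possibly times `qj`, or one lies in the span
of `1, qi` and the other in that of `qj, qk`. The proof compares the four coordinates. -/
theorem fiberQuat_linearIndependent {t s : DivAlg} (h : ¬(t = s ∧ s ≠ .cpx)) (tw : Bool) {c d : ℂ}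
    (hcd : c • fiberQuat t s tw false + d • fiberQuat t s tw true = 0) : c = 0 ∧ d = 0 := by
  have h1 : _ = (0 : ℂ) := congrArg QuaternionAlgebra.re hcd
  have h2 : _ = (0 : ℂ) := congrArg QuaternionAlgebra.imI hcd
  have h3 : _ = (0 : ℂ) := congrArg QuaternionAlgebra.imJ hcd
  have h4 : _ = (0 : ℂ) := congrArg QuaternionAlgebra.imK hcd
  have hI := Complex.I_mul_I
  obtain ⟨x1, x2, x3, x4⟩ : (quatC qj).re = 0 ∧ (quatC qj).imI = 0 ∧ (quatC qj).imJ = 1 ∧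
      (quatC qj).imK = 0 := ⟨Complex.ofReal_zero, Complex.ofReal_zero, Complex.ofReal_one,
        Complex.ofReal_zero⟩
  obtain ⟨y1, y2, y3, y4⟩ : (epsQuat .quat false).re = 1 / 2 ∧
      (epsQuat .quat false).imI = -(Complex.I / 2) ∧ (epsQuat .quat false).imJ = 0 ∧
      (epsQuat .quat false).imK = 0 := ⟨rfl, rfl, rfl, rfl⟩
  obtain ⟨z1, z2, z3, z4⟩ : (epsQuat .quat true).re = 1 / 2 ∧
      (epsQuat .quat true).imI = Complex.I / 2 ∧ (epsQuat .quat true).imJ = 0 ∧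
      (epsQuat .quat true).imK = 0 := ⟨rfl, rfl, rfl, rfl⟩
  have e1 (b : Bool) : epsQuat .cpx b = epsQuat .quat b := rfl
  have e2 (b : Bool) : epsQuat .real b = 1 := rfl
  clear hcd
  cases t <;> cases s <;> try (refine absurd ⟨rfl, ?_⟩ h; decide)
  all_goals
    cases tw <;>
    simp [fiberQuat, genQuat, e1, e2, x1, x2, x3, x4, y1, y2, y3, y4, z1, z2, z3, z4,
      -mul_eq_zero] at h1 h2 h3 h4 <;>
    constructor <;> grind

namespace ModQuiver

/-! ### Values of the complexified matrix representation on the vertices and arrows of `Γ`. -/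

section FiberMatrices

variable (Q : ModQuiver)

theorem gen_eq (p : Q.GE) :
    Q.gen p = genQuat (Q.M (Q.t p.1.1)) (Q.M (Q.s p.1.1)) (Q.tw p.1.1) p.1.2 := by
  unfold gen genQuat
  generalize Q.M (Q.t p.1.1) = t, Q.M (Q.s p.1.1) = s
  cases t <;> cases s <;> rfl

theorem gen_mem (p : Q.GE) : Q.gen p ∈ Q.bimod p.1.1 := by
  rw [gen_eq]
  exact genQuat_mem _ _ _ _

theorem modelC_eps (κ : Q.E → ℝ) (w : Q.GV) :
    Q.modelC κ (Q.eps w) = Matrix.single w.1.1 w.1.1 (epsQuat (Q.M w.1.1) w.1.2) := by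
  have h1 : quatC 1 = 1 := map_one quatC
  have hq : quatC qi = ⟨0, 1, 0, 0⟩ := by
    apply Quaternion.ext
    · exact Complex.ofReal_zero
    · exact Complex.ofReal_one
    · exact Complex.ofReal_zero
    · exact Complex.ofReal_zero
  have key (z : ℂ) (q r : ℍ[ℂ]) (h : z • (1 + q) = r) (i : Q.V) :
      z • (Matrix.single i i 1 + Matrix.single i i q) = Matrix.single i i r := by
    rw [← Matrix.single_add, Matrix.smul_single, h]
  have hc (z w : ℂ) : z • ((1 : ℍ[ℂ]) + w • ⟨0, 1, 0, 0⟩) = ⟨z, z * w, 0, 0⟩ := by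
    apply Quaternion.ext
    · change z * (1 + w * 0) = z; ring
    · change z * (0 + w * 1) = z * w; ring
    · change z * (0 + w * 0) = 0; ring
    · change z * (0 + w * 0) = 0; ring
  unfold eps epsQuat
  split_ifs with h hb
  · rw [modelC_tmul_vertEl Q κ _ (one_mem _), one_smul, h1]
  · rw [map_smul, map_add, modelC_tmul_vertEl Q κ _ (one_mem _),
      modelC_tmul_vertEl Q κ _ (Q.qi_mem h), one_smul, h1, hq]
    refine key _ _ _ ?_ _
    exact (hc _ _).trans ((by rw [one_div_mul_eq_div] : (⟨1 / 2, 1 / 2 * Complex.I, 0, 0⟩ : ℍ[ℂ]) =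
      ⟨1 / 2, Complex.I / 2, 0, 0⟩).trans (if_pos hb).symm)
  · rw [sub_eq_add_neg, ← TensorProduct.neg_tmul, map_smul, map_add,
      modelC_tmul_vertEl Q κ _ (one_mem _), modelC_tmul_vertEl Q κ _ (Q.qi_mem h), one_smul, h1, hq]
    refine key _ _ _ ?_ _
    exact (hc _ _).trans ((by rw [one_div_mul_eq_div, neg_div] :
      (⟨1 / 2, 1 / 2 * -Complex.I, 0, 0⟩ : ℍ[ℂ]) = ⟨1 / 2, -(Complex.I / 2), 0, 0⟩).trans
        (if_neg hb).symm)

theorem modelC_arrC (κ : Q.E → ℝ) (p : Q.GE) :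
    Q.modelC κ (Q.arrC p) = Matrix.single (Q.t p.1.1) (Q.s p.1.1)
      ((κ p.1.1 : ℂ) • fiberQuat (Q.M (Q.t p.1.1)) (Q.M (Q.s p.1.1)) (Q.tw p.1.1) p.1.2) := by
  unfold arrC
  rw [map_mul, map_mul, modelC_eps, modelC_eps, modelC_tmul_arrEl Q κ _ (Q.gen_mem p), mul_one,
    gen_eq]
  change Matrix.single (Q.t p.1.1) (Q.t p.1.1) _ * _ * Matrix.single (Q.s p.1.1) (Q.s p.1.1) _ = _
  rw [Matrix.single_mul_single_same, Matrix.single_mul_single_same]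
  have key (z : ℂ) (x y w : ℍ[ℂ]) : x * z • y * w = z • (x * y * w) := by
    apply Quaternion.ext <;> simp <;> ring
  exact congrArg _ (key _ _ _ _)

end FiberMatrices

/-! ### Admissible ideals give graded presentations. -/

section Graded

variable {Q : ModQuiver}

/-- Apply the vanishing to the real and imaginary parts of `z`. -/
theorem modelC_apply_eq_zero {I : TwoSidedIdeal Q.T} {κ : Q.E → ℝ} {i j : Q.V}
    (h : ∀ x ∈ I, Q.model κ x i j = 0) {z : Q.TC} (hz : z ∈ idealC I) : Q.modelC κ z i j = 0 := by
  have h1 := reC_mem_of_mem_idealC hz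
  rw [← reC_add_imC z, map_add, modelC_tmul, modelC_tmul]
  change (1 : ℂ) • quatC (Q.model κ (reC z) i j) + Complex.I • quatC (Q.model κ (imC z) i j) = 0
  rw [h _ h1.1, h _ h1.2, map_zero]
  exact (congrArg₂ (· + ·) (smul_zero (1 : ℂ)) (smul_zero Complex.I)).trans (add_zero (0 : ℍ[ℂ]))


/-- Matrix representations in which products of arrows act by zero kill the square of the arrow
ideal, hence `I`, but still distinguish vertices and fibers of arrows. -/
theorem isGradedPresentation_idealJ {ρ : Q.V → ℕ} (hρ : Q.IsLevel ρ) {I : TwoSidedIdeal Q.T}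
    (hI : I ≤ Q.arrowIdealSq) : FinQuiver.IsGradedPresentation (idealJ I) where
  level := ⟨_, hρ.gam⟩
  vertex_notMem := fun (w : Q.GV) hw => by
    rw [mem_idealJ] at hw
    replace hw : Q.eps w ∈ idealC I := psiInv_vertex w ▸ hw
    -- With `κ = 0` all arrows act by zero, while the idempotent of a vertex acts by a nonzero
    -- quaternion.
    have h := modelC_apply_eq_zero (i := w.1.1) (j := w.1.1)
      (fun x hx => congrFun₂ (Q.model_eq_zero_of_mem (κ := 0) (by simp) (hI hx)) _ _) hw
    rw [modelC_eps, Matrix.single_apply_same] at h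
    exact epsQuat_ne_zero _ _ h
  arrows := by
    classical
    -- Consecutive arrows are different, so letting a single arrow `a` act kills every product of
    -- two arrows. The relation between all arrows then reduces to one between the fibers of `a`.
    have hcomp (a b : Q.E) (h : Q.s a = Q.t b) : a ≠ b := by
      rintro rfl
      have := hρ a
      rw [h] at this
      omega
    refine Fintype.linearIndependent_iff.2 fun (c : Q.GE → ℂ) hc (p : Q.GE) => ?_
    have hJ : ∑ p, c p • FinQuiver.arrow ℂ Q.Gam p ∈ idealJ I := by
      rw [← quotMk_eq_zero (k := ℂ), map_sum, ← hc]
      refine Finset.sum_congr rfl fun p _ => ?_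
      rw [map_smul]
      rfl
    rw [mem_idealJ] at hJ
    change psiLin (∑ p, c p • FinQuiver.arrow ℂ Q.Gam p) ∈ idealC I at hJ
    have hsum : psiLin (∑ p, c p • FinQuiver.arrow ℂ Q.Gam p) = ∑ p : Q.GE, c p • Q.arrC p := by
      rw [map_sum]
      refine Finset.sum_congr rfl fun p _ => ?_
      rw [map_smul]
      exact congrArg _ (psiInv_arrow p)
    rw [hsum] at hJ
    obtain ⟨⟨a, b⟩, hb⟩ := p
    have h := modelC_apply_eq_zero (κ := Pi.single a 1) (i := Q.t a) (j := Q.s a)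
      (fun x hx => congrFun₂ (Q.model_eq_zero_of_mem (fun a' b' h' => by
        rcases eq_or_ne a' a with rfl | ha
        · rw [Pi.single_eq_of_ne (hcomp _ _ h').symm, mul_zero]
        · rw [Pi.single_eq_of_ne ha, zero_mul]) (hI hx)) _ _) hJ
    rw [map_sum, Matrix.sum_apply] at h
    have hne : ∀ p : Q.GE, p.1.1 ≠ a →
        Q.modelC (Pi.single a 1) (c p • Q.arrC p) (Q.t a) (Q.s a) = 0 := fun p hp => by
      rw [map_smul, modelC_arrC, Pi.single_eq_of_ne hp, Complex.ofReal_zero]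
      have h0 := zero_smul ℂ
        (fiberQuat (Q.M (Q.t p.1.1)) (Q.M (Q.s p.1.1)) (Q.tw p.1.1) p.1.2)
      rw [h0, Matrix.single_zero]
      exact smul_zero (A := ℍ[ℂ]) (c p)
    have heq : ∀ (b : Bool) (hb), Q.modelC (Pi.single a 1) (c ⟨(a, b), hb⟩ • Q.arrC ⟨(a, b), hb⟩)
        (Q.t a) (Q.s a) = c ⟨(a, b), hb⟩ • fiberQuat (Q.M (Q.t a)) (Q.M (Q.s a)) (Q.tw a) b := by
      intro b hb
      rw [map_smul, modelC_arrC]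
      simp only [Pi.single_eq_same, Complex.ofReal_one, one_smul]
      rw [Matrix.smul_apply, Matrix.single_apply_same]
    by_cases hM : Q.M (Q.t a) = Q.M (Q.s a) ∧ Q.M (Q.s a) ≠ .cpx
    · have hbf : b = false := by
        cases b
        · rfl
        · exact absurd hM (hb rfl)
      subst hbf
      rw [Finset.sum_eq_single (⟨(a, false), hb⟩ : Q.GE)
        (fun p _ hp => hne p fun h => hp (by
          obtain ⟨⟨a', b'⟩, hb'⟩ := p
          obtain rfl : a' = a := h
          cases b'
          · rfl
          · exact absurd hM (hb' rfl))) (by simp), heq, hM.1] at h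
      exact (smul_eq_zero.1 h).resolve_right (fiberQuat_false_ne_zero hM.2 _)
    · rw [Fintype.sum_eq_add (⟨(a, false), by simp⟩ : Q.GE) (⟨(a, true), fun _ => hM⟩ : Q.GE)
        (by simp) (fun p hp => hne p fun h => by
          obtain ⟨⟨a', b'⟩, hb'⟩ := p
          obtain rfl : a' = a := h
          cases b'
          · exact hp.1 rfl
          · exact hp.2 rfl), heq, heq] at h
      obtain ⟨h1, h2⟩ := fiberQuat_linearIndependent hM _ h
      cases b
      · exact h1
      · exact h2

end Graded

end ModQuiver

/-! ### Simplicity of the bimodules -/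

theorem DivAlg.inv_mem (D : DivAlg) {x : ℍ[ℝ]} (hx : x ∈ D.toSub) : x⁻¹ ∈ D.toSub := by
  have h : x⁻¹ = (Quaternion.normSq x)⁻¹ • star x := rfl
  rw [h]
  refine D.toSub.smul_mem ?_ _
  cases D
  · rw [mem_real_iff] at hx ⊢
    simpa using hx
  · rw [mem_cpx_iff] at hx ⊢
    simpa using hx
  · trivial

/-- In each untwisted case one of the two division algebras already acts transitively on the nonzero
elements, either through `y m⁻¹` from the left or through `m⁻¹ y` from the right. This is the
simplicity of the bimodule. -/
theorem exists_eq_mul_mul (t s : DivAlg) {tw : Bool} (htw : tw = false) {m y : ℍ[ℝ]} (hm : m ≠ 0)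
    (hm' : m ∈ simpleBimod t s tw) (hy : y ∈ simpleBimod t s tw) :
    ∃ d ∈ t.toSub, ∃ d' ∈ s.toSub, y = d * m * d' := by
  subst htw
  have hl : y = y * m⁻¹ * m * 1 := by rw [mul_one, mul_assoc, inv_mul_cancel₀ hm, mul_one]
  have hr : y = 1 * m * (m⁻¹ * y) := by rw [one_mul, ← mul_assoc, mul_inv_cancel₀ hm, one_mul]
  have hL (h : y * m⁻¹ ∈ t.toSub) : ∃ d ∈ t.toSub, ∃ d' ∈ s.toSub, y = d * m * d' :=
    ⟨_, h, 1, one_mem _, hl⟩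
  have hR (h : m⁻¹ * y ∈ s.toSub) : ∃ d ∈ t.toSub, ∃ d' ∈ s.toSub, y = d * m * d' :=
    ⟨1, one_mem _, _, h, hr⟩
  cases t <;> cases s
  · exact hL (mul_mem hy (DivAlg.inv_mem .real hm'))
  · exact hR (mul_mem (DivAlg.inv_mem .cpx hm') hy)
  · exact hR trivial
  · exact hL (mul_mem hy (DivAlg.inv_mem .cpx hm'))
  · exact hL (mul_mem hy (DivAlg.inv_mem .cpx hm'))
  · exact hR trivial
  · exact hL trivial
  · exact hL trivial
  · exact hL trivial

theorem simpleBimod_self {D : DivAlg} (hD : D ≠ .cpx) (tw : Bool) :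
    simpleBimod D D tw = Subalgebra.toSubmodule D.toSub := by
  cases D
  · rfl
  · exact absurd rfl hD
  · exact Algebra.top_toSubmodule.symm

theorem fiberQuat_self {D : DivAlg} (hD : D ≠ .cpx) (tw : Bool) :
    fiberQuat D D tw false = epsQuat D false := by
  cases D
  · simp [fiberQuat, genQuat, epsQuat]
  · exact absurd rfl hD
  · simp [fiberQuat, genQuat, epsQuat_mul_self]

/-- An arrow between equal algebras `ℝ` or `ℍ` acts as the idempotent of its end point, so composing
with it does not change the other factor. -/
theorem fiberQuat_mul_self {t s : DivAlg} (hs : s ≠ .cpx) (tw tw' b : Bool) :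
    fiberQuat t s tw b * fiberQuat s s tw' false = fiberQuat t s tw b := by
  rw [fiberQuat_self hs]
  unfold fiberQuat
  rw [decide_eq_false hs, Bool.false_and, mul_assoc, epsQuat_mul_self]

theorem self_mul_fiberQuat {t s : DivAlg} (ht : t ≠ .cpx) (tw tw' b : Bool) :
    fiberQuat t t tw' false * fiberQuat t s tw b = fiberQuat t s tw b := by
  rw [fiberQuat_self ht]
  unfold fiberQuat
  rw [decide_eq_false ht, Bool.false_and, mul_assoc, ← mul_assoc (epsQuat t false),
    epsQuat_mul_self]

namespace ModQuiver

/-! ### Products of arrow bimodules in `I` give products of fibers in `J`. -/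

section ComplexifiedProducts

variable {Q : ModQuiver}

theorem eps_mem_span (w : Q.GV) :
    Q.eps w ∈ Submodule.span ℂ (Set.range fun d => (1 : ℂ) ⊗ₜ[ℝ] Q.vert w.1.1 d) := by
  have key (z : ℂ) (x : ℍ[ℝ]) (hx : x ∈ (Q.M w.1.1).toSub) : z ⊗ₜ[ℝ] Q.vertEl w.1.1 x ∈
      Submodule.span ℂ (Set.range fun d => (1 : ℂ) ⊗ₜ[ℝ] Q.vert w.1.1 d) := by
    have h : z ⊗ₜ[ℝ] Q.vertEl w.1.1 x = z • ((1 : ℂ) ⊗ₜ[ℝ] Q.vert w.1.1 ⟨x, hx⟩) := by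
      rw [TensorProduct.smul_tmul', smul_eq_mul, mul_one, vertEl_of_mem Q hx]
    rw [h]
    exact Submodule.smul_mem _ _ (Submodule.subset_span ⟨_, rfl⟩)
  unfold eps
  split_ifs with h hb
  · exact key _ _ (one_mem _)
  · exact Submodule.smul_mem _ _ (Submodule.add_mem _ (key _ _ (one_mem _)) (key _ _ (Q.qi_mem h)))
  · exact Submodule.smul_mem _ _ (Submodule.sub_mem _ (key _ _ (one_mem _)) (key _ _ (Q.qi_mem h)))

/-- A fiber is obtained from `M a` by multiplying with elements of the complexified vertex algebras,
and `M a` is stable under the two vertex algebras. -/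
theorem arrC_mem_span (p : Q.GE) :
    Q.arrC p ∈ Submodule.span ℂ (Set.range fun m => (1 : ℂ) ⊗ₜ[ℝ] Q.arr p.1.1 m) := by
  have h := Submodule.mul_mem_mul (Submodule.mul_mem_mul (eps_mem_span (Q.gt p))
    (Submodule.subset_span (R := ℂ)
      ⟨⟨Q.gen p, Q.gen_mem p⟩, rfl⟩ : (1 : ℂ) ⊗ₜ[ℝ] Q.arr p.1.1 ⟨Q.gen p, Q.gen_mem p⟩ ∈
        Submodule.span ℂ (Set.range fun m => (1 : ℂ) ⊗ₜ[ℝ] Q.arr p.1.1 m)))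
    (eps_mem_span (Q.gs p))
  rw [Submodule.span_mul_span, Submodule.span_mul_span] at h
  unfold arrC
  rw [arrEl_of_mem Q (Q.gen_mem p)]
  refine Submodule.span_mono ?_ h
  rintro _ ⟨_, ⟨_, ⟨d, rfl⟩, _, ⟨m, rfl⟩, rfl⟩, _, ⟨d', rfl⟩, rfl⟩
  simp only [Algebra.TensorProduct.tmul_mul_tmul, mul_one]
  change _ ∈ Set.range _
  exact ⟨_, (congrArg ((1 : ℂ) ⊗ₜ[ℝ] ·) ((congrArg (· * Q.vert _ d')
    (vert_mul_arr Q p.1.1 d m)).trans (arr_mul_vert Q p.1.1 _ d'))).symm⟩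

theorem span_le_idealC {I : TwoSidedIdeal Q.T} {S : Set Q.TC} (hS : ∀ z ∈ S, z ∈ idealC I)
    {z : Q.TC} (hz : z ∈ Submodule.span ℂ S) : z ∈ idealC I := by
  induction hz using Submodule.span_induction with
  | mem x hx => exact hS x hx
  | zero => exact (idealC I).zero_mem
  | add x y _ _ hx hy => exact (idealC I).add_mem hx hy
  | smul c x _ hx =>
    have h : c • x = algebraMap ℂ Q.TC c * x := Algebra.smul_def c x
    rw [h]
    exact (idealC I).mul_mem_left _ _ hx

theorem arrow_mul_arrow_mem {I : TwoSidedIdeal Q.T} (p q : Q.GE)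
    (h : ∀ m n, Q.arr p.1.1 m * Q.arr q.1.1 n ∈ I) :
    FinQuiver.arrow ℂ Q.Gam p * FinQuiver.arrow ℂ Q.Gam q ∈ idealJ I := by
  rw [mem_idealJ]
  have h' := Submodule.mul_mem_mul (arrC_mem_span p) (arrC_mem_span q)
  rw [Submodule.span_mul_span] at h'
  have e : (Q.psiInv (FinQuiver.arrow ℂ Q.Gam p * FinQuiver.arrow ℂ Q.Gam q)).1 =
      Q.arrC p * Q.arrC q := by
    rw [← psiInv_arrow, ← psiInv_arrow]
    exact psiInv_mul _ _
  refine Eq.mpr (congrArg (· ∈ idealC I) e) (span_le_idealC ?_ h')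
  rintro _ ⟨_, ⟨m, rfl⟩, _, ⟨n, rfl⟩, rfl⟩
  simp only [Algebra.TensorProduct.tmul_mul_tmul]
  exact tmul_mem_idealC _ (h m n)

theorem arrow_mul_arrow_mul_arrow_mem {I : TwoSidedIdeal Q.T} (p q r : Q.GE)
    (h : ∀ l m n, Q.arr p.1.1 l * Q.arr q.1.1 m * Q.arr r.1.1 n ∈ I) :
    FinQuiver.arrow ℂ Q.Gam p * FinQuiver.arrow ℂ Q.Gam q * FinQuiver.arrow ℂ Q.Gam r ∈
      idealJ I := by
  rw [mem_idealJ]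
  have h' := Submodule.mul_mem_mul
    (Submodule.mul_mem_mul (arrC_mem_span p) (arrC_mem_span q)) (arrC_mem_span r)
  rw [Submodule.span_mul_span, Submodule.span_mul_span] at h'
  have e : (Q.psiInv (FinQuiver.arrow ℂ Q.Gam p * FinQuiver.arrow ℂ Q.Gam q *
      FinQuiver.arrow ℂ Q.Gam r)).1 = Q.arrC p * Q.arrC q * Q.arrC r := by
    rw [← psiInv_arrow, ← psiInv_arrow, ← psiInv_arrow]
    exact (psiInv_mul _ _).trans (congrArg (· * _) (psiInv_mul _ _))
  refine Eq.mpr (congrArg (· ∈ idealC I) e) (span_le_idealC ?_ h')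
  rintro _ ⟨_, ⟨_, ⟨l, rfl⟩, _, ⟨m, rfl⟩, rfl⟩, _, ⟨n, rfl⟩, rfl⟩
  simp only [Algebra.TensorProduct.tmul_mul_tmul]
  exact tmul_mem_idealC _ (h l m n)

end ComplexifiedProducts

end ModQuiver

theorem FinQuiver.mul_eq_zero_of_mem_span {k : Type} [Field k] {Γ : FinQuiver}
    {J : TwoSidedIdeal (Γ.PathAlg k)} {A B : Set Γ.E}
    (h : ∀ a ∈ A, ∀ b ∈ B, arrow k Γ a * arrow k Γ b ∈ J) {x y : J.ringCon.Quotient}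
    (hx : x ∈ Submodule.span k (qa J '' A)) (hy : y ∈ Submodule.span k (qa J '' B)) :
    x * y = 0 := by
  have hxy := Submodule.mul_mem_mul hx hy
  rw [Submodule.span_mul_span] at hxy
  refine (Submodule.mem_bot k).1 (Submodule.span_le.2 ?_ hxy)
  rintro _ ⟨_, ⟨a, ha, rfl⟩, _, ⟨b, hb, rfl⟩, rfl⟩
  exact (qa_mul_eq_zero J).2 (h a ha b hb)

namespace ModQuiver

/-! ### Two arrows, one of them between equal division algebras -/

section TwoArrows

variable {Q : ModQuiver} {I : TwoSidedIdeal Q.T} {a b : Q.E}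

/-- The fiber `a` of the arrow `a`. -/
def fiberFalse (a : Q.E) : Q.Gam.E := (⟨(a, false), fun h => Bool.noConfusion h⟩ : Q.GE)

/-- The fiber `ā` of an arrow `a` between different division algebras. -/
def fiberTrue (a : Q.E) (ha : Q.M (Q.t a) ≠ Q.M (Q.s a)) : Q.Gam.E :=
  (⟨(a, true), fun _ h => ha h.1⟩ : Q.GE)

/-- The fibers of an arrow. -/
def fiberSet (a : Q.E) : Set Q.Gam.E := {p : Q.GE | p.1.1 = a}

theorem exists_of_mem_span_fiber (ha : Q.M (Q.t a) = Q.M (Q.s a) ∧ Q.M (Q.s a) ≠ .cpx)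
    {x : (idealJ I).ringCon.Quotient}
    (hx : x ∈ Submodule.span ℂ (FinQuiver.qa (idealJ I) '' fiberSet a)) :
    ∃ c : ℂ, x = c • FinQuiver.qa (idealJ I) (fiberFalse a) := by
  have hS : fiberSet a = {fiberFalse a} := by
    ext ⟨⟨a', b'⟩, hb'⟩
    constructor
    · rintro rfl
      cases b'
      · rfl
      · exact absurd ha (hb' rfl)
    · rintro h
      exact congrArg (fun p : Q.GE => p.1.1) h
  rw [hS, Set.image_singleton] at hx
  obtain ⟨c, hc⟩ := Submodule.mem_span_singleton.1 hx
  exact ⟨c, hc.symm⟩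

theorem exists_of_mem_span_fibers (ha : Q.M (Q.t a) ≠ Q.M (Q.s a))
    {x : (idealJ I).ringCon.Quotient}
    (hx : x ∈ Submodule.span ℂ (FinQuiver.qa (idealJ I) '' fiberSet a)) :
    ∃ c d : ℂ, x = c • FinQuiver.qa (idealJ I) (fiberFalse a) +
      d • FinQuiver.qa (idealJ I) (fiberTrue a ha) := by
  have hS : fiberSet a = {fiberFalse a, fiberTrue a ha} := by
    ext ⟨⟨a', b'⟩, hb'⟩
    constructor
    · rintro rfl
      cases b'
      · exact Or.inl rfl
      · exact Or.inr rfl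
    · rintro (h | h)
      · exact congrArg (fun p : Q.GE => p.1.1) h
      · exact congrArg (fun p : Q.GE => p.1.1) h
  rw [hS, Set.image_pair] at hx
  obtain ⟨c, d, h⟩ := Submodule.mem_span_pair.1 hx
  exact ⟨c, d, h.symm⟩

theorem modelC_add_arrC (κ : Q.E → ℝ) (a : Q.E) (c d : ℂ) (p q : Q.GE) (hp : p.1.1 = a)
    (hq : q.1.1 = a) :
    Q.modelC κ (c • Q.arrC p + d • Q.arrC q) = Matrix.single (Q.t a) (Q.s a)
      ((κ a : ℂ) • (c • fiberQuat (Q.M (Q.t a)) (Q.M (Q.s a)) (Q.tw a) p.1.2 +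
        d • fiberQuat (Q.M (Q.t a)) (Q.M (Q.s a)) (Q.tw a) q.1.2)) := by
  obtain ⟨⟨p, x⟩, hx⟩ := p
  obtain ⟨⟨q, y⟩, hy⟩ := q
  obtain rfl : p = a := hp
  obtain rfl : q = p := hq
  rw [map_add, map_smul, map_smul, modelC_arrC, modelC_arrC, Matrix.smul_single, Matrix.smul_single]
  have key (k : ℂ) (x y : ℍ[ℂ]) : c • k • x + d • k • y = k • (c • x + d • y) := by
    apply Quaternion.ext <;> simp <;> ring
  exact (Matrix.single_add _ _ _ _).symm.trans (congrArg _ (key _ _ _))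

theorem psiLin_arrow (p : Q.GE) : psiLin (FinQuiver.arrow ℂ Q.Gam p) = Q.arrC p := psiInv_arrow p

/-- Products of fibers of two arrows vanish in `ℂΓ/J` only if they vanish in the model. -/
theorem modelC_mul_eq_zero (hab : Q.s a = Q.t b)
    (hI : ∀ x ∈ I, Q.model 1 x (Q.t a) (Q.s b) = 0) (p p' q q' : Q.GE) (hp : p.1.1 = a)
    (hp' : p'.1.1 = a) (hq : q.1.1 = b) (hq' : q'.1.1 = b) (c c' d d' : ℂ)
    (h : (c • FinQuiver.qa (idealJ I) p + c' • FinQuiver.qa (idealJ I) p') *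
      (d • FinQuiver.qa (idealJ I) q + d' • FinQuiver.qa (idealJ I) q') = 0) :
    (c • fiberQuat (Q.M (Q.t a)) (Q.M (Q.s a)) (Q.tw a) p.1.2 +
        c' • fiberQuat (Q.M (Q.t a)) (Q.M (Q.s a)) (Q.tw a) p'.1.2) *
      (d • fiberQuat (Q.M (Q.t b)) (Q.M (Q.s b)) (Q.tw b) q.1.2 +
        d' • fiberQuat (Q.M (Q.t b)) (Q.M (Q.s b)) (Q.tw b) q'.1.2) = 0 := by
  have h1 : quotMk ℂ (idealJ I) ((c • FinQuiver.arrow ℂ Q.Gam p + c' • FinQuiver.arrow ℂ Q.Gam p') *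
      (d • FinQuiver.arrow ℂ Q.Gam q + d' • FinQuiver.arrow ℂ Q.Gam q')) = 0 := by
    rw [map_mul, map_add, map_add, map_smul, map_smul, map_smul, map_smul]
    exact h
  rw [quotMk_eq_zero, mem_idealJ] at h1
  have e : (Q.psiInv ((c • FinQuiver.arrow ℂ Q.Gam p + c' • FinQuiver.arrow ℂ Q.Gam p') *
      (d • FinQuiver.arrow ℂ Q.Gam q + d' • FinQuiver.arrow ℂ Q.Gam q'))).1 =
      (c • Q.arrC p + c' • Q.arrC p') * (d • Q.arrC q + d' • Q.arrC q') := by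
    rw [← psiLin_arrow, ← psiLin_arrow, ← psiLin_arrow, ← psiLin_arrow, ← map_smul, ← map_smul,
      ← map_smul, ← map_smul, ← map_add, ← map_add]
    exact psiInv_mul _ _
  replace h1 : (c • Q.arrC p + c' • Q.arrC p') * (d • Q.arrC q + d' • Q.arrC q') ∈ idealC I :=
    e ▸ h1
  have h2 := modelC_apply_eq_zero hI h1
  rw [map_mul, modelC_add_arrC 1 a c c' p p' hp hp', modelC_add_arrC 1 b d d' q q' hq hq', hab,
    Matrix.single_mul_single_same, Matrix.single_apply_same, Pi.one_apply, Pi.one_apply,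
    Complex.ofReal_one] at h2
  have h3 (x : ℍ[ℂ]) : (1 : ℂ) • x = x := one_smul ℂ x
  rw [h3, h3] at h2
  rw [hab]
  exact h2

theorem quat_smul_eq_zero {c : ℂ} {x : ℍ[ℂ]} (h : c • x = 0) : c = 0 ∨ x = 0 := by
  rcases eq_or_ne c 0 with hc | hc
  · exact Or.inl hc
  · right
    apply Quaternion.ext
    · exact (mul_eq_zero.1 (congrArg QuaternionAlgebra.re h : c * x.re = 0)).resolve_left hc
    · exact (mul_eq_zero.1 (congrArg QuaternionAlgebra.imI h : c * x.imI = 0)).resolve_left hc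
    · exact (mul_eq_zero.1 (congrArg QuaternionAlgebra.imJ h : c * x.imJ = 0)).resolve_left hc
    · exact (mul_eq_zero.1 (congrArg QuaternionAlgebra.imK h : c * x.imK = 0)).resolve_left hc

theorem quat_smul_mul_smul (c c' d : ℂ) (x x' y : ℍ[ℂ]) :
    (c • x + c' • x') * (d • y + (0 : ℂ) • y) = d • (c • (x * y) + c' • (x' * y)) := by
  apply Quaternion.ext <;> simp <;> ring

theorem quat_smul_mul_smul' (c c' d : ℂ) (x x' y : ℍ[ℂ]) :
    (d • y + (0 : ℂ) • y) * (c • x + c' • x') = d • (c • (y * x) + c' • (y * x')) := by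
  apply Quaternion.ext <;> simp <;> ring

/-- The second factor is a scalar multiple of a fiber that acts as an idempotent, so a vanishing
product is a linear relation between the two fibers of `a`, and these are independent. -/
theorem mul_eq_zero_out (hab : Q.s a = Q.t b) (ha : Q.M (Q.t a) ≠ Q.M (Q.s a))
    (hb : Q.M (Q.t b) = Q.M (Q.s b) ∧ Q.M (Q.s b) ≠ .cpx)
    (hI : ∀ x ∈ I, Q.model 1 x (Q.t a) (Q.s b) = 0) {x y : (idealJ I).ringCon.Quotient}
    (hx : x ∈ Submodule.span ℂ (FinQuiver.qa (idealJ I) '' fiberSet a))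
    (hy : y ∈ Submodule.span ℂ (FinQuiver.qa (idealJ I) '' fiberSet b)) (hxy : x * y = 0) :
    x = 0 ∨ y = 0 := by
  obtain ⟨c, c', rfl⟩ := exists_of_mem_span_fibers ha hx
  obtain ⟨d, rfl⟩ := exists_of_mem_span_fiber hb hy
  have h := modelC_mul_eq_zero hab hI (fiberFalse a) (fiberTrue a ha) (fiberFalse b) (fiberFalse b)
    rfl rfl rfl rfl c c' d 0 (by rw [zero_smul, add_zero]; exact hxy)
  rw [quat_smul_mul_smul] at h
  rcases quat_smul_eq_zero h with rfl | h
  · exact Or.inr (zero_smul _ _)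
  · replace h : c • (fiberQuat (Q.M (Q.t a)) (Q.M (Q.s a)) (Q.tw a) false *
          fiberQuat (Q.M (Q.t b)) (Q.M (Q.s b)) (Q.tw b) false) +
        c' • (fiberQuat (Q.M (Q.t a)) (Q.M (Q.s a)) (Q.tw a) true *
          fiberQuat (Q.M (Q.t b)) (Q.M (Q.s b)) (Q.tw b) false) = 0 := h
    rw [hab, hb.1, fiberQuat_mul_self hb.2, fiberQuat_mul_self hb.2] at h
    rw [hab, hb.1] at ha
    obtain ⟨rfl, rfl⟩ := fiberQuat_linearIndependent (fun h => ha h.1) _ h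
    rw [zero_smul, zero_smul, add_zero]
    exact Or.inl rfl

theorem mul_eq_zero_in (hab : Q.s a = Q.t b) (ha : Q.M (Q.t a) = Q.M (Q.s a) ∧ Q.M (Q.s a) ≠ .cpx)
    (hb : Q.M (Q.t b) ≠ Q.M (Q.s b))
    (hI : ∀ x ∈ I, Q.model 1 x (Q.t a) (Q.s b) = 0) {x y : (idealJ I).ringCon.Quotient}
    (hx : x ∈ Submodule.span ℂ (FinQuiver.qa (idealJ I) '' fiberSet a))
    (hy : y ∈ Submodule.span ℂ (FinQuiver.qa (idealJ I) '' fiberSet b)) (hxy : x * y = 0) :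
    x = 0 ∨ y = 0 := by
  obtain ⟨c, c', rfl⟩ := exists_of_mem_span_fibers hb hy
  obtain ⟨d, rfl⟩ := exists_of_mem_span_fiber ha hx
  have h := modelC_mul_eq_zero hab hI (fiberFalse a) (fiberFalse a) (fiberFalse b) (fiberTrue b hb)
    rfl rfl rfl rfl d 0 c c' (by rw [zero_smul, add_zero]; exact hxy)
  rw [quat_smul_mul_smul'] at h
  rcases quat_smul_eq_zero h with rfl | h
  · exact Or.inl (zero_smul _ _)
  · replace h : c • (fiberQuat (Q.M (Q.t a)) (Q.M (Q.s a)) (Q.tw a) false *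
          fiberQuat (Q.M (Q.t b)) (Q.M (Q.s b)) (Q.tw b) false) +
        c' • (fiberQuat (Q.M (Q.t a)) (Q.M (Q.s a)) (Q.tw a) false *
          fiberQuat (Q.M (Q.t b)) (Q.M (Q.s b)) (Q.tw b) true) = 0 := h
    rw [ha.1, hab] at h
    rw [hab] at ha
    rw [self_mul_fiberQuat ha.2, self_mul_fiberQuat ha.2] at h
    obtain ⟨rfl, rfl⟩ := fiberQuat_linearIndependent (fun h => hb h.1) _ h
    rw [zero_smul, zero_smul, add_zero]
    exact Or.inr rfl

/-- If `a b` is the only path of its length between its ends, then a nonzero element of an ideal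
in this position exists only if the ideal contains `M (a b)`. -/
theorem mul_mem_or_model_eq_zero_out {ρ : Q.V → ℕ} (hρ : Q.IsLevel ρ) (hab : Q.s a = Q.t b)
    (hau : ∀ a', Q.t a' = Q.t a → a' = a) (hbu : ∀ b', Q.s b' = Q.s b → b' = b)
    (htw : Q.tw a = false) (hb : Q.M (Q.t b) = Q.M (Q.s b) ∧ Q.M (Q.s b) ≠ .cpx) :
    (∀ m n, Q.arr a m * Q.arr b n ∈ I) ∨ ∀ x ∈ I, Q.model 1 x (Q.t a) (Q.s b) = 0 := by
  refine or_iff_not_imp_right.2 fun h => ?_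
  push Not at h
  obtain ⟨x, hx, hne⟩ := h
  have hbm : ∀ d, d ∈ Q.bimod b ↔ d ∈ (Q.M (Q.s b)).toSub := fun d => by
    unfold bimod
    rw [hb.1, simpleBimod_self hb.2]
    rfl
  have hsa : Q.M (Q.s a) = Q.M (Q.s b) := by rw [hab, hb.1]
  -- As `M b` is the regular bimodule, `M a ⊗ M b` is identified with `M a` through `m ↦ m ⊗ 1`. By
  -- uniqueness of the path, the range of `f` is the whole corner.
  let f : Q.bimod a →ₗ[ℝ] Q.T := (LinearMap.mulRight ℝ (Q.arrEl b 1)) ∘ₗ Q.arrHom a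
  have hf (m : Q.bimod a) : f m = Q.arr a m * Q.arrEl b 1 := rfl
  have hmem := hρ.mem_span_tPath (i := Q.s b) (j := Q.t a) (n := 2)
    (by rw [hρ a, hab, hρ b]) x
  have hle : Submodule.span ℝ {y | TPath 2 (Q.s b) (Q.t a) y} ≤ LinearMap.range f := by
    refine Submodule.span_le.2 ?_
    intro y hy
    obtain ⟨a', m, b', n, h1, h2, h3, rfl⟩ := hy.exists_arr_mul
    obtain rfl := hau a' h3
    obtain rfl := hbu b' h1
    have hn : (n : ℍ[ℝ]) ∈ (Q.M (Q.s a')).toSub := by rw [hsa]; exact (hbm _).1 n.2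
    refine ⟨⟨m * n, right_mul_mem _ _ _ hn m.2⟩, ?_⟩
    rw [hf, ← arrEl_coe, ← arrEl_coe, ← arrEl_coe]
    exact (arrEl_mul_arrEl_assoc Q hab m.2 hn ((hbm _).2 (one_mem _))).trans (by rw [mul_one])
  obtain ⟨m, hm⟩ := hle hmem
  have hmI : f m ∈ I := by
    rw [hm]
    exact I.mul_mem_right _ _ (I.mul_mem_left _ _ hx)
  -- The corner of `x` is `f m`, and its value in the model is nonzero by assumption.
  have hm0 : (m : ℍ[ℝ]) ≠ 0 := by
    intro h0
    obtain rfl : m = 0 := Subtype.ext h0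
    rw [map_zero] at hm
    have := congrFun₂ (congrArg (Q.model 1) hm) (Q.t a) (Q.s b)
    rw [map_zero, map_mul, map_mul, model_vert, model_vert, Matrix.mul_single_apply_same,
      Matrix.single_mul_apply_same] at this
    apply hne
    simpa using this.symm
  intro m' n
  have hn : (n : ℍ[ℝ]) ∈ (Q.M (Q.s a)).toSub := by rw [hsa]; exact (hbm _).1 n.2
  have e1 : Q.arr a m' * Q.arr b n = Q.arrEl a (m' * n) * Q.arrEl b 1 := by
    rw [← arrEl_coe, ← arrEl_coe]
    refine Eq.trans ?_ (arrEl_mul_arrEl_assoc Q hab m'.2 hn ((hbm _).2 (one_mem _))).symm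
    rw [mul_one]
  -- Simplicity of `M a`: the given product is `d m d' ⊗ 1`. Here `d'` moves through the tensor sign
  -- to the right end of `b`, which shows the product to be a two-sided multiple of `f m`.
  obtain ⟨d, hd, d', hd', e⟩ := exists_eq_mul_mul _ _ htw hm0 m.2
    (right_mul_mem _ _ _ hn m'.2)
  have hdm : d * m ∈ Q.bimod a := left_mul_mem _ _ _ hd m.2
  have hd'b : d' ∈ (Q.M (Q.s b)).toSub := hsa ▸ hd'
  rw [e1, e, arrEl_mul_arrEl_assoc Q hab hdm hd' ((hbm _).2 (one_mem _)), mul_one,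
    ← vertEl_mul_arrEl Q hd m.2, ← one_mul d',
    ← arrEl_mul_vertEl Q ((hbm _).2 (one_mem _)) hd'b, ← mul_assoc, mul_assoc _ _ (Q.arrEl b 1),
    arrEl_coe, ← hf]
  exact I.mul_mem_right _ _ (I.mul_mem_left _ _ hmI)

/-- The mirror image: now `M a` is regular, and `M a ⊗ M b` is identified with the simple bimodule
`M b`. -/
theorem mul_mem_or_model_eq_zero_in {ρ : Q.V → ℕ} (hρ : Q.IsLevel ρ) (hab : Q.s a = Q.t b)
    (hau : ∀ a', Q.t a' = Q.t a → a' = a) (hbu : ∀ b', Q.s b' = Q.s b → b' = b)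
    (htw : Q.tw b = false) (ha : Q.M (Q.t a) = Q.M (Q.s a) ∧ Q.M (Q.s a) ≠ .cpx) :
    (∀ m n, Q.arr a m * Q.arr b n ∈ I) ∨ ∀ x ∈ I, Q.model 1 x (Q.t a) (Q.s b) = 0 := by
  refine or_iff_not_imp_right.2 fun h => ?_
  push Not at h
  obtain ⟨x, hx, hne⟩ := h
  have ham : ∀ d, d ∈ Q.bimod a ↔ d ∈ (Q.M (Q.s a)).toSub := fun d => by
    unfold bimod
    rw [ha.1, simpleBimod_self ha.2]
    rfl
  have hsa : Q.M (Q.t b) = Q.M (Q.s a) := by rw [hab]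
  let f : Q.bimod b →ₗ[ℝ] Q.T := (LinearMap.mulLeft ℝ (Q.arrEl a 1)) ∘ₗ Q.arrHom b
  have hf (m : Q.bimod b) : f m = Q.arrEl a 1 * Q.arr b m := rfl
  have hmem := hρ.mem_span_tPath (i := Q.s b) (j := Q.t a) (n := 2)
    (by rw [hρ a, hab, hρ b]) x
  have key (m : Q.bimod a) (n : Q.bimod b) : ∃ h : (m * n : ℍ[ℝ]) ∈ Q.bimod b,
      Q.arr a m * Q.arr b n = Q.arrEl a 1 * Q.arr b ⟨m * n, h⟩ := by
    have hm := (ham _).1 m.2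
    refine ⟨left_mul_mem _ _ _ (hsa.symm ▸ hm) n.2, ?_⟩
    rw [← arrEl_coe, ← arrEl_coe, ← arrEl_coe,
      ← arrEl_mul_arrEl_assoc Q hab ((ham _).2 (one_mem _)) hm n.2, one_mul]
  have hle : Submodule.span ℝ {y | TPath 2 (Q.s b) (Q.t a) y} ≤ LinearMap.range f := by
    refine Submodule.span_le.2 ?_
    intro y hy
    obtain ⟨a', m, b', n, h1, h2, h3, rfl⟩ := hy.exists_arr_mul
    obtain rfl := hau a' h3
    obtain rfl := hbu b' h1
    obtain ⟨h, e⟩ := key m n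
    exact ⟨_, e.symm⟩
  obtain ⟨m, hm⟩ := hle hmem
  have hmI : f m ∈ I := by
    rw [hm]
    exact I.mul_mem_right _ _ (I.mul_mem_left _ _ hx)
  have hm0 : (m : ℍ[ℝ]) ≠ 0 := by
    intro h0
    obtain rfl : m = 0 := Subtype.ext h0
    rw [map_zero] at hm
    have := congrFun₂ (congrArg (Q.model 1) hm) (Q.t a) (Q.s b)
    rw [map_zero, map_mul, map_mul, model_vert, model_vert, Matrix.mul_single_apply_same,
      Matrix.single_mul_apply_same] at this
    apply hne
    simpa using this.symm
  intro n m'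
  obtain ⟨h, e1⟩ := key n m'
  obtain ⟨d, hd, d', hd', e⟩ := exists_eq_mul_mul _ _ htw hm0 m.2 h
  have hd1 : d ∈ (Q.M (Q.s a)).toSub := hsa ▸ hd
  have hd2 : d ∈ (Q.M (Q.t a)).toSub := ha.1.symm ▸ hd1
  have e2 : Q.arrEl a 1 * Q.arr b ⟨n * m', h⟩ =
      Q.vertEl (Q.t a) d * (Q.arrEl a 1 * Q.arr b m) * Q.vertEl (Q.s b) d' := by
    rw [← mul_assoc, vertEl_mul_arrEl Q hd2 ((ham _).2 (one_mem _)), mul_one, mul_assoc,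
      ← arrEl_coe Q b m, arrEl_mul_vertEl Q m.2 hd', ← one_mul d,
      arrEl_mul_arrEl_assoc Q hab ((ham _).2 (one_mem _)) hd1 (right_mul_mem _ _ _ hd' m.2),
      ← arrEl_coe, ← mul_assoc d, ← e]
  rw [e1, e2, ← hf]
  exact I.mul_mem_right _ _ (I.mul_mem_left _ _ hmI)

theorem IsLevel.mem_span_fiberSet {ρ : Q.V → ℕ} (hρ : Q.IsLevel ρ) {w w' : Q.Gam.V}
    (hw : ρ w'.1.1 = ρ w.1.1 + 1) (ha : ∀ a', Q.s a' = w.1.1 → Q.t a' = w'.1.1 → a' = a)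
    {x : (idealJ I).ringCon.Quotient}
    (hx : x ∈ peirceCorner ℂ (FinQuiver.qv (idealJ I) w') (FinQuiver.qv (idealJ I) w)) :
    x ∈ Submodule.span ℂ (FinQuiver.qa (idealJ I) '' fiberSet a) := by
  refine Submodule.span_mono (Set.image_mono ?_) (hρ.gam.mem_span_arrows (idealJ I) hw hx)
  rintro p ⟨h1, h2⟩
  exact ha _ (congrArg (fun w : Q.GV => w.1.1) h1) (congrArg (fun w : Q.GV => w.1.1) h2)

theorem arrow_mul_arrow_mem_of_fiberSet (h : ∀ m n, Q.arr a m * Q.arr b n ∈ I) :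
    ∀ p ∈ fiberSet a, ∀ q ∈ fiberSet b,
      FinQuiver.arrow ℂ Q.Gam p * FinQuiver.arrow ℂ Q.Gam q ∈ idealJ I := by
  rintro ⟨⟨p, _⟩, _⟩ rfl ⟨⟨q, _⟩, _⟩ rfl
  exact arrow_mul_arrow_mem _ _ h

/-- A vertex not carrying `ℂ` has only one fiber, so fibers of consecutive arrows through it are
composable. -/
theorem gs_fiber_eq_gt_fiber {p q : Q.Gam.E} (h : Q.s p.1.1 = Q.t q.1.1)
    (hM : Q.M (Q.s p.1.1) ≠ .cpx) : Q.Gam.s p = Q.Gam.t q := by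
  refine Subtype.ext (Prod.ext h ?_)
  change (decide _ && _) = (decide _ && _)
  rw [← h, decide_eq_false hM, Bool.false_and, Bool.false_and]

/-- The two fibers of `a` follow the single fiber of `b`. The dichotomy for `M (a b)` gives exactly
the two alternatives that no gentle vertex allows. -/
theorem not_isLocallyGentle_path_out {ρ : Q.V → ℕ} (hρ : Q.IsLevel ρ) (hI : I ≤ Q.arrowIdealSq)
    (hab : Q.s a = Q.t b) (hE : ∀ c, c = a ∨ c = b) (htw : Q.tw a = false)
    (ha : Q.M (Q.t a) ≠ Q.M (Q.s a)) (hb : Q.M (Q.t b) = Q.M (Q.s b) ∧ Q.M (Q.s b) ≠ .cpx) :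
    ¬ IsLocallyGentle ℂ (Complexification I) := by
  have hρa := hρ a
  have hρb := hρ b
  rw [hab] at hρa
  have hsb (c : Q.E) (h : Q.s c = Q.s b) : c = b := (hE c).resolve_left fun hc => by
    rw [hc, hab] at h
    rw [h] at hρb
    omega
  have hta (c : Q.E) (h : Q.t c = Q.t a) : c = a := (hE c).resolve_right fun hc => by
    rw [hc] at h
    rw [h] at hρa
    omega
  have hsM : Q.M (Q.s a) ≠ .cpx := by rw [hab, hb.1]; exact hb.2
  refine (isGradedPresentation_idealJ hρ hI).not_isLocallyGentle_out (c := fiberFalse b)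
    (b := fiberFalse a) (b' := fiberTrue a ha)
    (fun h => Bool.noConfusion (congrArg (fun p : Q.GE => p.1.2) h))
    (gs_fiber_eq_gt_fiber hab hsM) (gs_fiber_eq_gt_fiber hab hsM) ?_
  have hd (d : Q.Gam.E) (h : Q.Gam.s d = Q.Gam.t (fiberFalse b)) : d.1.1 = a := by
    refine (hE d.1.1).resolve_right fun hdb => ?_
    have h1 : Q.s d.1.1 = Q.t b := congrArg (fun w : Q.GV => w.1.1) h
    rw [hdb] at h1
    rw [h1] at hρb
    omega
  have hx (d : Q.Gam.E) (h : Q.Gam.s d = Q.Gam.t (fiberFalse b)) {x : (idealJ I).ringCon.Quotient}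
      (hx : x ∈ peirceCorner ℂ (FinQuiver.qv (idealJ I) (Q.Gam.t d))
        (FinQuiver.qv (idealJ I) (Q.Gam.t (fiberFalse b)))) :
      x ∈ Submodule.span ℂ (FinQuiver.qa (idealJ I) '' fiberSet a) := by
    refine hρ.mem_span_fiberSet ?_ ?_ hx
    · rw [← h]
      exact hρ d.1.1
    · intro a' _ h2
      refine hta a' (h2.trans ?_)
      exact congrArg Q.t (hd d h)
  have hy {y : (idealJ I).ringCon.Quotient}
      (hy : y ∈ peirceCorner ℂ (FinQuiver.qv (idealJ I) (Q.Gam.t (fiberFalse b)))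
        (FinQuiver.qv (idealJ I) (Q.Gam.s (fiberFalse b)))) :
      y ∈ Submodule.span ℂ (FinQuiver.qa (idealJ I) '' fiberSet b) :=
    hρ.mem_span_fiberSet (hρ b) (fun a' h1 _ => hsb a' h1) hy
  rcases mul_mem_or_model_eq_zero_out (I := I) hρ hab hta hsb htw hb with h | h
  · refine Or.inl fun d hd x hx' y hy' =>
      FinQuiver.mul_eq_zero_of_mem_span ?_ (hx d hd hx') (hy hy')
    exact arrow_mul_arrow_mem_of_fiberSet h
  · exact Or.inr fun d hd x hx' y hy' hxy => mul_eq_zero_out hab ha hb h (hx d hd hx') (hy hy') hxy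

theorem not_isLocallyGentle_path_in {ρ : Q.V → ℕ} (hρ : Q.IsLevel ρ) (hI : I ≤ Q.arrowIdealSq)
    (hab : Q.s a = Q.t b) (hE : ∀ c, c = a ∨ c = b) (htw : Q.tw b = false)
    (ha : Q.M (Q.t a) = Q.M (Q.s a) ∧ Q.M (Q.s a) ≠ .cpx) (hb : Q.M (Q.t b) ≠ Q.M (Q.s b)) :
    ¬ IsLocallyGentle ℂ (Complexification I) := by
  have hρa := hρ a
  have hρb := hρ b
  rw [hab] at hρa
  have hsb (c : Q.E) (h : Q.s c = Q.s b) : c = b := (hE c).resolve_left fun hc => by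
    rw [hc, hab] at h
    rw [h] at hρb
    omega
  have hta (c : Q.E) (h : Q.t c = Q.t a) : c = a := (hE c).resolve_right fun hc => by
    rw [hc] at h
    rw [h] at hρa
    omega
  have hsM : Q.M (Q.s a) ≠ .cpx := ha.2
  refine (isGradedPresentation_idealJ hρ hI).not_isLocallyGentle_in (c := fiberFalse a)
    (b := fiberFalse b) (b' := fiberTrue b hb)
    (fun h => Bool.noConfusion (congrArg (fun p : Q.GE => p.1.2) h))
    (gs_fiber_eq_gt_fiber hab hsM).symm (gs_fiber_eq_gt_fiber hab hsM).symm ?_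
  have hd (d : Q.Gam.E) (h : Q.Gam.t d = Q.Gam.s (fiberFalse a)) : d.1.1 = b := by
    refine (hE d.1.1).resolve_left fun hda => ?_
    have h1 : Q.t d.1.1 = Q.s a := congrArg (fun w : Q.GV => w.1.1) h
    rw [hda, hab] at h1
    rw [h1] at hρa
    omega
  have hy (d : Q.Gam.E) (h : Q.Gam.t d = Q.Gam.s (fiberFalse a)) {x : (idealJ I).ringCon.Quotient}
      (hx : x ∈ peirceCorner ℂ (FinQuiver.qv (idealJ I) (Q.Gam.s (fiberFalse a)))
        (FinQuiver.qv (idealJ I) (Q.Gam.s d))) :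
      x ∈ Submodule.span ℂ (FinQuiver.qa (idealJ I) '' fiberSet b) := by
    refine hρ.mem_span_fiberSet ?_ ?_ hx
    · rw [← h]
      exact hρ d.1.1
    · intro a' h2 _
      refine hsb a' (h2.trans ?_)
      exact congrArg Q.s (hd d h)
  have hx {y : (idealJ I).ringCon.Quotient}
      (hy : y ∈ peirceCorner ℂ (FinQuiver.qv (idealJ I) (Q.Gam.t (fiberFalse a)))
        (FinQuiver.qv (idealJ I) (Q.Gam.s (fiberFalse a)))) :
      y ∈ Submodule.span ℂ (FinQuiver.qa (idealJ I) '' fiberSet a) :=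
    hρ.mem_span_fiberSet (hρ a) (fun a' _ h1 => hta a' h1) hy
  rcases mul_mem_or_model_eq_zero_in (I := I) hρ hab hta hsb htw ha with h | h
  · refine Or.inl fun d hd x hx' y hy' =>
      FinQuiver.mul_eq_zero_of_mem_span ?_ (hx hx') (hy d hd hy')
    exact arrow_mul_arrow_mem_of_fiberSet h
  · exact Or.inr fun d hd x hx' y hy' hxy => mul_eq_zero_in hab ha hb h (hx hx') (hy d hd hy') hxy

end TwoArrows

theorem not_isGentle_pathQuiver {A C : DivAlg} (hA : A ≠ .cpx) (hAC : A ≠ C) :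
    (∀ I : TwoSidedIdeal (pathQuiver A A C).T, I ≤ (pathQuiver A A C).arrowIdealSq →
      ¬ IsGentle ℂ (Complexification I)) ∧
    ∀ I : TwoSidedIdeal (pathQuiver A A C).op.T, I ≤ (pathQuiver A A C).op.arrowIdealSq →
      ¬ IsGentle ℂ (Complexification I) := by
  constructor
  · intro I hI h
    refine not_isLocallyGentle_path_out (Q := pathQuiver A A C) (ρ := ![0, 1, 2]) (a := (1 : Fin 2))
      (b := (0 : Fin 2)) ?_ hI rfl ?_ rfl hAC.symm ⟨rfl, hA⟩ h.1
    · intro a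
      change Fin 2 at a
      fin_cases a <;> rfl
    · intro c
      change Fin 2 at c
      fin_cases c
      · exact Or.inr rfl
      · exact Or.inl rfl
  · intro I hI h
    refine not_isLocallyGentle_path_in (Q := (pathQuiver A A C).op) (ρ := ![2, 1, 0])
      (a := (0 : Fin 2)) (b := (1 : Fin 2)) ?_ hI rfl ?_ rfl ⟨rfl, hA⟩ hAC h.1
    · intro a
      change Fin 2 at a
      fin_cases a <;> rfl
    · intro c
      change Fin 2 at c
      fin_cases c
      · exact Or.inl rfl
      · exact Or.inr rfl

end ModQuiver

/-! ### Quaternion units -/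

theorem qj_mul_qj : qj * qj = -1 := by
  have e1 : qj.re = 0 := rfl
  have e2 : qj.imI = 0 := rfl
  have e3 : qj.imJ = 1 := rfl
  have e4 : qj.imK = 0 := rfl
  apply Quaternion.ext <;> simp [e1, e2, e3, e4]

theorem qi_mul_qj : qi * qj = qk := by
  have e1 : qj.re = 0 := rfl
  have e2 : qj.imI = 0 := rfl
  have e3 : qj.imJ = 1 := rfl
  have e4 : qj.imK = 0 := rfl
  have f1 : qi.re = 0 := rfl
  have f2 : qi.imI = 1 := rfl
  have f3 : qi.imJ = 0 := rfl
  have f4 : qi.imK = 0 := rfl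
  have g1 : qk.re = 0 := rfl
  have g2 : qk.imI = 0 := rfl
  have g3 : qk.imJ = 0 := rfl
  have g4 : qk.imK = 1 := rfl
  apply Quaternion.ext <;> simp [e1, e2, e3, e4, f1, f2, f3, f4, g1, g2, g3, g4]

theorem qj_mul_qk : qj * qk = qi := by
  have e1 : qj.re = 0 := rfl
  have e2 : qj.imI = 0 := rfl
  have e3 : qj.imJ = 1 := rfl
  have e4 : qj.imK = 0 := rfl
  have f1 : qi.re = 0 := rfl
  have f2 : qi.imI = 1 := rfl
  have f3 : qi.imJ = 0 := rfl
  have f4 : qi.imK = 0 := rfl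
  have g1 : qk.re = 0 := rfl
  have g2 : qk.imI = 0 := rfl
  have g3 : qk.imJ = 0 := rfl
  have g4 : qk.imK = 1 := rfl
  apply Quaternion.ext <;> simp [e1, e2, e3, e4, f1, f2, f3, f4, g1, g2, g3, g4]

theorem qk_mul_qj : qk * qj = -qi := by
  rw [← qi_mul_qj, mul_assoc, qj_mul_qj, mul_neg_one]

theorem qj_mul_qi_mul_qj : qj * qi * qj = qi := by
  rw [mul_assoc, qi_mul_qj, qj_mul_qk]

/-! ### Pairs of maps rotating a subspace -/

section Rotation

variable {T : Type} [AddCommGroup T] [Module ℝ T]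

/-- Modulo `K`, the maps `f` and `f'` on `N` differ by a complex structure. -/
def Rotates (f f' : T →ₗ[ℝ] T) (N K : Submodule ℝ T) : Prop :=
  ∀ n ∈ N, ∃ n' ∈ N, f n + f' n' ∈ K ∧ f n' - f' n ∈ K

variable {f f' : T →ₗ[ℝ] T} {N K : Submodule ℝ T}

/-- The relations for `n` and `n'` form a linear system over `K`: from `f n ≡ -f' n'` and `f n' ≡ f'
n` one gets `(r² + s²) f' n ≡ r (r f n' + s f' n') + s (r f n + s f' n)`. Since `-1` is not a square
in `ℝ`, the factor is invertible. -/
theorem Rotates.mem (h : Rotates f f' N K) {r s : ℝ} (hrs : ¬(r = 0 ∧ s = 0))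
    (hK : ∀ n ∈ N, r • f n + s • f' n ∈ K) : ∀ n ∈ N, f n ∈ K ∧ f' n ∈ K := by
  have hpos : r ^ 2 + s ^ 2 ≠ 0 := by
    intro h0
    exact hrs ⟨by nlinarith [sq_nonneg r, sq_nonneg s], by nlinarith [sq_nonneg r, sq_nonneg s]⟩
  have key : ∀ n ∈ N, f' n ∈ K := by
    intro n hn
    obtain ⟨n', hn', h1, h2⟩ := h n hn
    have h3 : (r ^ 2 + s ^ 2) • f' n ∈ K := by
      have e : (r ^ 2 + s ^ 2) • f' n =
          r • (r • f n' + s • f' n') + s • (r • f n + s • f' n) - (r * s) • (f n + f' n') -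
            r ^ 2 • (f n' - f' n) := by module
      rw [e]
      exact K.sub_mem (K.sub_mem (K.add_mem (K.smul_mem _ (hK n' hn')) (K.smul_mem _ (hK n hn)))
        (K.smul_mem _ h1)) (K.smul_mem _ h2)
    exact (K.smul_mem_iff hpos).1 h3
  intro n hn
  obtain ⟨n', hn', h1, -⟩ := h n hn
  exact ⟨(K.add_mem_iff_left (key n' hn')).1 h1, key n hn⟩

theorem rotates_of_span {S : Set T} (hN : N ≤ Submodule.span ℝ S)
    (h : ∀ n ∈ S, ∃ n' ∈ N, f n + f' n' ∈ K ∧ f n' - f' n ∈ K) : Rotates f f' N K := by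
  intro n hn
  have hn' := hN hn
  clear hn
  induction hn' using Submodule.span_induction with
  | mem x hx => exact h x hx
  | zero => exact ⟨0, N.zero_mem, by simp, by simp⟩
  | add x y _ _ hx hy =>
    obtain ⟨x', hx', h1, h2⟩ := hx
    obtain ⟨y', hy', h3, h4⟩ := hy
    refine ⟨x' + y', N.add_mem hx' hy', ?_, ?_⟩
    · rw [map_add, map_add, add_add_add_comm]
      exact K.add_mem h1 h3
    · rw [map_add, map_add, add_sub_add_comm]
      exact K.add_mem h2 h4
  | smul c x _ hx =>
    obtain ⟨x', hx', h1, h2⟩ := hx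
    refine ⟨c • x', N.smul_mem _ hx', ?_, ?_⟩
    · rw [map_smul, map_smul, ← smul_add]
      exact K.smul_mem _ h1
    · rw [map_smul, map_smul, ← smul_sub]
      exact K.smul_mem _ h2

end Rotation

namespace ModQuiver

section Rotations

variable {Q : ModQuiver}

theorem arrEl_neg (a : Q.E) (x : ℍ[ℝ]) : Q.arrEl a (-x) = -Q.arrEl a x := by
  by_cases h : x ∈ Q.bimod a
  · rw [arrEl_of_mem Q h, arrEl_of_mem Q (neg_mem h)]
    exact (Q.arrHom a).map_neg ⟨x, h⟩
  · unfold arrEl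
    rw [dif_neg h, dif_neg (fun h' => h (by simpa using neg_mem h')), neg_zero]

theorem arrEl_add {a : Q.E} {x y : ℍ[ℝ]} (hx : x ∈ Q.bimod a) (hy : y ∈ Q.bimod a) :
    Q.arrEl a (x + y) = Q.arrEl a x + Q.arrEl a y := by
  rw [arrEl_of_mem Q hx, arrEl_of_mem Q hy, arrEl_of_mem Q (add_mem hx hy), ← arr_add]
  rfl

/-- The sum of the bimodules of two arrows. -/
def arrSpan (a a' : Q.E) : Submodule ℝ Q.T :=
  LinearMap.range (Q.arrHom a) ⊔ LinearMap.range (Q.arrHom a')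

theorem arrEl_mem_left {a a' : Q.E} (x : ℍ[ℝ]) : Q.arrEl a x ∈ arrSpan a a' := by
  unfold arrEl
  split_ifs with h
  · exact Submodule.mem_sup_left ⟨_, rfl⟩
  · exact zero_mem _

theorem arrEl_mem_right {a a' : Q.E} (x : ℍ[ℝ]) : Q.arrEl a' x ∈ arrSpan a a' := by
  unfold arrEl
  split_ifs with h
  · exact Submodule.mem_sup_right ⟨_, rfl⟩
  · exact zero_mem _

theorem arrSpan_le {a a' : Q.E} {P : Submodule ℝ Q.T}
    (h : ∀ x ∈ Q.bimod a, Q.arrEl a x ∈ P) (h' : ∀ x ∈ Q.bimod a', Q.arrEl a' x ∈ P) :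
    arrSpan a a' ≤ P := by
  refine sup_le ?_ ?_
  · rintro _ ⟨m, rfl⟩
    change Q.arr a m ∈ P
    rw [← arrEl_coe]
    exact h m m.2
  · rintro _ ⟨m, rfl⟩
    change Q.arr a' m ∈ P
    rw [← arrEl_coe]
    exact h' m m.2

/-- If the bimodule of `a` has a complex structure, a relation between `f` and `f'` for one
arrow gives a rotation. -/
theorem rotates_of_single {f f' : Q.T →ₗ[ℝ] Q.T} {K : Submodule ℝ Q.T} (a : Q.E)
    (J : ℍ[ℝ] → ℍ[ℝ]) (hJ : ∀ x ∈ Q.bimod a, J x ∈ Q.bimod a) (hJJ : ∀ x, J (J x) = -x)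
    (h : (∀ x ∈ Q.bimod a, f (Q.arrEl a x) + f' (Q.arrEl a (J x)) ∈ K) ∨
      ∀ x ∈ Q.bimod a, f (Q.arrEl a x) - f' (Q.arrEl a (J x)) ∈ K) :
    Rotates f f' (arrSpan a a) K := by
  refine rotates_of_span (S := {z | ∃ x ∈ Q.bimod a, z = Q.arrEl a x})
    (arrSpan_le (fun x hx => Submodule.subset_span ⟨x, hx, rfl⟩)
      (fun x hx => Submodule.subset_span ⟨x, hx, rfl⟩)) ?_
  rintro _ ⟨x, hx, rfl⟩
  rcases h with h | h
  · refine ⟨_, arrEl_mem_left (J x), h x hx, ?_⟩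
    have h1 := h _ (hJ x hx)
    rwa [hJJ, arrEl_neg, map_neg, ← sub_eq_add_neg] at h1
  · refine ⟨-Q.arrEl a (J x), neg_mem (arrEl_mem_left (J x)), ?_, ?_⟩
    · rw [map_neg, ← sub_eq_add_neg]
      exact h x hx
    · have h1 := h _ (hJ x hx)
      rw [hJJ, arrEl_neg, map_neg, sub_neg_eq_add] at h1
      rw [map_neg, ← neg_add']
      exact neg_mem h1

/-- For two parallel real arrows the complex structure exchanges the arrows up to sign. The two
alternatives are the two sets of generators at the vertex, and they differ by the sign of the
complex structure. -/
theorem rotates_of_real {f f' : Q.T →ₗ[ℝ] Q.T} {K : Submodule ℝ Q.T} {a a' : Q.E}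
    (ha : ∀ x ∈ Q.bimod a, ∃ r : ℝ, Q.arrEl a x = r • Q.arrEl a 1)
    (ha' : ∀ x ∈ Q.bimod a', ∃ r : ℝ, Q.arrEl a' x = r • Q.arrEl a' 1)
    (h : (f (Q.arrEl a 1) - f' (Q.arrEl a' 1) ∈ K ∧ f (Q.arrEl a' 1) + f' (Q.arrEl a 1) ∈ K) ∨
      (f (Q.arrEl a 1) + f' (Q.arrEl a' 1) ∈ K ∧ f (Q.arrEl a' 1) - f' (Q.arrEl a 1) ∈ K)) :
    Rotates f f' (arrSpan a a') K := by
  refine rotates_of_span (S := {Q.arrEl a 1, Q.arrEl a' 1}) (arrSpan_le ?_ ?_) ?_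
  · intro x hx
    obtain ⟨r, hr⟩ := ha x hx
    rw [hr]
    exact Submodule.smul_mem _ _ (Submodule.subset_span (Or.inl rfl))
  · intro x hx
    obtain ⟨r, hr⟩ := ha' x hx
    rw [hr]
    exact Submodule.smul_mem _ _ (Submodule.subset_span (Or.inr rfl))
  · rintro _ (rfl | rfl)
    · rcases h with ⟨h1, h2⟩ | ⟨h1, h2⟩
      · refine ⟨-Q.arrEl a' 1, neg_mem (arrEl_mem_right 1), ?_, ?_⟩
        · rwa [map_neg, ← sub_eq_add_neg]
        · rw [map_neg, ← neg_add']
          exact neg_mem h2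
      · exact ⟨Q.arrEl a' 1, arrEl_mem_right 1, h1, h2⟩
    · rcases h with ⟨h1, h2⟩ | ⟨h1, h2⟩
      · exact ⟨Q.arrEl a 1, arrEl_mem_left 1, h2, h1⟩
      · refine ⟨-Q.arrEl a 1, neg_mem (arrEl_mem_left 1), ?_, ?_⟩
        · rwa [map_neg, ← sub_eq_add_neg]
        · rw [map_neg, ← neg_add']
          exact neg_mem h1

/-- The complex structure is `x ↦ x * qi` on the elements `a (x y) + a' (x qi y)`. It is enough to
have it on these elements, because they span both bimodules. -/
theorem rotates_of_quat {f f' : Q.T →ₗ[ℝ] Q.T} {K : Submodule ℝ Q.T} {a a' : Q.E}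
    (h : (∀ x y, f (Q.arrEl a (x * y) + Q.arrEl a' (x * qi * y)) +
        f' (Q.arrEl a (x * qi * y) - Q.arrEl a' (x * y)) ∈ K) ∨
      ∀ x y, f (Q.arrEl a (x * y) + Q.arrEl a' (x * qi * y)) -
        f' (Q.arrEl a (x * qi * y) - Q.arrEl a' (x * y)) ∈ K) :
    Rotates f f' (arrSpan a a') K := by
  let g (x y : ℍ[ℝ]) : Q.T := Q.arrEl a (x * y) + Q.arrEl a' (x * qi * y)
  have hg (x y : ℍ[ℝ]) : g (x * qi) y = Q.arrEl a (x * qi * y) - Q.arrEl a' (x * y) := by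
    change _ + _ = _
    rw [mul_assoc x qi qi, qi_mul_qi, mul_neg_one, neg_mul, arrEl_neg, ← sub_eq_add_neg]
  have hgg (x y : ℍ[ℝ]) : g (x * qi * qi) y = -g x y := by
    change _ + _ = -(_ + _)
    rw [mul_assoc x qi qi, qi_mul_qi, mul_neg_one, neg_mul, neg_mul, neg_mul, arrEl_neg, arrEl_neg,
      neg_add]
  have hmem (x y : ℍ[ℝ]) : g x y ∈ arrSpan a a' := add_mem (arrEl_mem_left _) (arrEl_mem_right _)
  -- As `qj qi qj = qi` while `qj qj = -1`, the parts in `a'` cancel and those in `a` add up.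
  have h2 (x : ℍ[ℝ]) : (2 : ℝ) • Q.arrEl a x = g x 1 + g (-(x * qj)) qj := by
    change _ = _ + _ + (_ + _)
    have e1 : -(x * qj) * qj = x := by rw [neg_mul, mul_assoc, qj_mul_qj, mul_neg_one, neg_neg]
    have e2 : -(x * qj) * qi * qj = -(x * qi) := by
      rw [neg_mul, neg_mul, mul_assoc, mul_assoc, ← mul_assoc qj, qj_mul_qi_mul_qj]
    rw [e1, e2, mul_one, mul_one, arrEl_neg, two_smul]
    abel
  refine rotates_of_span (S := {z | ∃ x y, z = g x y}) ?_ ?_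
  · have hl (x : ℍ[ℝ]) : Q.arrEl a x ∈ Submodule.span ℝ {z | ∃ x y, z = g x y} := by
      refine (Submodule.smul_mem_iff _ (two_ne_zero : (2 : ℝ) ≠ 0)).1 ?_
      rw [h2]
      exact add_mem (Submodule.subset_span ⟨_, _, rfl⟩) (Submodule.subset_span ⟨_, _, rfl⟩)
    refine arrSpan_le (fun x _ => hl x) fun x _ => ?_
    have e : Q.arrEl a' x = g (-(x * qi)) 1 + Q.arrEl a (x * qi) := by
      change _ = _ + _ + _
      rw [mul_one, mul_one, neg_mul, mul_assoc, qi_mul_qi, mul_neg_one, neg_neg, arrEl_neg]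
      abel
    rw [e]
    exact add_mem (Submodule.subset_span ⟨_, _, rfl⟩) (hl _)
  · rintro _ ⟨x, y, rfl⟩
    rcases h with h | h
    · replace h : ∀ x y, f (g x y) + f' (g (x * qi) y) ∈ K := fun x y => hg x y ▸ h x y
      refine ⟨g (x * qi) y, hmem _ _, h x y, ?_⟩
      have h1 := h (x * qi) y
      rwa [hgg, map_neg, ← sub_eq_add_neg] at h1
    · replace h : ∀ x y, f (g x y) - f' (g (x * qi) y) ∈ K := fun x y => hg x y ▸ h x y
      refine ⟨-g (x * qi) y, neg_mem (hmem _ _), ?_, ?_⟩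
      · rw [map_neg, ← sub_eq_add_neg]
        exact h x y
      · have h1 := h (x * qi) y
        rw [hgg, map_neg, sub_neg_eq_add] at h1
        rw [map_neg, ← neg_add']
        exact neg_mem h1

end Rotations

end ModQuiver

namespace ModQuiver

/-! ### The relations at a specially gentle vertex as rotations. -/

section RotationsOfGens

variable {Q : ModQuiver}

theorem mem_bimod_iff {a : Q.E} {t s : DivAlg} (ht : Q.M (Q.t a) = t) (hs : Q.M (Q.s a) = s)
    (htw : Q.tw a = false) (x : ℍ[ℝ]) : x ∈ Q.bimod a ↔ x ∈ simpleBimod t s false := by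
  unfold bimod
  rw [ht, hs, htw]

theorem mem_bimod_self {a : Q.E} {D : DivAlg} (hD : D ≠ .cpx) (ht : Q.M (Q.t a) = D)
    (hs : Q.M (Q.s a) = D) (x : ℍ[ℝ]) : x ∈ Q.bimod a ↔ x ∈ D.toSub := by
  unfold bimod
  rw [ht, hs, simpleBimod_self hD]
  rfl

theorem exists_arrEl_eq_smul {a : Q.E} (ht : Q.M (Q.t a) = .real) (hs : Q.M (Q.s a) = .real) :
    ∀ x ∈ Q.bimod a, ∃ r : ℝ, Q.arrEl a x = r • Q.arrEl a 1 := by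
  intro x hx
  have h (x : ℍ[ℝ]) := mem_bimod_self (x := x) (by decide) ht hs
  obtain ⟨r, rfl⟩ := Algebra.mem_bot.1 ((h x).1 hx)
  refine ⟨r, ?_⟩
  rw [arrEl_of_mem Q hx, arrEl_of_mem Q ((h 1).2 (one_mem _)), ← arr_smul]
  congr 1
  exact Subtype.ext (Algebra.algebraMap_eq_smul_one r)

theorem vertEl_mul_ten_mul_vertEl {a b : Q.E} {w u : Q.V} (hw : Q.t a = w) (hu : Q.s b = u)
    {x p q y : ℍ[ℝ]} (hx : x ∈ (Q.M w).toSub) (hp : p ∈ Q.bimod a) (hq : q ∈ Q.bimod b)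
    (hy : y ∈ (Q.M u).toSub) :
    Q.vertEl w x * ten a p b q * Q.vertEl u y = ten a (x * p) b (q * y) := by
  subst hw hu
  unfold ten
  rw [← mul_assoc, vertEl_mul_arrEl Q hx hp, mul_assoc, arrEl_mul_vertEl Q hq hy]

theorem ten_eq_left {a b : Q.E} {D : DivAlg} (hD : D ≠ .cpx) (hab : Q.s a = Q.t b)
    (ht : Q.M (Q.t b) = D) (hs : Q.M (Q.s b) = D) {p q : ℍ[ℝ]} (hp : p ∈ Q.bimod a)
    (hq : q ∈ D.toSub) : ten a p b q = Q.arrEl a (p * q) * Q.arrEl b 1 := by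
  refine Eq.trans ?_ (arrEl_mul_arrEl_assoc Q hab hp (hab ▸ ht ▸ hq)
    ((mem_bimod_self hD ht hs _).2 (one_mem _))).symm
  rw [mul_one]
  rfl

theorem ten_eq_right {a b : Q.E} {D : DivAlg} (hD : D ≠ .cpx) (hab : Q.s a = Q.t b)
    (ht : Q.M (Q.t a) = D) (hs : Q.M (Q.s a) = D) {p q : ℍ[ℝ]} (hp : p ∈ D.toSub)
    (hq : q ∈ Q.bimod b) : ten a p b q = Q.arrEl a 1 * Q.arrEl b (p * q) := by
  refine Eq.trans ?_ (arrEl_mul_arrEl_assoc Q hab ((mem_bimod_self hD ht hs _).2 (one_mem _))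
    (hs ▸ hp) hq)
  rw [one_mul]
  rfl

theorem qj_mul_neg_qj_mul (z : ℍ[ℝ]) : qj * (-(qj * z)) = z := by
  rw [mul_neg, ← mul_assoc, qj_mul_qj, neg_mul, one_mul, neg_neg]

theorem qk_mul_neg_qj_mul (z : ℍ[ℝ]) : qk * (-(qj * z)) = qi * z := by
  rw [mul_neg, ← mul_assoc, qk_mul_qj, neg_mul, neg_neg]

theorem neg_mul_qj_mul_qj (z : ℍ[ℝ]) : -(z * qj) * qj = z := by
  rw [neg_mul, mul_assoc, qj_mul_qj, mul_neg_one, neg_neg]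

theorem neg_mul_qj_mul_qk (z : ℍ[ℝ]) : -(z * qj) * qk = -(z * qi) := by
  rw [neg_mul, mul_assoc, qj_mul_qk]

/-- The generators at a specially gentle vertex relate the two parallel ingoing arrows by a
rotation. -/
theorem rotates_in {v : Q.V} {a a' b b' : Q.E} {D B : DivAlg} {K : Submodule ℝ Q.T}
    (hsa : Q.s a = v) (hsa' : Q.s a' = v) (hta : Q.t a' = Q.t a) (htb : Q.t b = v)
    (htb' : Q.t b' = v) (hsb : Q.s b' = Q.s b) (htw : ∀ e, Q.tw e = false) (hD : D ≠ .cpx)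
    (hu : Q.M (Q.s b) = D) (hv : Q.M v = D) (hw : Q.M (Q.t a) = B) (haa : a ≠ a' ↔ B = D)
    (hK : (∀ r ∈ gens0 D D B a a' b b', ∀ x ∈ B.toSub, ∀ y ∈ D.toSub,
        Q.vertEl (Q.t a) x * r * Q.vertEl (Q.s b) y ∈ K) ∨
      ∀ r ∈ gens1 D D B a a' b b', ∀ x ∈ B.toSub, ∀ y ∈ D.toSub,
        Q.vertEl (Q.t a) x * r * Q.vertEl (Q.s b) y ∈ K) :
    Rotates (LinearMap.mulRight ℝ (Q.arrEl b 1)) (LinearMap.mulRight ℝ (Q.arrEl b' 1))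
      (arrSpan a a') K := by
  have hba (x : ℍ[ℝ]) := mem_bimod_iff (x := x) hw (hsa ▸ hv) (htw a)
  have hba' (x : ℍ[ℝ]) := mem_bimod_iff (x := x) (hta ▸ hw) (hsa' ▸ hv) (htw a')
  have hbb (x : ℍ[ℝ]) := mem_bimod_self (x := x) hD (htb ▸ hv) hu
  have hbb' (x : ℍ[ℝ]) := mem_bimod_self (x := x) hD (htb' ▸ hv) (hsb ▸ hu)
  -- The two-sided action `z ↦ x z y` by which the generators generate a bimodule.
  let φ (x y : ℍ[ℝ]) : Q.T →ₗ[ℝ] Q.T :=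
    LinearMap.mulRight ℝ (Q.vertEl (Q.s b) y) ∘ₗ LinearMap.mulLeft ℝ (Q.vertEl (Q.t a) x)
  -- The ingoing bimodules are regular, so all quaternions can be moved into the outgoing factor.
  have E (e f : Q.E) (he : e = a ∨ e = a') (hf : f = b ∨ f = b') (x p q y : ℍ[ℝ])
      (hx : x ∈ B.toSub) (hp : p ∈ simpleBimod B D false) (hq : q ∈ D.toSub) (hy : y ∈ D.toSub) :
      φ x y (ten e p f q) = Q.arrEl e (x * p * (q * y)) * Q.arrEl f 1 := by
    have h1 : Q.t e = Q.t a := by rcases he with rfl | rfl <;> simp [hta]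
    have h2 : Q.s f = Q.s b := by rcases hf with rfl | rfl <;> simp [hsb]
    have h3 : Q.s e = v := by rcases he with rfl | rfl <;> assumption
    have h4 : Q.t f = v := by rcases hf with rfl | rfl <;> assumption
    have hp' : p ∈ Q.bimod e := by rcases he with rfl | rfl <;> simp [hba, hba', hp]
    have hx' : x ∈ (Q.M (Q.t a)).toSub := hw ▸ hx
    change Q.vertEl (Q.t a) x * ten e p f q * Q.vertEl (Q.s b) y = _
    rw [vertEl_mul_ten_mul_vertEl h1 h2 hx' hp' ((mem_bimod_self hD (h4 ▸ hv) (h2 ▸ hu) _).2 hq)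
      (hu ▸ hy), ten_eq_left hD (h3.trans h4.symm) (h4 ▸ hv) (h2 ▸ hu)
        (left_mul_mem _ _ _ (h1.symm ▸ hx') hp') (mul_mem hq hy)]
  replace hK : (∀ r ∈ gens0 D D B a a' b b', ∀ x ∈ B.toSub, ∀ y ∈ D.toSub, φ x y r ∈ K) ∨
      ∀ r ∈ gens1 D D B a a' b b', ∀ x ∈ B.toSub, ∀ y ∈ D.toSub, φ x y r ∈ K := hK
  clear_value φ
  have l : a = a ∨ a = a' := Or.inl rfl
  have r : a' = a ∨ a' = a' := Or.inr rfl
  have l' : b = b ∨ b = b' := Or.inl rfl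
  have r' : b' = b ∨ b' = b' := Or.inr rfl
  have o (D : DivAlg) : 1 ∈ D.toSub := one_mem _
  have t (x : ℍ[ℝ]) : x ∈ DivAlg.quat.toSub := trivial
  by_cases hBD : B = D
  · subst hBD
    cases B
    · refine rotates_of_real (exists_arrEl_eq_smul hw (hsa ▸ hv))
        (exists_arrEl_eq_smul (hta ▸ hw) (hsa' ▸ hv)) ?_
      have E1 (e f : Q.E) (he : e = a ∨ e = a') (hf : f = b ∨ f = b') :
          φ 1 1 (ten e 1 f 1) = Q.arrEl e 1 * Q.arrEl f 1 := by
        rw [E e f he hf 1 1 1 1 (o _) (o _) (o _) (o _), mul_one, mul_one]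
      simp only [gens0, gens1, Set.mem_insert_iff, Set.mem_singleton_iff, forall_eq_or_imp,
        forall_eq] at hK
      simp only [LinearMap.mulRight_apply]
      rcases hK with ⟨h1, h2⟩ | ⟨h1, h2⟩
      · left
        have h1 := h1 1 (o _) 1 (o _)
        have h2 := neg_mem (h2 1 (o _) 1 (o _))
        rw [map_sub, E1 a b l l', E1 a' b' r r'] at h1
        rw [map_sub, map_neg, E1 a b' l r', E1 a' b r l', neg_sub, sub_neg_eq_add] at h2
        exact ⟨h1, h2⟩
      · right
        have h1 := h1 1 (o _) 1 (o _)
        have h2 := neg_mem (h2 1 (o _) 1 (o _))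
        rw [map_add, E1 a b l l', E1 a' b' r r'] at h1
        rw [map_sub, E1 a b' l r', E1 a' b r l', neg_sub] at h2
        exact ⟨h1, h2⟩
    · exact absurd rfl hD
    · refine rotates_of_quat ?_
      simp only [gens0, gens1, Set.mem_singleton_iff, forall_eq] at hK
      simp only [LinearMap.mulRight_apply, add_mul, sub_mul]
      have E1 (e f : Q.E) (he : e = a ∨ e = a') (hf : f = b ∨ f = b') (x p q y : ℍ[ℝ]) :
        φ x y (ten e p f q) = Q.arrEl e (x * p * (q * y)) * Q.arrEl f 1 :=
          E e f he hf x p q y (t _) (t _) (t _) (t _)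
      rcases hK with h | h
      · refine Or.inl fun x y => ?_
        have h1 := h x (t _) y (t _)
        rw [map_add, map_add, map_sub, E1 a b l l', E1 a' b' r r', E1 a b' l r', E1 a' b r l',
          mul_one, one_mul, ← mul_assoc x qi y] at h1
        convert h1 using 1
        abel
      · refine Or.inr fun x y => ?_
        -- Multiplying by `-(qj y)` turns `qj` into `y` and `qk` into `qi y`, which brings the
        -- second generator to the shape of the first with the opposite sign.
        have h1 := h x (t _) (-(qj * y)) (t _)
        rw [map_add, map_sub, map_add, E1 a b l l', E1 a' b' r r', E1 a b' l r', E1 a' b r l',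
          mul_one, qj_mul_neg_qj_mul, qk_mul_neg_qj_mul, ← mul_assoc x qi y] at h1
        convert h1 using 1
        abel
  · obtain rfl : a = a' := not_not.1 (haa.not.2 hBD)
    cases D
    -- For `D = ℝ` and `B ≠ ℝ` the bimodule of `a` is `B` itself: its elements come from `1` through
    -- the left action, and right multiplication by `qi` is a complex structure on it.
    · have hB : ∀ x ∈ simpleBimod B .real false, x ∈ B.toSub ∧
          x * qi ∈ simpleBimod B .real false := by
        intro x hx
        cases B
        · exact absurd rfl hBD
        · exact ⟨hx, DivAlg.cpx.toSub.mul_mem hx ((mem_cpx_iff _).2 ⟨rfl, rfl⟩)⟩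
        · exact ⟨trivial, trivial⟩
      have h1B : 1 ∈ simpleBimod B .real false := by
        cases B
        · exact o .real
        · exact o .cpx
        · trivial
      have hiB : qi ∈ simpleBimod B .real false := by
        have := (hB 1 h1B).2
        rwa [one_mul] at this
      refine rotates_of_single a (· * qi) (fun x hx => (hba _).2 (hB x ((hba x).1 hx)).2)
        (fun x => by rw [mul_assoc, qi_mul_qi, mul_neg_one]) ?_
      have h01 (x p : ℍ[ℝ]) : x * p * (1 * 1) = x * p := by rw [one_mul, mul_one]
      have E1 (f : Q.E) (hf : f = b ∨ f = b') (x p : ℍ[ℝ]) (hx : x ∈ B.toSub)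
          (hp : p ∈ simpleBimod B .real false) :
          φ x 1 (ten a p f 1) = Q.arrEl a (x * p) * Q.arrEl f 1 := by
        rw [E a f l hf x p 1 1 hx hp (o _) (o _), h01]
      have hK' : (∀ x ∈ B.toSub, φ x 1 (ten a 1 b 1) + φ x 1 (ten a qi b' 1) ∈ K) ∨
          ∀ x ∈ B.toSub, φ x 1 (ten a 1 b 1) - φ x 1 (ten a qi b' 1) ∈ K := by
        simp only [← map_add, ← map_sub]
        cases B
        · exact absurd rfl hBD
        · exact hK.imp (fun h x hx => h _ rfl x hx 1 (o _)) (fun h x hx => h _ rfl x hx 1 (o _))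
        · exact hK.imp (fun h x hx => h _ rfl x hx 1 (o _)) (fun h x hx => h _ rfl x hx 1 (o _))
      refine hK'.imp (fun h x hx => ?_) (fun h x hx => ?_)
      all_goals
        have hx' := (hB x ((hba x).1 hx)).1
        have h1 := h x hx'
        rw [E1 b l' x 1 hx' h1B, E1 b' r' x qi hx' hiB, mul_one] at h1
        exact h1
    · exact absurd rfl hD
    · have hB (x : ℍ[ℝ]) : x ∈ simpleBimod B .quat false := by
        cases B <;> trivial
      -- For `D = ℍ` the bimodule of `a` is realized by all of `ℍ`, and the complex structure comes
      -- from left multiplication by `qi`, which stands to the left of the free right factor.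
      refine rotates_of_single a (qi * ·) (fun x _ => (hba _).2 (hB _))
        (fun x => by rw [← mul_assoc, qi_mul_qi, neg_one_mul]) ?_
      have E1 (f : Q.E) (hf : f = b ∨ f = b') (q y : ℍ[ℝ]) :
          φ 1 y (ten a 1 f q) = Q.arrEl a (q * y) * Q.arrEl f 1 := by
        rw [E a f l hf 1 1 q y (o _) (hB _) (t _) (t _), one_mul, one_mul]
      have hK' : (∀ y, φ 1 y (ten a 1 b 1) + φ 1 y (ten a 1 b' qi) ∈ K) ∨
          ∀ y, φ 1 y (ten a 1 b qj) - φ 1 y (ten a 1 b' qk) ∈ K := by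
        simp only [← map_add, ← map_sub]
        cases B
        · exact hK.imp (fun h x => h _ rfl 1 (o _) x (t _)) (fun h x => h _ rfl 1 (o _) x (t _))
        · exact hK.imp (fun h x => h _ rfl 1 (o _) x (t _)) (fun h x => h _ rfl 1 (o _) x (t _))
        · exact absurd rfl hBD
      refine hK'.imp (fun h x hx => ?_) (fun h x hx => ?_)
      · have h1 := h x
        rwa [E1 b l', E1 b' r', one_mul] at h1
      · have h1 := h (-(qj * x))
        rwa [E1 b l', E1 b' r', qj_mul_neg_qj_mul, qk_mul_neg_qj_mul] at h1

/-- The generators at a specially gentle vertex relate the two parallel outgoing arrows by a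
rotation. -/
theorem rotates_out {v : Q.V} {a a' b b' : Q.E} {D B : DivAlg} {K : Submodule ℝ Q.T}
    (hsa : Q.s a = v) (hsa' : Q.s a' = v) (hta : Q.t a' = Q.t a) (htb : Q.t b = v)
    (htb' : Q.t b' = v) (hsb : Q.s b' = Q.s b) (htw : ∀ e, Q.tw e = false) (hD : D ≠ .cpx)
    (hu : Q.M (Q.s b) = B) (hv : Q.M v = D) (hw : Q.M (Q.t a) = D) (hbb' : b ≠ b' ↔ B = D)
    (hK : (∀ r ∈ gens0 B D D a a' b b', ∀ x ∈ D.toSub, ∀ y ∈ B.toSub,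
        Q.vertEl (Q.t a) x * r * Q.vertEl (Q.s b) y ∈ K) ∨
      ∀ r ∈ gens1 B D D a a' b b', ∀ x ∈ D.toSub, ∀ y ∈ B.toSub,
        Q.vertEl (Q.t a) x * r * Q.vertEl (Q.s b) y ∈ K) :
    Rotates (LinearMap.mulLeft ℝ (Q.arrEl a 1)) (LinearMap.mulLeft ℝ (Q.arrEl a' 1))
      (arrSpan b b') K := by
  have hbb (x : ℍ[ℝ]) := mem_bimod_iff (x := x) (htb ▸ hv) hu (htw b)
  have hbb2 (x : ℍ[ℝ]) := mem_bimod_iff (x := x) (htb' ▸ hv) (hsb ▸ hu) (htw b')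
  let φ (x y : ℍ[ℝ]) : Q.T →ₗ[ℝ] Q.T :=
    LinearMap.mulRight ℝ (Q.vertEl (Q.s b) y) ∘ₗ LinearMap.mulLeft ℝ (Q.vertEl (Q.t a) x)
  have E (e f : Q.E) (he : e = a ∨ e = a') (hf : f = b ∨ f = b') (x p q y : ℍ[ℝ])
      (hx : x ∈ D.toSub) (hp : p ∈ D.toSub) (hq : q ∈ simpleBimod D B false) (hy : y ∈ B.toSub) :
      φ x y (ten e p f q) = Q.arrEl e 1 * Q.arrEl f (x * p * (q * y)) := by
    have h1 : Q.t e = Q.t a := by rcases he with rfl | rfl <;> simp [hta]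
    have h2 : Q.s f = Q.s b := by rcases hf with rfl | rfl <;> simp [hsb]
    have h3 : Q.s e = v := by rcases he with rfl | rfl <;> assumption
    have h4 : Q.t f = v := by rcases hf with rfl | rfl <;> assumption
    have hq' : q ∈ Q.bimod f := by rcases hf with rfl | rfl <;> simp [hbb, hbb2, hq]
    have hy' : y ∈ (Q.M (Q.s b)).toSub := hu ▸ hy
    change Q.vertEl (Q.t a) x * ten e p f q * Q.vertEl (Q.s b) y = _
    rw [vertEl_mul_ten_mul_vertEl h1 h2 (hw ▸ hx)
      ((mem_bimod_self hD (h1 ▸ hw) (h3 ▸ hv) _).2 hp) hq' hy',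
      ten_eq_right hD (h3.trans h4.symm) (h1 ▸ hw) (h3 ▸ hv) (mul_mem hx hp)
        (right_mul_mem _ _ _ (h2.symm ▸ hy') hq')]
  replace hK : (∀ r ∈ gens0 B D D a a' b b', ∀ x ∈ D.toSub, ∀ y ∈ B.toSub, φ x y r ∈ K) ∨
      ∀ r ∈ gens1 B D D a a' b b', ∀ x ∈ D.toSub, ∀ y ∈ B.toSub, φ x y r ∈ K := hK
  clear_value φ
  have l : a = a ∨ a = a' := Or.inl rfl
  have r : a' = a ∨ a' = a' := Or.inr rfl
  have l' : b = b ∨ b = b' := Or.inl rfl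
  have r' : b' = b ∨ b' = b' := Or.inr rfl
  have o (D : DivAlg) : 1 ∈ D.toSub := one_mem _
  have t (x : ℍ[ℝ]) : x ∈ DivAlg.quat.toSub := trivial
  have T_mul_neg (x y : Q.T) : x * -y = -(x * y) := (LinearMap.mulLeft ℝ x).map_neg y
  by_cases hBD : B = D
  · subst hBD
    cases B
    · refine rotates_of_real (exists_arrEl_eq_smul (htb ▸ hv) hu)
        (exists_arrEl_eq_smul (htb' ▸ hv) (hsb ▸ hu)) ?_
      have E1 (e f : Q.E) (he : e = a ∨ e = a') (hf : f = b ∨ f = b') :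
          φ 1 1 (ten e 1 f 1) = Q.arrEl e 1 * Q.arrEl f 1 := by
        rw [E e f he hf 1 1 1 1 (o _) (o _) (o _) (o _), mul_one, mul_one]
      simp only [gens0, gens1, Set.mem_insert_iff, Set.mem_singleton_iff, forall_eq_or_imp,
        forall_eq] at hK
      simp only [LinearMap.mulLeft_apply]
      rcases hK with ⟨h1, h2⟩ | ⟨h1, h2⟩
      · left
        have h1 := h1 1 (o _) 1 (o _)
        have h2 := neg_mem (h2 1 (o _) 1 (o _))
        rw [map_sub, E1 a b l l', E1 a' b' r r'] at h1
        rw [map_sub, map_neg, E1 a b' l r', E1 a' b r l', neg_sub, sub_neg_eq_add, add_comm] at h2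
        exact ⟨h1, h2⟩
      · right
        have h1 := h1 1 (o _) 1 (o _)
        have h2 := h2 1 (o _) 1 (o _)
        rw [map_add, E1 a b l l', E1 a' b' r r'] at h1
        rw [map_sub, E1 a b' l r', E1 a' b r l'] at h2
        exact ⟨h1, h2⟩
    · exact absurd rfl hD
    · refine rotates_of_quat ?_
      simp only [gens0, gens1, Set.mem_singleton_iff, forall_eq] at hK
      simp only [LinearMap.mulLeft_apply, mul_add, mul_sub]
      have E1 (e f : Q.E) (he : e = a ∨ e = a') (hf : f = b ∨ f = b') (x q y : ℍ[ℝ]) :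
        φ x y (ten e 1 f q) = Q.arrEl e 1 * Q.arrEl f (x * q * y) := by
          rw [E e f he hf x 1 q y (t _) (t _) (t _) (t _), mul_one, mul_assoc]
      rcases hK with h | h
      · refine Or.inl fun x y => ?_
        have h1 := h x (t _) y (t _)
        rw [map_add, map_add, map_sub, E1 a b l l', E1 a' b' r r', E1 a b' l r', E1 a' b r l',
          mul_one] at h1
        convert h1 using 1
        abel
      · refine Or.inr fun x y => ?_
        -- The normalization of the second generator is now made from the left: `-(x qj)` times `qj`
        -- is `x`, and times `qk` is `-(x qi)`.
        have h1 := h (-(x * qj)) (t _) y (t _)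
        rw [map_add, map_sub, map_add, E1 a b l l', E1 a' b' r r', E1 a b' l r', E1 a' b r l',
          neg_mul_qj_mul_qj, neg_mul_qj_mul_qk, neg_mul, arrEl_neg, arrEl_neg, T_mul_neg,
          T_mul_neg] at h1
        convert h1 using 1
        abel
  · obtain rfl : b = b' := not_not.1 (hbb'.not.2 hBD)
    cases D
    · have hB : ∀ x ∈ simpleBimod .real B false, x ∈ B.toSub ∧
          qi * x ∈ simpleBimod .real B false := by
        intro x hx
        cases B
        · exact absurd rfl hBD
        · exact ⟨hx, DivAlg.cpx.toSub.mul_mem ((mem_cpx_iff _).2 ⟨rfl, rfl⟩) hx⟩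
        · exact ⟨trivial, trivial⟩
      have h1B : 1 ∈ simpleBimod .real B false := by
        cases B
        · exact o .real
        · exact o .cpx
        · trivial
      have hiB : qi ∈ simpleBimod .real B false := by
        have := (hB 1 h1B).2
        rwa [mul_one] at this
      refine rotates_of_single b (qi * ·) (fun x hx => (hbb _).2 (hB x ((hbb x).1 hx)).2)
        (fun x => by rw [← mul_assoc, qi_mul_qi, neg_one_mul]) ?_
      have E1 (e : Q.E) (he : e = a ∨ e = a') (q y : ℍ[ℝ]) (hq : q ∈ simpleBimod .real B false)
          (hy : y ∈ B.toSub) : φ 1 y (ten e 1 b q) = Q.arrEl e 1 * Q.arrEl b (q * y) := by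
        rw [E e b he l' 1 1 q y (o _) (o _) hq hy, one_mul, one_mul]
      have hK' : (∀ y ∈ B.toSub, φ 1 y (ten a 1 b 1) + φ 1 y (ten a' 1 b qi) ∈ K) ∨
          ∀ y ∈ B.toSub, φ 1 y (ten a 1 b 1) - φ 1 y (ten a' 1 b qi) ∈ K := by
        simp only [← map_add, ← map_sub]
        cases B
        · exact absurd rfl hBD
        · exact hK.imp (fun h y hy => h _ rfl 1 (o _) y hy) (fun h y hy => h _ rfl 1 (o _) y hy)
        · exact hK.imp (fun h y hy => h _ rfl 1 (o _) y hy) (fun h y hy => h _ rfl 1 (o _) y hy)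
      refine hK'.imp (fun h x hx => ?_) (fun h x hx => ?_)
      all_goals
        have hx' := (hB x ((hbb x).1 hx)).1
        have h1 := h x hx'
        rw [E1 a l 1 x h1B hx', E1 a' r qi x hiB hx', one_mul] at h1
        exact h1
    · exact absurd rfl hD
    · have hB (x : ℍ[ℝ]) : x ∈ simpleBimod .quat B false := by
        cases B <;> trivial
      refine rotates_of_single b (· * qi) (fun x _ => (hbb _).2 (hB _))
        (fun x => by rw [mul_assoc, qi_mul_qi, mul_neg_one]) ?_
      have E1 (e : Q.E) (he : e = a ∨ e = a') (x p q : ℍ[ℝ]) :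
          φ x 1 (ten e p b q) = Q.arrEl e 1 * Q.arrEl b (x * (p * q)) := by
        rw [E e b he l' x p q 1 (t _) (t _) (hB _) (o _), mul_one, mul_assoc]
      -- The generators for sources `ℝ` and `ℂ` place the quaternion units in different tensor
      -- factors. Once everything is moved into the factor of `b` they agree.
      have hK' : (∀ x, Q.arrEl a 1 * Q.arrEl b x + Q.arrEl a' 1 * Q.arrEl b (x * qi) ∈ K) ∨
          ∀ x, Q.arrEl a 1 * Q.arrEl b (x * qj) + Q.arrEl a' 1 * Q.arrEl b (x * qk) ∈ K := by
        cases B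
        · refine hK.imp (fun h x => ?_) (fun h x => ?_)
          all_goals
            have h1 := h _ rfl x (t _) 1 (o _)
            rw [map_add, E1 a l, E1 a' r, one_mul, one_mul] at h1
            simpa only [mul_one] using h1
        · refine hK.imp (fun h x => ?_) (fun h x => ?_)
          all_goals
            have h1 := h _ rfl x (t _) 1 (o _)
            rw [map_add, E1 a l, E1 a' r, mul_one, mul_one] at h1
            simpa only [mul_one] using h1
        · exact absurd rfl hBD
      refine hK'.imp (fun h x hx => h x) (fun h x hx => ?_)
      have h1 := h (-(x * qj))
      rw [neg_mul_qj_mul_qj, neg_mul_qj_mul_qk, arrEl_neg, T_mul_neg, ← sub_eq_add_neg] at h1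
      exact h1

end RotationsOfGens

end ModQuiver

/-- A path of length `3` is a product of three arrows. -/
theorem FinQuiver.IsPath.eq_arrow_mul_mul {k : Type} [Field k] {Q : FinQuiver} {i j : Q.V}
    {x : Q.PathAlg k} (h : IsPath 3 i j x) :
    ∃ a b c, Q.s c = i ∧ Q.t c = Q.s b ∧ Q.t b = Q.s a ∧ Q.t a = j ∧
      x = arrow k Q a * arrow k Q b * arrow k Q c := by
  cases h with
  | cons a h =>
    obtain ⟨b, c, h1, h2, h3, h4⟩ := h.eq_arrow_mul
    exact ⟨a, b, c, h1, h2, h3, rfl, by rw [h4, mul_assoc]⟩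

theorem one_mem_simpleBimod (t s : DivAlg) : 1 ∈ simpleBimod t s false := by
  cases t <;> cases s <;>
    first
      | exact Submodule.mem_top
      | exact one_mem DivAlg.real.toSub
      | exact one_mem DivAlg.cpx.toSub

/-- The centre of `ℝ` and of `ℍ` is `ℝ`. For `ℍ`, commuting with `qi` and `qj` is enough. -/
theorem exists_eq_coe_of_commute {D : DivAlg} (hD : D ≠ .cpx) {q : ℍ[ℝ]} (hq : q ∈ D.toSub)
    (h : ∀ d ∈ D.toSub, d * q = q * d) : ∃ r : ℝ, q = algebraMap ℝ ℍ[ℝ] r := by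
  cases D
  · obtain ⟨r, hr⟩ := Algebra.mem_bot.1 hq
    exact ⟨r, hr.symm⟩
  · exact absurd rfl hD
  · have h1 := h qi trivial
    have h2 := h qj trivial
    have e1 : qj.re = 0 := rfl
    have e2 : qj.imI = 0 := rfl
    have e3 : qj.imJ = 1 := rfl
    have e4 : qj.imK = 0 := rfl
    have f1 : qi.re = 0 := rfl
    have f2 : qi.imI = 1 := rfl
    have f3 : qi.imJ = 0 := rfl
    have f4 : qi.imK = 0 := rfl
    have g1 := congrArg QuaternionAlgebra.imK h1
    have g2 := congrArg QuaternionAlgebra.imJ h1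
    have g3 := congrArg QuaternionAlgebra.imK h2
    rw [Quaternion.imK_mul, Quaternion.imK_mul] at g1 g3
    rw [Quaternion.imJ_mul, Quaternion.imJ_mul] at g2
    simp only [e1, e2, e3, e4, f1, f2, f3, f4] at g1 g2 g3
    obtain ⟨r, hr⟩ := Algebra.mem_bot.1 ((mem_real_iff q).2
      ⟨by linarith, by linarith, by linarith⟩ : q ∈ (⊥ : Subalgebra ℝ ℍ[ℝ]))
    exact ⟨r, hr.symm⟩

namespace ModQuiver

/-! ### A criterion for admissibility in terms of pairs of parallel arrows. -/

section Admissible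

variable {Q : ModQuiver} {I : TwoSidedIdeal Q.T}

/-- A nonzero element generates the simple bimodule of its arrow. -/
theorem arr_mem_of_ne_zero {e : Q.E} (htw : Q.tw e = false) {m : Q.bimod e} (hm : m ≠ 0)
    (h : Q.arr e m ∈ I) (n : Q.bimod e) : Q.arr e n ∈ I := by
  obtain ⟨d, hd, d', hd', e1⟩ := exists_eq_mul_mul _ _ htw (fun h0 => hm (Subtype.ext h0)) m.2 n.2
  have e2 : Q.arr e n = Q.vertEl (Q.t e) d * Q.arr e m * Q.vertEl (Q.s e) d' := by
    rw [← arrEl_coe Q e m, vertEl_mul_arrEl Q hd m.2,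
      arrEl_mul_vertEl Q (left_mul_mem _ _ _ hd m.2) hd', ← e1, arrEl_coe]
  rw [e2]
  exact I.mul_mem_right _ _ (I.mul_mem_left _ _ h)

/-- A nonzero subbimodule of `D ⊕ D` contains a nonzero real combination of the two generators, so
real combinations suffice to test that it vanishes. If the first component of an element is nonzero,
the element can be normalized to `1 + q`, and `q` turns out to be central. -/
theorem eq_zero_of_arr_add_arr_mem {b b' : Q.E} {D : DivAlg} (hD : D ≠ .cpx)
    (ht : Q.M (Q.t b) = D) (hs : Q.M (Q.s b) = D) (hst : Q.s b' = Q.s b) (htt : Q.t b' = Q.t b)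
    (h : ∀ r s : ℝ, r • Q.arrEl b 1 + s • Q.arrEl b' 1 ∈ I → r = 0 ∧ s = 0)
    {m : Q.bimod b} {n : Q.bimod b'} (hmn : Q.arr b m + Q.arr b' n ∈ I) : m = 0 ∧ n = 0 := by
  have hb (x : ℍ[ℝ]) := mem_bimod_self (x := x) hD ht hs
  have hb' (x : ℍ[ℝ]) := mem_bimod_self (x := x) hD (htt ▸ ht) (hst ▸ hs)
  have key' : ∀ x ∈ D.toSub, Q.arrEl b' x ∈ I → x = 0 := by
    intro x hx hI
    by_contra hx0
    have h1 := I.mul_mem_right _ (Q.vertEl (Q.s b') x⁻¹) hI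
    rw [arrEl_mul_vertEl Q ((hb' x).2 hx) (by rw [hst, hs]; exact D.inv_mem hx),
      mul_inv_cancel₀ hx0] at h1
    refine one_ne_zero (h 0 1 ?_).2
    rw [zero_smul, one_smul, zero_add]
    exact h1
  have hm : m = 0 := by
    by_contra hm0
    replace hm0 : (m : ℍ[ℝ]) ≠ 0 := fun h0 => hm0 (Subtype.ext h0)
    have hmD := (hb _).1 m.2
    have hnD := (hb' _).1 n.2
    have hq : (n * (m : ℍ[ℝ])⁻¹ : ℍ[ℝ]) ∈ D.toSub := mul_mem hnD (D.inv_mem hmD)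
    have h1 := I.mul_mem_right _ (Q.vertEl (Q.s b) (m : ℍ[ℝ])⁻¹) hmn
    rw [← arrEl_coe, ← arrEl_coe, add_mul,
      arrEl_mul_vertEl Q m.2 (by rw [hs]; exact D.inv_mem hmD), ← hst,
      arrEl_mul_vertEl Q n.2 (by rw [hst, hs]; exact D.inv_mem hmD), mul_inv_cancel₀ hm0] at h1
    generalize (n * (m : ℍ[ℝ])⁻¹ : ℍ[ℝ]) = q at hq h1
    -- Left and right multiplication by `d` agree on the first component, so the difference is the
    -- element `d q - q d` of the second bimodule. It lies in `I` and vanishes by `key'`.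
    have hcomm : ∀ d ∈ D.toSub, d * q = q * d := by
      intro d hd
      have h2 := I.mul_mem_left (Q.vertEl (Q.t b) d) _ h1
      have h3 := I.mul_mem_right _ (Q.vertEl (Q.s b) d) h1
      have hdt : d ∈ (Q.M (Q.t b)).toSub := ht.symm ▸ hd
      have hds : d ∈ (Q.M (Q.s b)).toSub := hs.symm ▸ hd
      rw [mul_add, vertEl_mul_arrEl Q hdt ((hb _).2 (one_mem _)), ← htt,
        vertEl_mul_arrEl Q (htt.symm ▸ hdt) ((hb' _).2 hq), mul_one] at h2
      rw [add_mul, arrEl_mul_vertEl Q ((hb _).2 (one_mem _)) hds, ← hst,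
        arrEl_mul_vertEl Q ((hb' _).2 hq) (hst.symm ▸ hds), one_mul] at h3
      have h4 := I.sub_mem h2 h3
      rw [add_sub_add_left_eq_sub, sub_eq_add_neg, ← arrEl_neg, ← arrEl_add
        ((hb' _).2 (mul_mem hd hq)) (neg_mem ((hb' _).2 (mul_mem hq hd))), ← sub_eq_add_neg] at h4
      exact sub_eq_zero.1 (key' _ (sub_mem (mul_mem hd hq) (mul_mem hq hd)) h4)
    obtain ⟨r, rfl⟩ := exists_eq_coe_of_commute hD hq hcomm
    refine one_ne_zero (h 1 r ?_).1
    have e : Q.arrEl b' (algebraMap ℝ ℍ[ℝ] r) = r • Q.arrEl b' 1 := by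
      rw [arrEl_of_mem Q ((hb' _).2 hq), arrEl_of_mem Q ((hb' 1).2 (one_mem _)), ← arr_smul]
      congr 1
      exact Subtype.ext (Algebra.algebraMap_eq_smul_one r)
    rw [one_smul, ← e]
    exact h1
  refine ⟨hm, ?_⟩
  rw [hm, arr_zero, zero_add, ← arrEl_coe] at hmn
  exact Subtype.ext (key' _ ((hb' _).1 n.2) hmn)

/-- An ideal is admissible if it meets the span of any two parallel arrows trivially, in a quiver
without triples of parallel arrows. -/
theorem IsLevel.le_arrowIdealSq_of_pairs {ρ : Q.V → ℕ} (hρ : Q.IsLevel ρ)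
    (htw : ∀ e, Q.tw e = false) (hinc : ∀ i, ∃ e, Q.s e = i ∨ Q.t e = i)
    (H : ∀ e, ((∀ f, Q.s f = Q.s e → Q.t f = Q.t e → f = e) ∧ ∀ m, Q.arr e m ∈ I → m = 0) ∨
      ∃ e', e ≠ e' ∧ (∀ f, Q.s f = Q.s e → Q.t f = Q.t e → f = e ∨ f = e') ∧
        ∀ m n, Q.arr e m + Q.arr e' n ∈ I → m = 0) : I ≤ Q.arrowIdealSq := by
  refine hρ.le_arrowIdealSq ?_ ?_
  · intro i d hd
    by_contra hd0
    replace hd0 : (d : ℍ[ℝ]) ≠ 0 := fun h0 => hd0 (Subtype.ext h0)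
    -- A nonzero element of a division algebra is invertible, so the idempotent of the vertex would
    -- lie in `I`, and with it the bimodule of an arrow at this vertex.
    have h1 : Q.vert i 1 ∈ I := by
      have h2 := I.mul_mem_right _ (Q.vert i ⟨_, (Q.M i).inv_mem d.2⟩) hd
      rw [vert_mul] at h2
      have e : d * ⟨_, (Q.M i).inv_mem d.2⟩ = 1 := Subtype.ext (mul_inv_cancel₀ hd0)
      rwa [e] at h2
    obtain ⟨e, he⟩ := hinc i
    have h2 (m : Q.bimod e) : Q.arr e m ∈ I := by
      rcases he with rfl | rfl
      · rw [← arr_mul_vert_one]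
        exact I.mul_mem_left _ _ h1
      · rw [← vert_one_mul_arr]
        exact I.mul_mem_right _ _ h1
    have h3 (m : Q.bimod e) : m = 0 := by
      rcases H e with ⟨-, h⟩ | ⟨e', -, -, h⟩
      · exact h m (h2 m)
      · exact h m 0 (by rw [arr_zero, add_zero]; exact h2 m)
    have h4 : 1 ∈ Q.bimod e := (mem_bimod_iff rfl rfl (htw e) 1).2 (one_mem_simpleBimod _ _)
    exact one_ne_zero (congrArg Subtype.val (h3 ⟨1, h4⟩))
  · intro i j m hm hI e
    by_cases he : Q.s e = i ∧ Q.t e = j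
    · obtain ⟨rfl, rfl⟩ := he
      rcases H e with ⟨h, h'⟩ | ⟨e', hne, h, h'⟩
      · rw [Fintype.sum_eq_single e fun f hf => by
          rw [hm f fun hf' => hf (h f hf'.1 hf'.2), arr_zero]] at hI
        exact h' _ hI
      · rw [Fintype.sum_eq_add e e' hne fun f hf => by
          rw [hm f fun hf' => (h f hf'.1 hf'.2).elim hf.1 hf.2, arr_zero]] at hI
        exact h' _ _ hI
    · exact hm e he

end Admissible

end ModQuiver

namespace ModQuiver

/-! ### Consequences of special gentleness. -/

section SpeciallyGentle

variable {Q : ModQuiver} {I : TwoSidedIdeal Q.T} {v : Q.V} {a a' b b' : Q.E}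

/-- An ideal of `T(Q, M)`, as a real subspace. -/
def idealSubmodule (I : TwoSidedIdeal Q.T) : Submodule ℝ Q.T where
  carrier := {x | x ∈ I}
  add_mem' := I.add_mem
  zero_mem' := I.zero_mem
  smul_mem' r _ h := smul_mem_ideal I r h

variable (I v a a' b b') in
/-- The arrows at a specially gentle vertex which is neither a source nor a sink. -/
structure SpecialArrows : Prop where
  ne_cpx : Q.M v ≠ .cpx
  out : OutSide v a a'
  inn : InSide v b b'
  xor : Xor
    (Includes I (bimodGen (Q.t a) (Q.s b) (gens0 (Q.M (Q.s b)) (Q.M v) (Q.M (Q.t a)) a a' b b')))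
    (Includes I (bimodGen (Q.t a) (Q.s b) (gens1 (Q.M (Q.s b)) (Q.M v) (Q.M (Q.t a)) a a' b b')))

theorem SpeciallyGentle.exists_specialArrows (h : SpeciallyGentle I v) (hin : ∃ e, Q.t e = v)
    (hout : ∃ e, Q.s e = v) : ∃ a a' b b', SpecialArrows I v a a' b b' := by
  obtain ⟨e, he⟩ := hin
  obtain ⟨f, hf⟩ := hout
  obtain ⟨h1, ⟨a, a', b, b', h2, h3, h4⟩ | ⟨h2, -⟩ | ⟨h2, -⟩ | ⟨h2, -⟩⟩ := h
  · exact ⟨a, a', b, b', h1, h2, h3, h4⟩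
  · exact absurd he (h2 e)
  · exact absurd hf (h2 f)
  · exact absurd he (h2 e)

/-- All that matters here about the generators is that they are combinations of paths through the
vertex. -/
theorem gens_mem {K : Submodule ℝ Q.T} (h : ∀ e f, e = a ∨ e = a' → f = b ∨ f = b' →
    ∀ x y, ten e x f y ∈ K) (Mu Mv Mw : DivAlg) :
    (∀ r ∈ gens0 Mu Mv Mw a a' b b', r ∈ K) ∧ ∀ r ∈ gens1 Mu Mv Mw a a' b b', r ∈ K := by
  have h1 := h a b (Or.inl rfl) (Or.inl rfl)
  have h2 := h a b' (Or.inl rfl) (Or.inr rfl)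
  have h3 := h a' b (Or.inr rfl) (Or.inl rfl)
  have h4 := h a' b' (Or.inr rfl) (Or.inr rfl)
  cases Mu <;> cases Mv <;> cases Mw <;>
    simp only [gens0, gens1, Set.mem_insert_iff, Set.mem_singleton_iff, forall_eq_or_imp,
      forall_eq, Set.mem_empty_iff_false, false_imp_iff, implies_true, and_self, K.add_mem,
      K.sub_mem, neg_mem, h1, h2, h3, h4]
  exact ⟨K.add_mem (K.add_mem (K.sub_mem (h1 _ _) (h4 _ _)) (h2 _ _)) (h3 _ _),
    K.add_mem (K.sub_mem (K.add_mem (h1 _ _) (h4 _ _)) (h2 _ _)) (h3 _ _)⟩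

theorem includes_bimodGen {w u : Q.V} {R : Set Q.T} (h : ∀ r ∈ R, r ∈ I) :
    Includes I (bimodGen w u R) := by
  have h1 : bimodGen w u R ≤ idealSubmodule I := by
    refine Submodule.span_le.2 ?_
    rintro _ ⟨r, hr, x, y, rfl⟩
    exact I.mul_mem_right _ _ (I.mul_mem_left _ _ (h r hr))
  exact h1

theorem Includes.vertEl_mul_mem {w u : Q.V} {R : Set Q.T} (h : Includes I (bimodGen w u R)) :
    ∀ r ∈ R, ∀ x ∈ (Q.M w).toSub, ∀ y ∈ (Q.M u).toSub, Q.vertEl w x * r * Q.vertEl u y ∈ I := by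
  intro r hr x hx y hy
  rw [vertEl_of_mem Q hx, vertEl_of_mem Q hy]
  exact h _ (Submodule.subset_span ⟨r, hr, _, _, rfl⟩)

namespace SpecialArrows

variable (h : SpecialArrows I v a a' b b')

include h

/-- The ideal does not contain all paths through a specially gentle vertex. -/
theorem exists_notMem : ¬ ∀ e f, Q.s e = v → Q.t f = v → ∀ m n, Q.arr e m * Q.arr f n ∈ I := by
  intro hall
  -- If all paths through `v` were in `I`, both complementary subbimodules would be included,
  -- against the exclusive alternative.
  have h1 := gens_mem (a := a) (a' := a') (b := b) (b' := b') (K := idealSubmodule I) (fun e f he hf x y => by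
    have := hall e f ((h.out.1 e).2 he) ((h.inn.1 f).2 hf)
    unfold ten arrEl
    split_ifs
    · exact this _ _
    · rw [mul_zero]
      exact I.zero_mem
    · rw [zero_mul]
      exact I.zero_mem
    · rw [zero_mul]
      exact I.zero_mem) (Q.M (Q.s b)) (Q.M v) (Q.M (Q.t a))
  rcases h.xor with ⟨-, h2⟩ | ⟨-, h2⟩
  · exact h2 (includes_bimodGen h1.2)
  · exact h2 (includes_bimodGen h1.1)

theorem s_left : Q.s a = v := (h.out.1 a).2 (Or.inl rfl)

theorem s_right : Q.s a' = v := (h.out.1 a').2 (Or.inr rfl)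

theorem t_left : Q.t b = v := (h.inn.1 b).2 (Or.inl rfl)

theorem t_right : Q.t b' = v := (h.inn.1 b').2 (Or.inr rfl)

/-- One of the two subbimodules lies in `I`. The rotation is stated modulo any subspace containing
`I`, because it will be used both for `I` and for an annihilator modulo `I`. -/
theorem rotates_in (htw : ∀ e, Q.tw e = false) (hu : Q.M (Q.s b) = Q.M v) {K : Submodule ℝ Q.T}
    (hK : ∀ x ∈ I, x ∈ K) :
    Rotates (LinearMap.mulRight ℝ (Q.arrEl b 1)) (LinearMap.mulRight ℝ (Q.arrEl b' 1))
      (arrSpan a a') K := by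
  refine ModQuiver.rotates_in h.s_left h.s_right h.out.2.1.symm h.t_left h.t_right h.inn.2.1.symm
    htw h.ne_cpx hu rfl rfl h.out.2.2 ?_
  have hx := h.xor.or
  rw [hu] at hx
  refine hx.imp (fun h1 r hr x hx y hy => ?_) (fun h1 r hr x hx y hy => ?_)
  · exact hK _ (h1.vertEl_mul_mem r hr x hx y (hu.symm ▸ hy))
  · exact hK _ (h1.vertEl_mul_mem r hr x hx y (hu.symm ▸ hy))

theorem rotates_out (htw : ∀ e, Q.tw e = false) (hw : Q.M (Q.t a) = Q.M v) {K : Submodule ℝ Q.T}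
    (hK : ∀ x ∈ I, x ∈ K) :
    Rotates (LinearMap.mulLeft ℝ (Q.arrEl a 1)) (LinearMap.mulLeft ℝ (Q.arrEl a' 1))
      (arrSpan b b') K := by
  refine ModQuiver.rotates_out h.s_left h.s_right h.out.2.1.symm h.t_left h.t_right h.inn.2.1.symm
    htw h.ne_cpx rfl rfl hw h.inn.2.2 ?_
  have hx := h.xor.or
  rw [hw] at hx
  refine hx.imp (fun h1 r hr x hx y hy => ?_) (fun h1 r hr x hx y hy => ?_)
  · exact hK _ (h1.vertEl_mul_mem r hr x (hw.symm ▸ hx) y hy)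
  · exact hK _ (h1.vertEl_mul_mem r hr x (hw.symm ▸ hx) y hy)

/-- If a subspace contains the products of the outgoing arrows with a combination of the ingoing
arrows, then it contains all paths through the vertex. -/
theorem arr_mul_arr_mem_in (htw : ∀ e, Q.tw e = false) (hu : Q.M (Q.s b) = Q.M v)
    {K : Submodule ℝ Q.T} (hK : ∀ x ∈ I, x ∈ K) {r s : ℝ} (hrs : ¬(r = 0 ∧ s = 0))
    (hrK : ∀ e m, Q.s e = v → r • (Q.arr e m * Q.arrEl b 1) + s • (Q.arr e m * Q.arrEl b' 1) ∈ K) :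
    ∀ e f, Q.s e = v → Q.t f = v → ∀ m n, Q.arr e m * Q.arr f n ∈ K := by
  have h1 := (h.rotates_in htw hu hK).mem hrs (by
    have hle : arrSpan a a' ≤ K.comap (r • LinearMap.mulRight ℝ (Q.arrEl b 1) +
        s • LinearMap.mulRight ℝ (Q.arrEl b' 1)) := by
      refine arrSpan_le (fun x hx => ?_) (fun x hx => ?_)
      · rw [arrEl_of_mem Q hx]
        exact hrK a _ h.s_left
      · rw [arrEl_of_mem Q hx]
        exact hrK a' _ h.s_right
    exact fun n hn => hle hn)
  intro e f he hf m n
  have htf : Q.M (Q.t f) = Q.M v := by rw [hf]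
  have hsf : Q.M (Q.s f) = Q.M v := by
    rcases (h.inn.1 f).1 hf with rfl | rfl
    · exact hu
    · rw [← h.inn.2.1, hu]
  -- The ingoing bimodule is regular, so every path through `v` is a value of one of the two rotated
  -- maps.
  have h2 : Q.arr e m * Q.arr f n = Q.arrEl e (m * n) * Q.arrEl f 1 := by
    rw [← ten_eq_left h.ne_cpx (he.trans hf.symm) htf hsf m.2
      ((mem_bimod_self h.ne_cpx htf hsf _).1 n.2)]
    unfold ten
    rw [arrEl_coe, arrEl_coe]
  have h3 : Q.arrEl e (m * n) ∈ arrSpan a a' := by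
    rcases (h.out.1 e).1 he with rfl | rfl
    · exact arrEl_mem_left _
    · exact arrEl_mem_right _
  rw [h2]
  rcases (h.inn.1 f).1 hf with rfl | rfl
  · exact (h1 _ h3).1
  · exact (h1 _ h3).2

theorem arr_mul_arr_mem_out (htw : ∀ e, Q.tw e = false) (hw : Q.M (Q.t a) = Q.M v)
    {K : Submodule ℝ Q.T} (hK : ∀ x ∈ I, x ∈ K) {r s : ℝ} (hrs : ¬(r = 0 ∧ s = 0))
    (hrK : ∀ f n, Q.t f = v → r • (Q.arrEl a 1 * Q.arr f n) + s • (Q.arrEl a' 1 * Q.arr f n) ∈ K) :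
    ∀ e f, Q.s e = v → Q.t f = v → ∀ m n, Q.arr e m * Q.arr f n ∈ K := by
  have h1 := (h.rotates_out htw hw hK).mem hrs (by
    have hle : arrSpan b b' ≤ K.comap (r • LinearMap.mulLeft ℝ (Q.arrEl a 1) +
        s • LinearMap.mulLeft ℝ (Q.arrEl a' 1)) := by
      refine arrSpan_le (fun x hx => ?_) (fun x hx => ?_)
      · rw [arrEl_of_mem Q hx]
        exact hrK b _ h.t_left
      · rw [arrEl_of_mem Q hx]
        exact hrK b' _ h.t_right
    exact fun n hn => hle hn)
  intro e f he hf m n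
  have hse : Q.M (Q.s e) = Q.M v := by rw [he]
  have hte : Q.M (Q.t e) = Q.M v := by
    rcases (h.out.1 e).1 he with rfl | rfl
    · exact hw
    · rw [← h.out.2.1, hw]
  have h2 : Q.arr e m * Q.arr f n = Q.arrEl e 1 * Q.arrEl f (m * n) := by
    rw [← ten_eq_right h.ne_cpx (he.trans hf.symm) hte hse
      ((mem_bimod_self h.ne_cpx hte hse _).1 m.2) n.2]
    unfold ten
    rw [arrEl_coe, arrEl_coe]
  have h3 : Q.arrEl f (m * n) ∈ arrSpan b b' := by
    rcases (h.inn.1 f).1 hf with rfl | rfl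
    · exact arrEl_mem_left _
    · exact arrEl_mem_right _
  rw [h2]
  rcases (h.out.1 e).1 he with rfl | rfl
  · exact (h1 _ h3).1
  · exact (h1 _ h3).2

/-- The ideal meets the span of the ingoing arrows trivially. -/
theorem pairs_in (htw : ∀ e, Q.tw e = false) {e : Q.E} (he : Q.t e = v) :
    ((∀ f, Q.s f = Q.s e → Q.t f = Q.t e → f = e) ∧ ∀ m, Q.arr e m ∈ I → m = 0) ∨
      ∃ e', e ≠ e' ∧ (∀ f, Q.s f = Q.s e → Q.t f = Q.t e → f = e ∨ f = e') ∧
        ∀ m n, Q.arr e m + Q.arr e' n ∈ I → m = 0 := by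
  have hIn := h.inn.1
  by_cases hu : Q.M (Q.s b) = Q.M v
  · right
    have hbb := h.inn.2.2.2 hu
    have h1 (m : Q.bimod b) (n : Q.bimod b') (hmn : Q.arr b m + Q.arr b' n ∈ I) :
        m = 0 ∧ n = 0 := by
      refine eq_zero_of_arr_add_arr_mem h.ne_cpx (by rw [h.t_left]) hu h.inn.2.1.symm
        (by rw [h.t_left, h.t_right]) ?_ hmn
      intro r s hrs
      by_contra hne
      -- A nontrivial real combination of the ingoing arrows in `I` would, after multiplication with
      -- the outgoing arrows and by the rotation, put all paths through `v` into `I`.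
      refine h.exists_notMem (h.arr_mul_arr_mem_in htw hu (K := idealSubmodule I)
        (fun x hx => hx) hne fun e m _ => ?_)
      have h2 := I.mul_mem_left (Q.arr e m) _ hrs
      rw [mul_add, mul_smul_comm, mul_smul_comm] at h2
      exact h2
    rcases (hIn e).1 he with rfl | rfl
    · exact ⟨b', hbb, fun f _ hf => (hIn f).1 (hf.trans he), fun m n hmn => (h1 m n hmn).1⟩
    · refine ⟨b, hbb.symm, fun f _ hf => ((hIn f).1 (hf.trans he)).symm, fun m n hmn => ?_⟩
      rw [add_comm] at hmn
      exact (h1 n m hmn).2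
  · left
    obtain rfl : b = b' := not_not.1 (h.inn.2.2.not.2 hu)
    obtain rfl : e = b := by simpa using (hIn e).1 he
    refine ⟨fun f _ hf => by simpa using (hIn f).1 (hf.trans he), fun m hm => ?_⟩
    by_contra hm0
    refine h.exists_notMem fun e' f _ hf _ n => I.mul_mem_left _ _ ?_
    obtain rfl : f = e := by simpa using (hIn f).1 hf
    exact arr_mem_of_ne_zero (htw f) hm0 hm n

/-- The ideal meets the span of the outgoing arrows trivially. -/
theorem pairs_out (htw : ∀ e, Q.tw e = false) {e : Q.E} (he : Q.s e = v) :
    ((∀ f, Q.s f = Q.s e → Q.t f = Q.t e → f = e) ∧ ∀ m, Q.arr e m ∈ I → m = 0) ∨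
      ∃ e', e ≠ e' ∧ (∀ f, Q.s f = Q.s e → Q.t f = Q.t e → f = e ∨ f = e') ∧
        ∀ m n, Q.arr e m + Q.arr e' n ∈ I → m = 0 := by
  have hOut := h.out.1
  by_cases hw : Q.M (Q.t a) = Q.M v
  · right
    have haa := h.out.2.2.2 hw
    have h1 (m : Q.bimod a) (n : Q.bimod a') (hmn : Q.arr a m + Q.arr a' n ∈ I) :
        m = 0 ∧ n = 0 := by
      refine eq_zero_of_arr_add_arr_mem h.ne_cpx hw (by rw [h.s_left])
        (by rw [h.s_left, h.s_right]) h.out.2.1.symm ?_ hmn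
      intro r s hrs
      by_contra hne
      refine h.exists_notMem (h.arr_mul_arr_mem_out htw hw (K := idealSubmodule I)
        (fun x hx => hx) hne fun e m _ => ?_)
      have h2 := I.mul_mem_right _ (Q.arr e m) hrs
      rw [add_mul, smul_mul_assoc, smul_mul_assoc] at h2
      exact h2
    rcases (hOut e).1 he with rfl | rfl
    · exact ⟨a', haa, fun f hf _ => (hOut f).1 (hf.trans he), fun m n hmn => (h1 m n hmn).1⟩
    · refine ⟨a, haa.symm, fun f hf _ => ((hOut f).1 (hf.trans he)).symm, fun m n hmn => ?_⟩
      rw [add_comm] at hmn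
      exact (h1 n m hmn).2
  · left
    obtain rfl : a = a' := not_not.1 (h.out.2.2.not.2 hw)
    obtain rfl : e = a := by simpa using (hOut e).1 he
    refine ⟨fun f hf _ => by simpa using (hOut f).1 (hf.trans he), fun m hm => ?_⟩
    by_contra hm0
    refine h.exists_notMem fun f e' hf _ n _ => I.mul_mem_right _ _ ?_
    obtain rfl : f = e := by simpa using (hOut f).1 hf
    exact arr_mem_of_ne_zero (htw f) hm0 hm n

/-- The arrows at `v` are controlled by `pairs_in` and `pairs_out`. The remaining arrow `c` has a
simple bimodule that is not contained in `I`. -/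
theorem le_arrowIdealSq {ρ : Q.V → ℕ} (hρ : Q.IsLevel ρ) (htw : ∀ e, Q.tw e = false)
    (hinc : ∀ i, ∃ e, Q.s e = i ∨ Q.t e = i) {c : Q.E}
    (hE : ∀ e, Q.s e = v ∨ Q.t e = v ∨ e = c) (hcc : ∀ f, Q.s f = Q.s c → Q.t f = Q.t c → f = c)
    (hc : ¬ ∀ m, Q.arr c m ∈ I) : I ≤ Q.arrowIdealSq := by
  refine hρ.le_arrowIdealSq_of_pairs htw hinc fun e => ?_
  rcases hE e with he | he | rfl
  · exact h.pairs_out htw he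
  · exact h.pairs_in htw he
  · refine Or.inl ⟨hcc, fun m hm => ?_⟩
    by_contra hm0
    exact hc (arr_mem_of_ne_zero (htw e) hm0 hm)

/-- The outgoing arrows have two fibers. -/
theorem exists_fibers_out : ∃ p p' : Q.Gam.E, p ≠ p' ∧ Q.s p.1.1 = v ∧ Q.s p'.1.1 = v := by
  -- There are two parallel arrows with one fiber each, or a single arrow with two fibers.
  by_cases hw : Q.M (Q.t a) = Q.M v
  · refine ⟨fiberFalse a, fiberFalse a', fun he => h.out.2.2.2 hw ?_, h.s_left, h.s_right⟩
    exact congrArg (fun p : Q.GE => p.1.1) he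
  · refine ⟨fiberFalse a, fiberTrue a (by rwa [h.s_left]), fun he => ?_, h.s_left, h.s_left⟩
    exact Bool.noConfusion (congrArg (fun p : Q.GE => p.1.2) he)

/-- The ingoing arrows have two fibers. -/
theorem exists_fibers_in : ∃ p p' : Q.Gam.E, p ≠ p' ∧ Q.t p.1.1 = v ∧ Q.t p'.1.1 = v := by
  by_cases hu : Q.M (Q.s b) = Q.M v
  · refine ⟨fiberFalse b, fiberFalse b', fun he => h.inn.2.2.2 hu ?_, h.t_left, h.t_right⟩
    exact congrArg (fun p : Q.GE => p.1.1) he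
  · refine ⟨fiberFalse b, fiberTrue b (by rw [h.t_left]; exact Ne.symm hu), fun he => ?_, h.t_left,
      h.t_left⟩
    exact Bool.noConfusion (congrArg (fun p : Q.GE => p.1.2) he)

end SpecialArrows

end SpeciallyGentle

end ModQuiver

namespace ModQuiver

/-! ### An ordinarily gentle vertex next to a specially gentle one. -/

section Glue

variable {Q : ModQuiver} {I : TwoSidedIdeal Q.T}

theorem OrdinarilyGentle.conditions {u : Q.V} (h : OrdinarilyGentle I u) :
    OrdGentleConditions I u := by
  rcases h with h | h | h
  · exact h.2.2
  · exact h.2.2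
  · exact h.2.1

theorem includes_pathBimod {a b : Q.E} (h : ∀ m n, Q.arr a m * Q.arr b n ∈ I) :
    Includes I (pathBimod a b) := by
  have h1 : pathBimod a b ≤ idealSubmodule I := by
    refine Submodule.span_le.2 ?_
    rintro _ ⟨m, n, rfl⟩
    exact h m n
  exact h1

theorem arrEl_mul_arr_mem {a b : Q.E} (h : Includes I (pathBimod a b)) (x : ℍ[ℝ])
    (n : Q.bimod b) : Q.arrEl a x * Q.arr b n ∈ I := by
  unfold arrEl
  split_ifs
  · exact h _ (Submodule.subset_span ⟨_, _, rfl⟩)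
  · rw [zero_mul]
    exact I.zero_mem

theorem arr_mul_arrEl_mem {a b : Q.E} (h : Includes I (pathBimod a b)) (m : Q.bimod a)
    (x : ℍ[ℝ]) : Q.arr a m * Q.arrEl b x ∈ I := by
  unfold arrEl
  split_ifs
  · exact h _ (Submodule.subset_span ⟨_, _, rfl⟩)
  · rw [mul_zero]
    exact I.zero_mem

/-- The elements whose products with the bimodule of `c` on the right lie in `I`. -/
def leftAnnihilator (I : TwoSidedIdeal Q.T) (c : Q.E) : Submodule ℝ Q.T :=
  ⨅ m, (idealSubmodule I).comap (LinearMap.mulRight ℝ (Q.arr c m))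

/-- The elements whose products with the bimodule of `c` on the left lie in `I`. -/
def rightAnnihilator (I : TwoSidedIdeal Q.T) (c : Q.E) : Submodule ℝ Q.T :=
  ⨅ m, (idealSubmodule I).comap (LinearMap.mulLeft ℝ (Q.arr c m))

theorem mem_leftAnnihilator {c : Q.E} {x : Q.T} :
    x ∈ leftAnnihilator I c ↔ ∀ m, x * Q.arr c m ∈ I := Submodule.mem_iInf _

theorem mem_rightAnnihilator {c : Q.E} {x : Q.T} :
    x ∈ rightAnnihilator I c ↔ ∀ m, Q.arr c m * x ∈ I := Submodule.mem_iInf _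

variable {u v : Q.V} {c : Q.E} {ρ : Q.V → ℕ}

/-- A specially gentle vertex `v` cannot follow an ordinarily gentle vertex `u` with one ingoing
arrow `c`. -/
theorem not_isLocallyGentle_glue_out (hρ : Q.IsLevel ρ) (htw : ∀ e, Q.tw e = false)
    (hinc : ∀ i, ∃ e, Q.s e = i ∨ Q.t e = i) (hE : ∀ e, Q.s e = v ∨ Q.t e = v ∨ e = c)
    (hcc : ∀ f, Q.s f = Q.s c → f = c) (hct : Q.t c = u) (huv : ∀ f, Q.s f = u ↔ Q.t f = v)
    (hin : ∃ e, Q.t e = v) (hout : ∃ e, Q.s e = v) (hM : Q.M u = Q.M v)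
    (hu : OrdinarilyGentle I u) (hv : SpeciallyGentle I v) :
    ¬ IsLocallyGentle ℂ (Complexification I) := by
  obtain ⟨a, a', b, b', h⟩ := hv.exists_specialArrows hin hout
  have hsb : Q.s b = u := (huv b).2 h.t_left
  have hsb' : Q.s b' = u := (huv b').2 h.t_right
  have hMb : Q.M (Q.s b) = Q.M v := by rw [hsb, hM]
  have hbb : b ≠ b' := h.inn.2.2.2 hMb
  have hx := hu.conditions.xor_out c b b' hct hsb hsb' hbb
  -- Otherwise both products at `u` would lie in `I`. This is the part of admissibility that special
  -- gentleness of `v` does not give.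
  have hc : ¬ ∀ m, Q.arr c m ∈ I := by
    intro hall
    have h1 (e : Q.E) : Includes I (pathBimod e c) :=
      includes_pathBimod fun m n => I.mul_mem_left _ _ (hall n)
    rcases hx with ⟨-, h2⟩ | ⟨-, h2⟩
    · exact h2 (h1 b')
    · exact h2 (h1 b)
  have hI := h.le_arrowIdealSq hρ htw hinc hE (fun f hf _ => hcc f hf) hc
  have hK (x : Q.T) (hx : x ∈ I) : x ∈ leftAnnihilator I c :=
    mem_leftAnnihilator.2 fun m => I.mul_mem_right _ _ hx
  -- Modulo the annihilator of `c`, the paths through `v` along one of `b, b'` vanish by gentleness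
  -- of `u`. This is the real combination `(1, 0)` or `(0, 1)`, and the rotation extends the
  -- vanishing to the other arrow.
  have hmem : ∀ e f, Q.s e = v → Q.t f = v → ∀ m n, Q.arr e m * Q.arr f n ∈ leftAnnihilator I c := by
    rcases hx.or with h1 | h1
    · refine h.arr_mul_arr_mem_in htw hMb hK (r := 1) (s := 0) (by simp) fun e m _ => ?_
      rw [one_smul, zero_smul, add_zero, mem_leftAnnihilator]
      intro n
      rw [mul_assoc]
      exact I.mul_mem_left _ _ (arrEl_mul_arr_mem h1 1 n)
    · refine h.arr_mul_arr_mem_in htw hMb hK (r := 0) (s := 1) (by simp) fun e m _ => ?_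
      rw [one_smul, zero_smul, zero_add, mem_leftAnnihilator]
      intro n
      rw [mul_assoc]
      exact I.mul_mem_left _ _ (arrEl_mul_arr_mem h1 1 n)
  obtain ⟨p, p', hpp, hp, hp'⟩ := h.exists_fibers_out
  have hG (q r : Q.Gam.E) (hq : Q.s q.1.1 = v) (hr : Q.t r.1.1 = v) : Q.Gam.s q = Q.Gam.t r :=
    gs_fiber_eq_gt_fiber (hq.trans hr.symm) (by rw [hq]; exact h.ne_cpx)
  have hGc (q : Q.Gam.E) (hq : Q.s q.1.1 = u) : Q.Gam.s q = Q.Gam.t (fiberFalse c) :=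
    gs_fiber_eq_gt_fiber (hq.trans hct.symm) (by rw [hq, hM]; exact h.ne_cpx)
  have hb : Q.t (fiberFalse b).1.1 = v := h.t_left
  have hb' : Q.t (fiberFalse b').1.1 = v := h.t_right
  refine (isGradedPresentation_idealJ hρ hI).not_isLocallyGentle_glue_out (a := p) (a' := p')
    (b := fiberFalse b) (b' := fiberFalse b') (c := fiberFalse c) hpp
    (fun he => hbb (congrArg (fun p : Q.GE => p.1.1) he)) (hGc _ hsb) (hGc _ hsb')
    ((hG p _ hp hb').symm.trans (hG p _ hp hb)) (hG p _ hp hb) (hG p' _ hp' hb) ?_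
  intro d hd x hx
  have hds : Q.s d.1.1 = v := (congrArg (fun w : Q.GV => w.1.1) hd).trans h.t_left
  have hn : ρ (Q.t d.1.1) = ρ (Q.s c) + 3 := by
    rw [hρ, hds, ← h.t_left, hρ, hsb, ← hct, hρ]
  -- The component consists of combinations of paths of length three, each of which starts with a
  -- fiber of `c` and then passes through `v`.
  have hspan := hρ.gam.mem_span (idealJ I) (i := Q.Gam.s (fiberFalse c)) (j := Q.Gam.t d) hn hx
  refine (Submodule.mem_bot ℂ).1 (Submodule.span_le.2 ?_ hspan)
  rintro _ ⟨y, hy, rfl⟩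
  obtain ⟨q₁, q₂, q₃, h3, h32, h21, -, rfl⟩ := FinQuiver.IsPath.eq_arrow_mul_mul hy
  obtain rfl : q₃.1.1 = c := hcc _ (congrArg (fun w : Q.GV => w.1.1) h3)
  have e2 : Q.t q₂.1.1 = v :=
    (huv _).1 ((congrArg (fun w : Q.GV => w.1.1) h32).symm.trans hct)
  have e1 : Q.s q₁.1.1 = v := (congrArg (fun w : Q.GV => w.1.1) h21).symm.trans e2
  exact quotMk_eq_zero.2 (arrow_mul_arrow_mul_arrow_mem _ _ _ fun l m n =>
    mem_leftAnnihilator.1 (hmem _ _ e1 e2 l m) n)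

/-- A specially gentle vertex `v` cannot precede an ordinarily gentle vertex `u` with one outgoing
arrow `c`. -/
theorem not_isLocallyGentle_glue_in (hρ : Q.IsLevel ρ) (htw : ∀ e, Q.tw e = false)
    (hinc : ∀ i, ∃ e, Q.s e = i ∨ Q.t e = i) (hE : ∀ e, Q.s e = v ∨ Q.t e = v ∨ e = c)
    (hcc : ∀ f, Q.t f = Q.t c → f = c) (hcs : Q.s c = u) (huv : ∀ f, Q.t f = u ↔ Q.s f = v)
    (hin : ∃ e, Q.t e = v) (hout : ∃ e, Q.s e = v) (hM : Q.M u = Q.M v)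
    (hu : OrdinarilyGentle I u) (hv : SpeciallyGentle I v) :
    ¬ IsLocallyGentle ℂ (Complexification I) := by
  obtain ⟨a, a', b, b', h⟩ := hv.exists_specialArrows hin hout
  have hta : Q.t a = u := (huv a).2 h.s_left
  have hta' : Q.t a' = u := (huv a').2 h.s_right
  have hMa : Q.M (Q.t a) = Q.M v := by rw [hta, hM]
  have haa : a ≠ a' := h.out.2.2.2 hMa
  have hx := hu.conditions.xor_in c a a' hcs hta hta' haa
  have hc : ¬ ∀ m, Q.arr c m ∈ I := by
    intro hall
    have h1 (e : Q.E) : Includes I (pathBimod c e) :=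
      includes_pathBimod fun m n => I.mul_mem_right _ _ (hall m)
    rcases hx with ⟨-, h2⟩ | ⟨-, h2⟩
    · exact h2 (h1 a')
    · exact h2 (h1 a)
  have hI := h.le_arrowIdealSq hρ htw hinc hE (fun f _ hf => hcc f hf) hc
  -- In the mirror image `c` leaves `u`, so the vanishing is tested by multiplication with `M c`
  -- from the left.
  have hK (x : Q.T) (hx : x ∈ I) : x ∈ rightAnnihilator I c :=
    mem_rightAnnihilator.2 fun m => I.mul_mem_left _ _ hx
  have hmem : ∀ e f, Q.s e = v → Q.t f = v →
      ∀ m n, Q.arr e m * Q.arr f n ∈ rightAnnihilator I c := by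
    rcases hx.or with h1 | h1
    · refine h.arr_mul_arr_mem_out htw hMa hK (r := 1) (s := 0) (by simp) fun e n _ => ?_
      rw [one_smul, zero_smul, add_zero, mem_rightAnnihilator]
      intro m
      rw [← mul_assoc]
      exact I.mul_mem_right _ _ (arr_mul_arrEl_mem h1 m 1)
    · refine h.arr_mul_arr_mem_out htw hMa hK (r := 0) (s := 1) (by simp) fun e n _ => ?_
      rw [one_smul, zero_smul, zero_add, mem_rightAnnihilator]
      intro m
      rw [← mul_assoc]
      exact I.mul_mem_right _ _ (arr_mul_arrEl_mem h1 m 1)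
  obtain ⟨p, p', hpp, hp, hp'⟩ := h.exists_fibers_in
  have hG (q r : Q.Gam.E) (hq : Q.s q.1.1 = v) (hr : Q.t r.1.1 = v) : Q.Gam.s q = Q.Gam.t r :=
    gs_fiber_eq_gt_fiber (hq.trans hr.symm) (by rw [hq]; exact h.ne_cpx)
  have hGc (q : Q.Gam.E) (hq : Q.t q.1.1 = u) : Q.Gam.t q = Q.Gam.s (fiberFalse c) :=
    (gs_fiber_eq_gt_fiber (p := fiberFalse c) (hcs.trans hq.symm)
      (by change Q.M (Q.s c) ≠ _; rw [hcs, hM]; exact h.ne_cpx)).symm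
  have ha : Q.s (fiberFalse a).1.1 = v := h.s_left
  have ha' : Q.s (fiberFalse a').1.1 = v := h.s_right
  refine (isGradedPresentation_idealJ hρ hI).not_isLocallyGentle_glue_in (a := p) (a' := p')
    (b := fiberFalse a) (b' := fiberFalse a') (c := fiberFalse c) hpp
    (fun he => haa (congrArg (fun p : Q.GE => p.1.1) he)) (hGc _ hta) (hGc _ hta')
    ((hG _ p ha' hp).trans (hG _ p ha hp).symm) (hG _ p ha hp).symm (hG _ p' ha hp').symm ?_
  intro d hd x hx
  have hdt : Q.t d.1.1 = v := (congrArg (fun w : Q.GV => w.1.1) hd).trans h.s_left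
  have hn : ρ (Q.t c) = ρ (Q.s d.1.1) + 3 := by
    rw [hρ, hcs, ← hta, hρ, h.s_left, ← hdt, hρ]
  have hspan := hρ.gam.mem_span (idealJ I) (i := Q.Gam.s d) (j := Q.Gam.t (fiberFalse c)) hn hx
  refine (Submodule.mem_bot ℂ).1 (Submodule.span_le.2 ?_ hspan)
  rintro _ ⟨y, hy, rfl⟩
  obtain ⟨q₁, q₂, q₃, -, h32, h21, h1, rfl⟩ := FinQuiver.IsPath.eq_arrow_mul_mul hy
  obtain rfl : q₁.1.1 = c := hcc _ (congrArg (fun w : Q.GV => w.1.1) h1)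
  have e2 : Q.s q₂.1.1 = v := (huv _).1 ((congrArg (fun w : Q.GV => w.1.1) h21).trans hcs)
  have e1 : Q.t q₃.1.1 = v := (congrArg (fun w : Q.GV => w.1.1) h32).trans e2
  exact quotMk_eq_zero.2 (arrow_mul_arrow_mul_arrow_mem _ _ _ fun l m n => by
    rw [mul_assoc]
    exact mem_rightAnnihilator.1 (hmem _ _ e2 e1 m n) l)

end Glue

theorem not_isGentle_glueQuiver (D B : DivAlg) :
    (∀ I : TwoSidedIdeal (glueQuiver D B).T, OrdinarilyGentle I (1 : Fin 4) →
      SpeciallyGentle I (2 : Fin 4) → ¬ IsGentle ℂ (Complexification I)) ∧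
    ∀ I : TwoSidedIdeal (glueQuiver D B).op.T,
      OrdinarilyGentle (Q := (glueQuiver D B).op) I (1 : Fin 4) →
      SpeciallyGentle (Q := (glueQuiver D B).op) I (2 : Fin 4) →
        ¬ IsGentle ℂ (Complexification I) := by
  constructor
  · intro I hu hv h
    refine not_isLocallyGentle_glue_out (Q := glueQuiver D B) (ρ := ![0, 1, 2, 3])
      (c := (0 : Fin 4)) ?_ (fun _ => rfl) ?_ ?_ ?_ rfl ?_ ⟨(1 : Fin 4), rfl⟩ ⟨(3 : Fin 4), rfl⟩ rfl
      hu hv h.1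
    · intro a
      change Fin 4 at a
      fin_cases a <;> rfl
    · change ∀ i : Fin 4, ∃ e : Fin 4, (![0, 1, 1, 2] : Fin 4 → Fin 4) e = i ∨
        (![1, 2, 2, 3] : Fin 4 → Fin 4) e = i
      decide
    · change ∀ e : Fin 4, (![0, 1, 1, 2] : Fin 4 → Fin 4) e = 2 ∨
        (![1, 2, 2, 3] : Fin 4 → Fin 4) e = 2 ∨ e = 0
      decide
    · change ∀ e : Fin 4, (![0, 1, 1, 2] : Fin 4 → Fin 4) e = 0 → e = 0
      decide
    · change ∀ e : Fin 4, (![0, 1, 1, 2] : Fin 4 → Fin 4) e = 1 ↔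
        (![1, 2, 2, 3] : Fin 4 → Fin 4) e = 2
      decide
  · intro I hu hv h
    -- Vertices and arrows keep their names in the opposite quiver: the levels are reversed, and `c`
    -- is still the arrow `0`, now leaving `u = 1`.
    refine not_isLocallyGentle_glue_in (Q := (glueQuiver D B).op) (ρ := ![3, 2, 1, 0])
      (c := (0 : Fin 4)) ?_ (fun _ => rfl) ?_ ?_ ?_ rfl ?_ ⟨(3 : Fin 4), rfl⟩ ⟨(1 : Fin 4), rfl⟩ rfl
      hu hv h.1
    · intro a
      change Fin 4 at a
      fin_cases a <;> rfl
    · change ∀ i : Fin 4, ∃ e : Fin 4, (![1, 2, 2, 3] : Fin 4 → Fin 4) e = i ∨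
        (![0, 1, 1, 2] : Fin 4 → Fin 4) e = i
      decide
    · change ∀ e : Fin 4, (![1, 2, 2, 3] : Fin 4 → Fin 4) e = 2 ∨
        (![0, 1, 1, 2] : Fin 4 → Fin 4) e = 2 ∨ e = 0
      decide
    · change ∀ e : Fin 4, (![0, 1, 1, 2] : Fin 4 → Fin 4) e = 0 → e = 0
      decide
    · change ∀ e : Fin 4, (![0, 1, 1, 2] : Fin 4 → Fin 4) e = 1 ↔
        (![1, 2, 2, 3] : Fin 4 → Fin 4) e = 2
      decide

theorem not_isGentle_glueQuiver₂ (D : DivAlg) :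
    (∀ I : TwoSidedIdeal (glueQuiver₂ D).T, OrdinarilyGentle I (1 : Fin 4) →
      SpeciallyGentle I (2 : Fin 4) → ¬ IsGentle ℂ (Complexification I)) ∧
    ∀ I : TwoSidedIdeal (glueQuiver₂ D).op.T,
      OrdinarilyGentle (Q := (glueQuiver₂ D).op) I (1 : Fin 4) →
      SpeciallyGentle (Q := (glueQuiver₂ D).op) I (2 : Fin 4) →
        ¬ IsGentle ℂ (Complexification I) := by
  constructor
  · intro I hu hv h
    refine not_isLocallyGentle_glue_out (Q := glueQuiver₂ D) (ρ := ![0, 1, 2, 3])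
      (c := (0 : Fin 5)) ?_ (fun _ => rfl) ?_ ?_ ?_ rfl ?_ ⟨(1 : Fin 5), rfl⟩ ⟨(3 : Fin 5), rfl⟩ rfl
      hu hv h.1
    · intro a
      change Fin 5 at a
      fin_cases a <;> rfl
    · change ∀ i : Fin 4, ∃ e : Fin 5, (![0, 1, 1, 2, 2] : Fin 5 → Fin 4) e = i ∨
        (![1, 2, 2, 3, 3] : Fin 5 → Fin 4) e = i
      decide
    · change ∀ e : Fin 5, (![0, 1, 1, 2, 2] : Fin 5 → Fin 4) e = 2 ∨
        (![1, 2, 2, 3, 3] : Fin 5 → Fin 4) e = 2 ∨ e = 0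
      decide
    · change ∀ e : Fin 5, (![0, 1, 1, 2, 2] : Fin 5 → Fin 4) e = 0 → e = 0
      decide
    · change ∀ e : Fin 5, (![0, 1, 1, 2, 2] : Fin 5 → Fin 4) e = 1 ↔
        (![1, 2, 2, 3, 3] : Fin 5 → Fin 4) e = 2
      decide
  · intro I hu hv h
    refine not_isLocallyGentle_glue_in (Q := (glueQuiver₂ D).op) (ρ := ![3, 2, 1, 0])
      (c := (0 : Fin 5)) ?_ (fun _ => rfl) ?_ ?_ ?_ rfl ?_ ⟨(3 : Fin 5), rfl⟩ ⟨(1 : Fin 5), rfl⟩ rfl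
      hu hv h.1
    · intro a
      change Fin 5 at a
      fin_cases a <;> rfl
    · change ∀ i : Fin 4, ∃ e : Fin 5, (![1, 2, 2, 3, 3] : Fin 5 → Fin 4) e = i ∨
        (![0, 1, 1, 2, 2] : Fin 5 → Fin 4) e = i
      decide
    · change ∀ e : Fin 5, (![1, 2, 2, 3, 3] : Fin 5 → Fin 4) e = 2 ∨
        (![0, 1, 1, 2, 2] : Fin 5 → Fin 4) e = 2 ∨ e = 0
      decide
    · change ∀ e : Fin 5, (![0, 1, 1, 2, 2] : Fin 5 → Fin 4) e = 0 → e = 0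
      decide
    · change ∀ e : Fin 5, (![0, 1, 1, 2, 2] : Fin 5 → Fin 4) e = 1 ↔
        (![1, 2, 2, 3, 3] : Fin 5 → Fin 4) e = 2
      decide

end ModQuiver

end

theorem mainTheorem9 :
    (∀ Q : ModQuiver, PathCase Q →
      (∀ I : TwoSidedIdeal Q.T, I ≤ Q.arrowIdealSq →
        ¬ IsGentle ℂ (ModQuiver.Complexification I)) ∧
      (∀ I : TwoSidedIdeal Q.op.T, I ≤ Q.op.arrowIdealSq →
        ¬ IsGentle ℂ (ModQuiver.Complexification I))) ∧
    (∀ (Q : ModQuiver) (u v : Q.V), GlueCase Q u v →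
      (∀ I : TwoSidedIdeal Q.T,
        ModQuiver.OrdinarilyGentle I u → ModQuiver.SpeciallyGentle I v →
          ¬ IsGentle ℂ (ModQuiver.Complexification I)) ∧
      (∀ I : TwoSidedIdeal Q.op.T,
        ModQuiver.OrdinarilyGentle (Q := Q.op) I u → ModQuiver.SpeciallyGentle (Q := Q.op) I v →
          ¬ IsGentle ℂ (ModQuiver.Complexification I))) := by
  constructor
  · intro Q h
    cases h <;> exact ModQuiver.not_isGentle_pathQuiver (by decide) (by decide)
  · intro Q u v h
    cases h
    · exact ModQuiver.not_isGentle_glueQuiver₂ _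
    · exact ModQuiver.not_isGentle_glueQuiver _ _
    · exact ModQuiver.not_isGentle_glueQuiver _ _
    · exact ModQuiver.not_isGentle_glueQuiver _ _
    · exact ModQuiver.not_isGentle_glueQuiver₂ _
    · exact ModQuiver.not_isGentle_glueQuiver _ _
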